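/- Let $\Omega\subset\mathbb R^2$ be a bounded connected open set with Lipschitz boundary, let $\Gamma\subset\partial\Omega$ be a Borel set with $\mathcal H^1(\Gamma)>0$, let $h>0$, $E>0$ and $-1<\nu<1/2$. For $2\times2$ symmetric matrices $A$ put $|A|^2=\sum_{i,j}A_{ij}^2$, $A:B=\sum_{i,j}A_{ij}B_{ij}$, $J(A)=\frac{E}{2(1+\nu)}|A|^2+\frac{E\nu}{2(1-\nu^2)}(\operatorname{Tr}A)^2$ and $J'(A)=\frac{E}{1+\nu}A+\frac{E\nu}{1-\nu^2}(\operatorname{Tr}A)I$. For $\mathbf u\in H^1(\Omega,\mathbb R^2)$ put $\mathbb E(\mathbf u)=\frac12(D\mathbf u+D\mathbf u^T)$. Let $\mathbf f_h\in L^2(\partial\Omega,\mathbb R^2)$ satisfy $\int_{\partial\Omega}\mathbf f_h\cdot\mathbf z\,d\mathcal H^1=0$ for all $\mathbf z\in H^1(\Omega,\mathbb R^2)$ with $\mathbb E(\mathbf z)=0$. For $(\mathbf u,w)\in H^1(\Omega,\mathbb R^2)\times H^2(\Omega)$ define $$F_h^b(w)=\frac{h^3}{12}\int_\Omega J(D^2w)\,dx,\qquad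 \mathcal F_h(\mathbf u,w)=h\int_\Omega J\big(\mathbb E(\mathbf u)+\tfrac12Dw\otimes Dw\big)dx+F_h^b(w)-h\int_{\partial\Omega}\mathbf f_h\cdot\mathbf u\,d\mathcal H^1 .$$ Let $\mathcal A^0=\{w\in H^2(\Omega): w=\partial w/\partial\mathbf n=0\text{ on }\Gamma\}$, $\mathcal A^1=\{w\in H^2(\Omega): w=0\text{ on }\Gamma\}$ (in the sense of traces, $\mathbf n$ being the unit outer normal) and $\mathcal A^2=H^2(\Omega)$. For $i\in\{0,1,2\}$ let $\mathcal F^i_h(\mathbf u,w)=\mathcal F_h(\mathbf u,w)$ if $w\in\mathcal A^i$ and $+\infty$ otherwise; for $\varepsilon>0$ let $\mathcal F^i_{h,\varepsilon}(\mathbf u,w)=\mathcal F^i_h(\mathbf u,\varepsilon w)$; let $\mathcal F_{h,0}(\mathbf u)=\mathcal F_h(\mathbf u,0)$. Then $\mathcal F_{h,0}$ attains its minimum over $H^1(\Omega,\mathbb R^2)$, and, for every $i\in\{0,1,2\}$, the functionals $$\mathcal E^i_{h,\varepsilon}(\mathbf u,w)=\varepsilon^{-2}\Big(\mathcal F^i_{h,\varepsilon}(\mathbf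 u,w)-\min_{H^1(\Omega,\mathbb R^2)}\mathcal F_{h,0}\Big)$$ $\Gamma$-converge as $\varepsilon\to0^+$, with respect to weak convergence in $H^1(\Omega,\mathbb R^2)\times H^2(\Omega)$, to $$\mathcal E^i_h(\mathbf u,w)=\begin{cases}F_h^b(w)+\frac h2\int_\Omega J'(\mathbb E(\mathbf u)):Dw\otimes Dw\,dx&\text{if }\mathbf u\in\operatorname{argmin}\mathcal F_{h,0}\text{ and }w\in\mathcal A^i,\\+\infty&\text{otherwise.}\end{cases}$$ Precisely: (i) if $(\mathbf u_\varepsilon,w_\varepsilon)\rightharpoonup(\mathbf u,w)$ weakly in $H^1(\Omega,\mathbb R^2)\times H^2(\Omega)$ as $\varepsilon\to0^+$, then $\liminf_{\varepsilon\to0^+}\mathcal E^i_{h,\varepsilon}(\mathbf u_\varepsilon,w_\varepsilon)\ge\mathcal E^i_h(\mathbf u,w)$; (ii) for every $(\mathbf u,w)\in H^1(\Omega,\mathbb R^2)\times H^2(\Omega)$ there are $(\widetilde{\mathbf u}_\varepsilon,\widetilde w_\varepsilon)\rightharpoonup(\mathbf u,w)$ weakly in $H^1(\Omega,\mathbb R^2)\times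 H^2(\Omega)$ with $\lim_{\varepsilon\to0^+}\mathcal E^i_{h,\varepsilon}(\widetilde{\mathbf u}_\varepsilon,\widetilde w_\varepsilon)=\mathcal E^i_h(\mathbf u,w)$. -/

import Mathlib

open MeasureTheory Filter Topology Set
open scoped ENNReal NNReal ContDiff

noncomputable section

namespace FvK

/-- The Euclidean plane. -/
abbrev Plane : Type := EuclideanSpace ℝ (Fin 2)

/-- Partial derivative in the `i`-th coordinate direction of a smooth function on the plane. -/
def pderiv (i : Fin 2) (φ : Plane → ℝ) (x : Plane) : ℝ :=
  fderiv ℝ φ x (EuclideanSpace.single i 1)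

/-! ### Domains -/

/-- Bounded connected open sets with Lipschitz boundary: near each boundary point, after a
linear isometric change of coordinates, `Ω` is the strict epigraph of a Lipschitz function. -/
structure IsLipschitzDomain (Ω : Set Plane) : Prop where
  isOpen : IsOpen Ω
  isConnected : IsConnected Ω
  isBounded : Bornology.IsBounded Ω
  lipschitz_boundary : ∀ x ∈ frontier Ω, ∃ (A : Plane ≃ₗᵢ[ℝ] Plane) (K : ℝ≥0) (γ : ℝ → ℝ)
    (r : ℝ), LipschitzWith K γ ∧ 0 < r ∧
      ∀ y ∈ Metric.ball x r, y ∈ Ω ↔ γ ((A y) 0) < (A y) 1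

/-- `n` is the unit outer normal to `Ω` at the boundary point `x`: near `x`, every cone with vertex
`x`, axis `-n` and half-angle less than `π / 2` lies inside `Ω`, and every such cone with axis `n`
lies outside `Ω`. At a boundary point
of a Lipschitz domain such an `n` exists exactly when the local graph is differentiable there,
hence at almost every boundary point, and it is unique. -/
def IsOuterNormal (Ω : Set Plane) (x n : Plane) : Prop :=
  ‖n‖ = 1 ∧ ∀ η : ℝ, 0 < η → ∃ δ > 0, ∀ y ∈ Metric.ball x δ,
    (η * ‖y - x‖ < inner ℝ (y - x) n → y ∉ Ω) ∧
    (inner ℝ (y - x) n < -(η * ‖y - x‖) → y ∈ Ω)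

/-- One-dimensional Hausdorff measure on the boundary of `Ω`. -/
def bdryMeasure (Ω : Set Plane) : Measure Plane :=
  (Measure.hausdorffMeasure 1 : Measure Plane).restrict (frontier Ω)

/-! ### Sobolev spaces -/

/-- The Lebesgue space of square integrable functions on `Ω`. -/
abbrev L2 (Ω : Set Plane) : Type := Lp ℝ 2 ((volume : Measure Plane).restrict Ω)

/-- `g` is the distributional `i`-th partial derivative of `f` in `Ω`. -/
def IsWeakDeriv {Ω : Set Plane} (i : Fin 2) (f g : L2 Ω) : Prop :=
  ∀ φ : Plane → ℝ, ContDiff ℝ ∞ φ → HasCompactSupport φ → tsupport φ ⊆ Ω →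
    ∫ x in Ω, f x * pderiv i φ x = -∫ x in Ω, g x * φ x

theorem integrable_mul_pderiv {Ω : Set Plane} (f : L2 Ω) (i : Fin 2) {φ : Plane → ℝ}
    (h1 : ContDiff ℝ ∞ φ) (h2 : HasCompactSupport φ) :
    Integrable (fun x => f x * pderiv i φ x) ((volume : Measure Plane).restrict Ω) := by
  have hc : Continuous (pderiv i φ) := by
    have := h1.continuous_fderiv (by simp)
    exact this.clm_apply continuous_const
  have hs : HasCompactSupport (pderiv i φ) := h2.fderiv_apply (𝕜 := ℝ) _
  exact MemLp.integrable_mul (p := 2) (q := 2) (Lp.memLp f)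
    (hc.memLp_of_hasCompactSupport hs)

theorem integrable_mul_test {Ω : Set Plane} (f : L2 Ω) {φ : Plane → ℝ}
    (h1 : ContDiff ℝ ∞ φ) (h2 : HasCompactSupport φ) :
    Integrable (fun x => f x * φ x) ((volume : Measure Plane).restrict Ω) :=
  MemLp.integrable_mul (p := 2) (q := 2) (Lp.memLp f)
    (h1.continuous.memLp_of_hasCompactSupport h2)

theorem IsWeakDeriv.zero (Ω : Set Plane) (i : Fin 2) :
    IsWeakDeriv i (0 : L2 Ω) (0 : L2 Ω) := by
  intro φ _ _ _
  have h := Lp.coeFn_zero ℝ 2 ((volume : Measure Plane).restrict Ω)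
  have e : ∀ ψ : Plane → ℝ, ∫ x in Ω, (0 : L2 Ω) x * ψ x = 0 := by
    intro ψ
    rw [integral_congr_ae (g := fun _ => (0 : ℝ))]
    · simp
    · filter_upwards [h] with x hx
      rw [hx, Pi.zero_apply, zero_mul]
  rw [e, e, neg_zero]

theorem IsWeakDeriv.add {Ω : Set Plane} {i : Fin 2} {f g f' g' : L2 Ω}
    (h : IsWeakDeriv i f g) (h' : IsWeakDeriv i f' g') :
    IsWeakDeriv i (f + f') (g + g') := by
  intro φ h1 h2 h3
  have e : ∀ (a b : L2 Ω) (ψ : Plane → ℝ),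
      ∫ x in Ω, (a + b) x * ψ x = ∫ x in Ω, (a x * ψ x + b x * ψ x) := by
    intro a b ψ
    refine integral_congr_ae ?_
    filter_upwards [Lp.coeFn_add a b] with x hx
    rw [hx, Pi.add_apply, add_mul]
  rw [e, e, integral_add (integrable_mul_pderiv f i h1 h2) (integrable_mul_pderiv f' i h1 h2),
    integral_add (integrable_mul_test g h1 h2) (integrable_mul_test g' h1 h2),
    h φ h1 h2 h3, h' φ h1 h2 h3]
  ring

theorem IsWeakDeriv.smul {Ω : Set Plane} {i : Fin 2} {f g : L2 Ω} (c : ℝ)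
    (h : IsWeakDeriv i f g) : IsWeakDeriv i (c • f) (c • g) := by
  intro φ h1 h2 h3
  have e : ∀ (a : L2 Ω) (ψ : Plane → ℝ),
      ∫ x in Ω, (c • a) x * ψ x = ∫ x in Ω, c * (a x * ψ x) := by
    intro a ψ
    refine integral_congr_ae ?_
    filter_upwards [Lp.coeFn_smul c a] with x hx
    rw [hx, Pi.smul_apply, smul_eq_mul, mul_assoc]
  rw [e, e, integral_const_mul, integral_const_mul, h φ h1 h2 h3]
  ring

/-- The Sobolev space `H¹(Ω)`: a function in `L²(Ω)` together with its distributional gradient in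
`L²(Ω)` (which it determines), normed by `‖u‖² + ‖∂₀ u‖² + ‖∂₁ u‖²`. -/
def H1 (Ω : Set Plane) : Submodule ℝ (WithLp 2 (L2 Ω × PiLp 2 (fun _ : Fin 2 => L2 Ω))) where
  carrier := {u | ∀ i, IsWeakDeriv i u.fst (u.snd i)}
  zero_mem' := fun i => IsWeakDeriv.zero Ω i
  add_mem' := fun hu hv i => (hu i).add (hv i)
  smul_mem' := fun c _ hu i => (hu i).smul c

/-- The underlying function of an element of `H¹(Ω)`. -/
def valH1 {Ω : Set Plane} (u : H1 Ω) : L2 Ω := u.1.fst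

/-- The `i`-th weak partial derivative of an element of `H¹(Ω)`. -/
def derivH1 {Ω : Set Plane} (u : H1 Ω) (i : Fin 2) : L2 Ω := u.1.snd i

/-- The Sobolev space `H²(Ω)`: a function in `L²(Ω)` together with its distributional partial
derivatives, which lie in `H¹(Ω)`; the squared norm is the sum of the squared `L²(Ω)` norms of `w`
and of all its partial derivatives of order one and two. -/
def H2 (Ω : Set Plane) : Submodule ℝ (WithLp 2 (L2 Ω × PiLp 2 (fun _ : Fin 2 => H1 Ω))) where
  carrier := {w | ∀ i, IsWeakDeriv i w.fst (valH1 (w.snd i))}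
  zero_mem' := fun i => IsWeakDeriv.zero Ω i
  add_mem' := fun hu hv i => (hu i).add (hv i)
  smul_mem' := fun c _ hu i => (hu i).smul c

/-- The `i`-th weak partial derivative of an element of `H²(Ω)`, as an element of `H¹(Ω)`. -/
def derivH2 {Ω : Set Plane} (w : H2 Ω) (i : Fin 2) : H1 Ω := w.1.snd i

/-- The inclusion of `H²(Ω)` in `H¹(Ω)`. -/
def toH1 {Ω : Set Plane} (w : H2 Ω) : H1 Ω :=
  ⟨WithLp.toLp 2 (w.1.fst, WithLp.toLp 2 fun i => valH1 (derivH2 w i)), fun i => w.2 i⟩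

/-- The space `H¹(Ω, ℝ²)` of vector fields with components in `H¹(Ω)`. -/
abbrev H1Vec (Ω : Set Plane) : Type := PiLp 2 (fun _ : Fin 2 => H1 Ω)

/-! ### Traces -/

/-- `g` is the boundary trace of `u`: some sequence of smooth functions on the plane converges
to `u` in `H¹(Ω)` while its boundary values converge to `g` in `L²(∂Ω)`. -/
def IsTrace (Ω : Set Plane) (u : H1 Ω) (g : Lp ℝ 2 (bdryMeasure Ω)) : Prop :=
  ∃ φ : ℕ → Plane → ℝ, (∀ k, ContDiff ℝ ∞ (φ k)) ∧
    Tendsto (fun k => eLpNorm (fun x => φ k x - valH1 u x) 2 (volume.restrict Ω)) atTop (𝓝 0) ∧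
    (∀ i, Tendsto (fun k => eLpNorm (fun x => pderiv i (φ k) x - derivH1 u i x) 2
      (volume.restrict Ω)) atTop (𝓝 0)) ∧
    Tendsto (fun k => eLpNorm (fun x => φ k x - g x) 2 (bdryMeasure Ω)) atTop (𝓝 0)

open Classical in
/-- The boundary trace in `L²(∂Ω)`. On a bounded Lipschitz domain each element of `H¹(Ω)` has
exactly one trace; the value `0` is a convention that is never used there. -/
def trace {Ω : Set Plane} (u : H1 Ω) : Lp ℝ 2 (bdryMeasure Ω) :=
  if h : ∃ g, IsTrace Ω u g then h.choose else 0

/-- The function vanishes on `Γ` in the sense of traces. -/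
def VanishesOn {Ω : Set Plane} (Γ : Set Plane) (w : H2 Ω) : Prop :=
  ∀ᵐ x ∂((Measure.hausdorffMeasure 1 : Measure Plane).restrict Γ), trace (toH1 w) x = 0

/-- The normal derivative vanishes on `Γ` in the sense of traces. -/
def NormalDerivVanishesOn {Ω : Set Plane} (Γ : Set Plane) (w : H2 Ω) : Prop :=
  ∀ᵐ x ∂((Measure.hausdorffMeasure 1 : Measure Plane).restrict Γ),
    ∀ n : Plane, IsOuterNormal Ω x n → ∑ i, trace (derivH2 w i) x * n i = 0

/-- The classes of admissible out-of-plane displacements: clamped on `Γ` (`i = 0`), simply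
supported on `Γ` (`i = 1`), free (`i = 2`). -/
def admissible (Ω Γ : Set Plane) : Fin 3 → Set (H2 Ω)
  | 0 => {w | VanishesOn Γ w ∧ NormalDerivVanishesOn Γ w}
  | 1 => {w | VanishesOn Γ w}
  | 2 => Set.univ

/-! ### Strains and energies -/

/-- The energy density `J`, for Young modulus `Y` and Poisson ratio `ν`. -/
def J (Y ν : ℝ) (A : Matrix (Fin 2) (Fin 2) ℝ) : ℝ :=
  Y / (2 * (1 + ν)) * (∑ i, ∑ j, A i j ^ 2) + Y * ν / (2 * (1 - ν ^ 2)) * A.trace ^ 2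

/-- The derivative `J'` of the energy density. -/
def J' (Y ν : ℝ) (A : Matrix (Fin 2) (Fin 2) ℝ) : Matrix (Fin 2) (Fin 2) ℝ :=
  (Y / (1 + ν)) • A + (Y * ν / (1 - ν ^ 2) * A.trace) • (1 : Matrix (Fin 2) (Fin 2) ℝ)

/-- The product `A : B` of two matrices. -/
def frob (A B : Matrix (Fin 2) (Fin 2) ℝ) : ℝ := ∑ i, ∑ j, A i j * B i j

variable {Ω : Set Plane}

/-- The linearized strain `E(u) = (Du + Duᵀ) / 2`. -/
def strain (u : H1Vec Ω) (x : Plane) : Matrix (Fin 2) (Fin 2) ℝ :=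
  Matrix.of fun i j => (derivH1 (u i) j x + derivH1 (u j) i x) / 2

/-- The tensor `Dw ⊗ Dw`. -/
def gradTensor (w : H2 Ω) (x : Plane) : Matrix (Fin 2) (Fin 2) ℝ :=
  Matrix.of fun i j => valH1 (derivH2 w i) x * valH1 (derivH2 w j) x

/-- The Hessian `D²w`. -/
def hess (w : H2 Ω) (x : Plane) : Matrix (Fin 2) (Fin 2) ℝ :=
  Matrix.of fun i j => derivH1 (derivH2 w i) j x

/-- The stretching tensor `D(u, w) = E(u) + (Dw ⊗ Dw) / 2`. -/
def stretching (u : H1Vec Ω) (w : H2 Ω) (x : Plane) : Matrix (Fin 2) (Fin 2) ℝ :=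
  strain u x + (1 / 2 : ℝ) • gradTensor w x

/-- The work of the boundary load `f`, before multiplication by the thickness. -/
def loadWork (f : Plane → Plane) (u : H1Vec Ω) : ℝ :=
  ∫ x, ∑ i, f x i * trace (u i) x ∂(bdryMeasure Ω)

/-- The load `f` does no work on infinitesimal rigid displacements. -/
def Equilibrated (Ω : Set Plane) (f : Plane → Plane) : Prop :=
  ∀ z : H1Vec Ω, (∀ᵐ x ∂((volume : Measure Plane).restrict Ω), strain z x = 0) →
    loadWork f z = 0

/-- The bending energy. -/
def bendingEnergy (Y ν h : ℝ) (w : H2 Ω) : ℝ :=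
  h ^ 3 / 12 * ∫ x in Ω, J Y ν (hess w x)

/-- The membrane energy. -/
def membraneEnergy (Y ν h : ℝ) (u : H1Vec Ω) (w : H2 Ω) : ℝ :=
  h * ∫ x in Ω, J Y ν (stretching u w x)

/-- The Föppl-von Kármán functional under the in-plane boundary load `f`, with no out-of-plane
load. -/
def energy (Y ν h : ℝ) (f : Plane → Plane) (u : H1Vec Ω) (w : H2 Ω) : ℝ :=
  membraneEnergy Y ν h u w + bendingEnergy Y ν h w - h * loadWork f u

open Classical in
/-- The Föppl-von Kármán functional with the boundary conditions on `w` enclosed in it. -/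
def energyBC (Γ : Set Plane) (i : Fin 3) (Y ν h : ℝ) (f : Plane → Plane) (u : H1Vec Ω)
    (w : H2 Ω) : EReal :=
  if w ∈ admissible Ω Γ i then (energy Y ν h f u w : EReal) else ⊤

/-- The functional of the flat plate. -/
def flatEnergy (Y ν h : ℝ) (f : Plane → Plane) (u : H1Vec Ω) : ℝ := energy Y ν h f u 0

/-- The minimizers of the functional of the flat plate over `H¹(Ω, ℝ²)`. -/
def flatArgmin (Ω : Set Plane) (Y ν h : ℝ) (f : Plane → Plane) : Set (H1Vec Ω) :=
  {u | ∀ v : H1Vec Ω, flatEnergy Y ν h f u ≤ flatEnergy Y ν h f v}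

/-- The minimum of the functional of the flat plate over `H¹(Ω, ℝ²)`. -/
def flatMin (Ω : Set Plane) (Y ν h : ℝ) (f : Plane → Plane) : ℝ :=
  ⨅ v : H1Vec Ω, flatEnergy Y ν h f v

/-- The rescaled energies `ε⁻² (F(u, ε w) - min F₀)`. -/
def rescaledEnergy (Γ : Set Plane) (i : Fin 3) (Y ν h : ℝ) (f : Plane → Plane) (ε : ℝ)
    (p : H1Vec Ω × H2 Ω) : EReal :=
  (((ε ^ 2)⁻¹ : ℝ) : EReal) * (energyBC Γ i Y ν h f p.1 (ε • p.2) - (flatMin Ω Y ν h f : EReal))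

open Classical in
/-- The limit energy. -/
def limitEnergy (Γ : Set Plane) (i : Fin 3) (Y ν h : ℝ) (f : Plane → Plane)
    (p : H1Vec Ω × H2 Ω) : EReal :=
  if p.1 ∈ flatArgmin Ω Y ν h f ∧ p.2 ∈ admissible Ω Γ i then
    ((bendingEnergy Y ν h p.2 +
      h / 2 * ∫ x in Ω, frob (J' Y ν (strain p.1 x)) (gradTensor p.2 x) : ℝ) : EReal)
  else ⊤

/-- Weak convergence of `p ε` to `q` in `H¹(Ω, ℝ²) × H²(Ω)` as `ε → 0⁺`. -/
def WeaklyTendsto (p : ℝ → H1Vec Ω × H2 Ω) (q : H1Vec Ω × H2 Ω) : Prop :=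
  Tendsto (fun ε => toWeakSpace ℝ (H1Vec Ω × H2 Ω) (p ε)) (𝓝[>] (0 : ℝ))
    (𝓝 (toWeakSpace ℝ (H1Vec Ω × H2 Ω) q))

end FvK

end

/-! Let B be the elastic bilinear form, the integral of J'(X) : Z, with Q(X) = B(X, X), and let u₀
solve the Euler-Lagrange equation of the flat plate: B(E(u₀), E(v)) is the work of the load on v,
for every v. Completing the square around u₀ (`energy_eq_add`) writes the energy at (u, εw), minus
the flat minimum, as the sum of (h/2) Q(E(u - u₀) + (ε²/2) Dw ⊗ Dw), of ε² (h/2) B(E(u₀), Dw ⊗ Dw)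
and of ε² times the bending energy of w. After division by ε² the last two terms no longer depend on
ε, and they are the limit energy, since all minimizers have the strain of u₀.

Lower bound: if the rescaled energies stay bounded above, the first term forces E(u_ε - u₀) to tend
weakly to zero, so the limit u is a minimizer. The first term is nonnegative and may then be
dropped; the bending energy is convex, and the coupling term passes to the limit because w ↦ Dw ⊗ Dw
is weak-to-strong continuous from H² to L² (`tendsto_gradF`). The boundary conditions survive
because the admissible class is closed and convex. Recovery: constant families suffice. At a
minimizer the first term is O(ε²) after rescaling; where the limit energy is infinite, the lower
bound already forces divergence.

The remaining work is analysis on Lipschitz domains. Near each boundary point Ω coincides with an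
epigraph, which is stable under translation along an open cone of directions (`IsConeOpen`).
Integration along these directions, from a point inwards, yields the trace inequality and
Ladyzhenskaya's inequality; averages along them never leave the domain, which yields density of
smooth functions and Rellich's theorem. Ladyzhenskaya and Rellich together give the weak-to-strong
continuity of products.

Korn's inequality uses the same cone. The strain determines the derivative of ξ · u in the direction
ξ, so integrating from x to infinity along ξ recovers ξ · u(x). Averaging over ξ against ∂ᵢk, for a
kernel k supported in the cone, recovers uᵢ from the strain (`IsConeOpen.integral_mul_d_eq`); one
further derivative gives a singular integral, bounded on L² by Plancherel. Korn and Rellich make the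
elastic form coercive once the rigid displacements are penalized. Lax-Milgram then gives u₀, and the
equilibrium of the load shows that the penalty term vanishes (`exists_equilibrium`). -/

noncomputable section

namespace FvK

/-! ### Test functions on the plane -/

/-- Compactly supported smooth functions on the plane. -/
def testSubmodule : Submodule ℝ (Plane → ℝ) where
  carrier := {φ | ContDiff ℝ ∞ φ ∧ HasCompactSupport φ}
  zero_mem' := ⟨contDiff_const, HasCompactSupport.zero⟩
  add_mem' := fun h h' => ⟨h.1.add h'.1, h.2.add h'.2⟩
  smul_mem' := fun c _ h => ⟨contDiff_const.smul h.1, h.2.smul_left (f := fun _ => c)⟩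

/-- Compactly supported smooth functions on the plane. -/
abbrev Test : Type := testSubmodule

namespace Test

instance : CoeFun Test (fun _ => Plane → ℝ) := ⟨fun φ => φ.1⟩

theorem contDiff (φ : Test) : ContDiff ℝ ∞ φ := φ.2.1

theorem hasCompactSupport (φ : Test) : HasCompactSupport φ := φ.2.2

theorem continuous (φ : Test) : Continuous φ := φ.contDiff.continuous

theorem differentiable (φ : Test) : Differentiable ℝ φ := φ.contDiff.differentiable (by simp)

theorem measurable (φ : Test) : Measurable φ := φ.continuous.measurable

/-- The product of two test functions. -/
def mul (χ φ : Test) : Test := ⟨fun x => χ x * φ x, χ.contDiff.mul φ.contDiff,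
  φ.hasCompactSupport.mul_left (f := χ)⟩

@[simp] theorem mul_apply (χ φ : Test) (x : Plane) : mul χ φ x = χ x * φ x := rfl

@[simp] theorem add_apply (χ φ : Test) (x : Plane) : (χ + φ : Test) x = χ x + φ x := rfl

@[simp] theorem smul_apply (c : ℝ) (φ : Test) (x : Plane) : (c • φ : Test) x = c * φ x := rfl

@[simp] theorem sum_apply {ι : Type*} (s : Finset ι) (φ : ι → Test) (x : Plane) :
    (∑ i ∈ s, φ i : Test) x = ∑ i ∈ s, φ i x := by
  have : ((∑ i ∈ s, φ i : Test) : Plane → ℝ) = ∑ i ∈ s, (φ i : Plane → ℝ) :=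
    map_sum testSubmodule.subtype φ s
  simp [this]

/-- The partial derivative of a test function. -/
def d (i : Fin 2) (φ : Test) : Test := ⟨pderiv i φ,
  (φ.contDiff.fderiv_right (m := ∞) le_rfl).clm_apply contDiff_const,
  φ.hasCompactSupport.fderiv_apply (𝕜 := ℝ) _⟩

@[simp] theorem d_apply (i : Fin 2) (φ : Test) (x : Plane) : d i φ x = pderiv i φ x := rfl

theorem d_add (i : Fin 2) (φ ψ : Test) : d i (φ + ψ) = d i φ + d i ψ := by
  ext x
  have : ((φ + ψ : Test) : Plane → ℝ) = fun x => φ x + ψ x := rfl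
  simp only [d_apply, add_apply, pderiv, this]
  rw [fderiv_fun_add φ.differentiable.differentiableAt ψ.differentiable.differentiableAt]
  rfl

theorem d_smul (i : Fin 2) (c : ℝ) (φ : Test) : d i (c • φ) = c • d i φ := by
  ext x
  have : ((c • φ : Test) : Plane → ℝ) = fun x => c • φ x := rfl
  simp only [d_apply, smul_apply, pderiv, this]
  rw [fderiv_fun_const_smul φ.differentiable.differentiableAt]
  rfl

theorem d_mul (i : Fin 2) (χ φ : Test) : d i (mul χ φ) = mul χ (d i φ) + mul (d i χ) φ := by
  ext x
  have : ((mul χ φ : Test) : Plane → ℝ) = fun x => χ x * φ x := rfl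
  simp only [d_apply, mul_apply, add_apply, pderiv, this]
  rw [fderiv_fun_mul χ.differentiable.differentiableAt φ.differentiable.differentiableAt]
  simp [mul_comm]

theorem tsupport_mul_subset_left (χ φ : Test) : tsupport (mul χ φ) ⊆ tsupport χ :=
  closure_mono (Function.support_mul_subset_left χ φ)

theorem tsupport_mul_subset_right (χ φ : Test) : tsupport (mul χ φ) ⊆ tsupport φ :=
  closure_mono (Function.support_mul_subset_right χ φ)

theorem tsupport_d_subset (i : Fin 2) (φ : Test) : tsupport (d i φ) ⊆ tsupport φ :=
  tsupport_fderiv_apply_subset ℝ _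

theorem fderiv_apply (φ : Test) (x v : Plane) :
    fderiv ℝ φ x v = ∑ i, v i * d i φ x := by
  have hv : v = ∑ i, v i • EuclideanSpace.single i (1 : ℝ) := by
    ext j
    fin_cases j <;> simp
  conv_lhs => rw [hv]
  simp [pderiv]

theorem memLp (φ : Test) (p : ℝ≥0∞) (μ : Measure Plane) [IsFiniteMeasureOnCompacts μ] :
    MemLp φ p μ := φ.continuous.memLp_of_hasCompactSupport φ.hasCompactSupport

theorem integrable (φ : Test) (μ : Measure Plane) [IsFiniteMeasureOnCompacts μ] :
    Integrable φ μ := φ.continuous.integrable_of_hasCompactSupport φ.hasCompactSupport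

theorem integral_mul_d (φ ψ : Test) (i : Fin 2) :
    ∫ x, φ x * d i ψ x = -∫ x, d i φ x * ψ x := by
  refine integral_mul_fderiv_eq_neg_fderiv_mul_of_integrable ?_ ?_ ?_
    (fun x _ => φ.differentiable x) (fun x _ => ψ.differentiable x)
  · exact (mul (d i φ) ψ).integrable _
  · exact (mul φ (d i ψ)).integrable _
  · exact (mul φ ψ).integrable _

theorem setIntegral_mul_d {Ω : Set Plane} (φ ψ : Test) (hψ : tsupport ψ ⊆ Ω) (i : Fin 2) :
    ∫ x in Ω, φ x * d i ψ x = -∫ x in Ω, d i φ x * ψ x := by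
  rw [setIntegral_eq_integral_of_forall_compl_eq_zero,
    setIntegral_eq_integral_of_forall_compl_eq_zero, integral_mul_d]
  · intro x hx
    rw [image_eq_zero_of_notMem_tsupport (fun h => hx (hψ h)), mul_zero]
  · intro x hx
    rw [image_eq_zero_of_notMem_tsupport (f := d i ψ)
      (fun h => hx (hψ (tsupport_d_subset i ψ h))), mul_zero]

/-- The class of a test function in `L²(Ω)`. -/
def toL2 (Ω : Set Plane) : Test →ₗ[ℝ] L2 Ω where
  toFun φ := (memLp φ 2 _).toLp φ
  map_add' _ _ := rfl
  map_smul' _ _ := rfl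

theorem coeFn_toL2 (Ω : Set Plane) (φ : Test) : toL2 Ω φ =ᵐ[volume.restrict Ω] φ :=
  MemLp.coeFn_toLp (memLp φ 2 _)

/-- The restriction of a test function to `Ω`, as an element of `H¹(Ω)`. -/
def toH1 (Ω : Set Plane) : Test →ₗ[ℝ] H1 Ω where
  toFun φ := ⟨WithLp.toLp 2 (toL2 Ω φ, WithLp.toLp 2 fun i => toL2 Ω (d i φ)), by
    intro i η h1 h2 h3
    have := setIntegral_mul_d φ ⟨η, h1, h2⟩ h3 i
    calc _ = ∫ x in Ω, φ x * d i ⟨η, h1, h2⟩ x := by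
          refine integral_congr_ae ?_
          filter_upwards [coeFn_toL2 Ω φ] with x hx
          simp [hx]
      _ = -∫ x in Ω, d i φ x * η x := this
      _ = _ := by
          congr 1
          refine integral_congr_ae ?_
          filter_upwards [coeFn_toL2 Ω (d i φ)] with x hx
          simp [hx]⟩
  map_add' φ ψ := by
    ext1
    simp only [d_add, map_add]
    rfl
  map_smul' c φ := by
    ext1
    simp only [d_smul, map_smul]
    rfl

@[simp] theorem valH1_toH1 (Ω : Set Plane) (φ : Test) : valH1 (toH1 Ω φ) = toL2 Ω φ := rfl

@[simp] theorem derivH1_toH1 (Ω : Set Plane) (φ : Test) (i : Fin 2) :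
    derivH1 (toH1 Ω φ) i = toL2 Ω (d i φ) := rfl

/-- The squared length of the gradient. -/
def gradSq (φ : Test) (x : Plane) : ℝ := ∑ i, d i φ x ^ 2

theorem gradSq_nonneg (φ : Test) (x : Plane) : 0 ≤ gradSq φ x :=
  Finset.sum_nonneg fun _ _ => sq_nonneg _

theorem integrable_sq (φ : Test) (μ : Measure Plane) [IsFiniteMeasureOnCompacts μ] :
    Integrable (fun x => φ x ^ 2) μ :=
  ((mul φ φ).integrable μ).congr (.of_forall fun x => by simp [sq])

theorem continuous_gradSq (φ : Test) : Continuous (gradSq φ) :=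
  continuous_finsetSum _ fun i _ => (d i φ).continuous.pow 2

theorem integrable_gradSq (φ : Test) (μ : Measure Plane) [IsFiniteMeasureOnCompacts μ] :
    Integrable (gradSq φ) μ :=
  integrable_finsetSum _ fun i _ => (d i φ).integrable_sq μ

theorem sq_fderiv_apply_le (φ : Test) (x v : Plane) :
    (fderiv ℝ φ x v) ^ 2 ≤ ‖v‖ ^ 2 * gradSq φ x := by
  rw [fderiv_apply, EuclideanSpace.real_norm_sq_eq, gradSq]
  exact Finset.sum_mul_sq_le_sq_mul_sq _ _ _

theorem norm_toL2_sq (Ω : Set Plane) (φ : Test) : ‖toL2 Ω φ‖ ^ 2 = ∫ x in Ω, φ x ^ 2 := by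
  rw [← real_inner_self_eq_norm_sq, L2.inner_def]
  refine integral_congr_ae ?_
  filter_upwards [coeFn_toL2 Ω φ] with x hx
  simp [hx]

end Test

/-! ### Hilbert norms and bounded maps on H¹ and H², and the Cauchy-Schwarz inequality. -/

theorem norm_sq_H1 {Ω : Set Plane} (u : H1 Ω) :
    ‖u‖ ^ 2 = ‖valH1 u‖ ^ 2 + ∑ i, ‖derivH1 u i‖ ^ 2 := by
  have h1 : ‖u‖ = ‖u.1‖ := rfl
  rw [h1, WithLp.prod_norm_sq_eq_of_L2, PiLp.norm_sq_eq_of_L2]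
  rfl

theorem Test.norm_toH1_sq (Ω : Set Plane) (φ : Test) :
    ‖toH1 Ω φ‖ ^ 2 = (∫ x in Ω, φ x ^ 2) + ∫ x in Ω, gradSq φ x := by
  rw [norm_sq_H1]
  simp only [valH1_toH1, derivH1_toH1, norm_toL2_sq, gradSq]
  rw [integral_finsetSum _ fun i _ => (d i φ).integrable_sq _]

/-- The underlying function, as a continuous linear map. -/
def valL (Ω : Set Plane) : H1 Ω →L[ℝ] L2 Ω :=
  (WithLp.fstL 2 ℝ _ _).comp (H1 Ω).subtypeL

@[simp] theorem valL_apply {Ω : Set Plane} (u : H1 Ω) : valL Ω u = valH1 u := rfl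

/-- The weak partial derivative, as a continuous linear map. -/
def derivL (Ω : Set Plane) (i : Fin 2) : H1 Ω →L[ℝ] L2 Ω :=
  ((PiLp.proj 2 _ i).comp (WithLp.sndL 2 ℝ _ _)).comp (H1 Ω).subtypeL

@[simp] theorem derivL_apply {Ω : Set Plane} (u : H1 Ω) (i : Fin 2) :
    derivL Ω i u = derivH1 u i := rfl

/-- The weak partial derivative on `H²(Ω)`, as a continuous linear map to `H¹(Ω)`. -/
def derivH2L (Ω : Set Plane) (i : Fin 2) : H2 Ω →L[ℝ] H1 Ω :=
  ((PiLp.proj 2 _ i).comp (WithLp.sndL 2 ℝ _ _)).comp (H2 Ω).subtypeL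

theorem norm_sq_H2 {Ω : Set Plane} (w : H2 Ω) :
    ‖w‖ ^ 2 = ‖valH1 (toH1 w)‖ ^ 2 + ∑ i, ‖derivH2 w i‖ ^ 2 := by
  rw [Submodule.coe_norm, WithLp.prod_norm_sq_eq_of_L2, PiLp.norm_sq_eq_of_L2]
  rfl

/-- The inclusion of `H²(Ω)` in `H¹(Ω)`, as a linear map. -/
def toH1ₗ (Ω : Set Plane) : H2 Ω →ₗ[ℝ] H1 Ω where
  toFun := toH1
  map_add' _ _ := rfl
  map_smul' _ _ := rfl

theorem norm_toH1_le {Ω : Set Plane} (w : H2 Ω) : ‖toH1 w‖ ≤ ‖w‖ := by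
  refine le_of_sq_le_sq ?_ (norm_nonneg _)
  rw [norm_sq_H1, norm_sq_H2]
  refine add_le_add le_rfl (Finset.sum_le_sum fun i _ => ?_)
  rw [norm_sq_H1 (derivH2 w i)]
  exact le_add_of_nonneg_right (Finset.sum_nonneg fun _ _ => sq_nonneg _)

/-- The inclusion of `H²(Ω)` in `H¹(Ω)`, as a continuous linear map. -/
def toH1L (Ω : Set Plane) : H2 Ω →L[ℝ] H1 Ω :=
  (toH1ₗ Ω).mkContinuous 1 fun w => by
    rw [one_mul]
    exact norm_toH1_le w

@[simp] theorem toH1L_apply {Ω : Set Plane} (w : H2 Ω) : toH1L Ω w = toH1 w := rfl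

/-- The Cauchy-Schwarz inequality for square integrable functions. -/
theorem sq_integral_mul_le {α : Type*} [MeasurableSpace α] {μ : Measure α} {f g : α → ℝ}
    (hf : MemLp f 2 μ) (hg : MemLp g 2 μ) :
    (∫ x, f x * g x ∂μ) ^ 2 ≤ (∫ x, f x ^ 2 ∂μ) * ∫ x, g x ^ 2 ∂μ := by
  have key : ∀ {f g : α → ℝ} (hf : MemLp f 2 μ) (hg : MemLp g 2 μ),
      inner ℝ (hf.toLp f) (hg.toLp g) = ∫ x, f x * g x ∂μ := by
    intro f g hf hg
    rw [L2.inner_def]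
    refine integral_congr_ae ?_
    filter_upwards [hf.coeFn_toLp, hg.coeFn_toLp] with x h1 h2
    simp [h1, h2, mul_comm]
  have h := real_inner_mul_inner_self_le (hf.toLp f) (hg.toLp g)
  rw [key hf hg, key hf hf, key hg hg] at h
  simpa [sq] using h

/-! ### Open sets that contain a cone of directions -/

/-- `U` is open and stable under translation by positive multiples of the vectors in a ball that
does not contain the origin. -/
structure IsConeOpen (U : Set Plane) (ξ₀ : Plane) (ρ : ℝ) : Prop where
  isOpen : IsOpen U
  pos : 0 < ρ
  le_norm : ρ ≤ ‖ξ₀‖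
  add_mem : ∀ y ∈ U, ∀ ξ ∈ Metric.ball ξ₀ ρ, ∀ t : ℝ, 0 < t → y + t • ξ ∈ U

theorem IsConeOpen.ne_zero {U : Set Plane} {ξ₀ : Plane} {ρ : ℝ} (h : IsConeOpen U ξ₀ ρ)
    {ξ : Plane} (hξ : ξ ∈ Metric.ball ξ₀ ρ) : ξ ≠ 0 := by
  rintro rfl
  have := h.le_norm
  rw [mem_ball_iff_norm', sub_zero] at hξ
  linarith

namespace Test

theorem hasCompactSupport_ray (φ : Test) (x : Plane) {ξ : Plane} (hξ : ξ ≠ 0) :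
    HasCompactSupport fun t : ℝ => φ (x + t • ξ) := by
  have h1 : IsClosedEmbedding fun t : ℝ => x + t • ξ :=
    (Homeomorph.addLeft x).isClosedEmbedding.comp (isClosedEmbedding_smul_left hξ)
  exact φ.hasCompactSupport.comp_isClosedEmbedding h1

theorem hasDerivAt_ray (φ : Test) (x ξ : Plane) (t : ℝ) :
    HasDerivAt (fun t : ℝ => φ (x + t • ξ)) (fderiv ℝ φ (x + t • ξ) ξ) t := by
  have h1 : HasDerivAt (fun t : ℝ => x + t • ξ) ξ t := by
    simpa using ((hasDerivAt_id t).smul_const ξ).const_add x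
  exact (φ.differentiable _).hasFDerivAt.comp_hasDerivAt t h1

theorem continuous_fderiv_apply (φ : Test) (ξ : Plane) : Continuous fun x => fderiv ℝ φ x ξ :=
  (φ.contDiff.continuous_fderiv (by simp)).clm_apply continuous_const

/-- The square of φ at the origin of a ray is minus the integral of the derivative of φ² along it:
compact support removes the contribution at infinity. -/
theorem ofReal_sq_le_lintegral_ray (φ : Test) (x : Plane) {ξ : Plane} (hξ : ξ ≠ 0) :
    ENNReal.ofReal (φ x ^ 2) ≤
      ∫⁻ t in Ioi (0 : ℝ), ENNReal.ofReal (2 * |φ (x + t • ξ)| * |fderiv ℝ φ (x + t • ξ) ξ|) := by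
  set f : ℝ → ℝ := fun t => φ (x + t • ξ) with hf
  have hcs := φ.hasCompactSupport_ray x hξ
  have hline : Continuous fun t : ℝ => x + t • ξ := by fun_prop
  have hc : Continuous f := φ.continuous.comp hline
  have hc' : Continuous fun t : ℝ => fderiv ℝ φ (x + t • ξ) ξ :=
    (φ.continuous_fderiv_apply ξ).comp hline
  have hint : Integrable fun t : ℝ => 2 * f t * fderiv ℝ φ (x + t • ξ) ξ := by
    refine ((continuous_const.mul hc).mul hc').integrable_of_hasCompactSupport ?_
    exact (hcs.mul_left (f := fun _ => (2 : ℝ))).mul_right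
  have hd : ∀ t : ℝ, HasDerivAt (fun t => f t ^ 2) (2 * f t * fderiv ℝ φ (x + t • ξ) ξ) t := by
    intro t
    simpa using (φ.hasDerivAt_ray x ξ t).fun_pow 2
  have hz : Tendsto (fun t => f t ^ 2) atTop (𝓝 0) := by
    have h1 : Tendsto f (cocompact ℝ) (𝓝 0) := hcs.is_zero_at_infty
    have h2 := (h1.mono_left atTop_le_cocompact).pow 2
    simpa using h2
  have key := integral_Ioi_of_hasDerivAt_of_tendsto (a := 0) (hc.pow 2).continuousWithinAt
    (fun t _ => hd t) hint.integrableOn hz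
  have h0 : f 0 = φ x := by simp [hf]
  calc ENNReal.ofReal (φ x ^ 2)
      ≤ ENNReal.ofReal (∫ t in Ioi (0 : ℝ), |2 * f t * fderiv ℝ φ (x + t • ξ) ξ|) := by
        refine ENNReal.ofReal_le_ofReal ?_
        have := neg_le_abs (∫ t in Ioi (0 : ℝ), 2 * f t * fderiv ℝ φ (x + t • ξ) ξ)
        have h3 := abs_integral_le_integral_abs (μ := volume.restrict (Ioi (0 : ℝ)))
          (f := fun t => 2 * f t * fderiv ℝ φ (x + t • ξ) ξ)
        have h4 : (f ^ 2) 0 = φ x ^ 2 := by simp [h0]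
        rw [h4] at key
        linarith
    _ = ∫⁻ t in Ioi (0 : ℝ), ENNReal.ofReal |2 * f t * fderiv ℝ φ (x + t • ξ) ξ| :=
        ofReal_integral_eq_lintegral_ofReal hint.abs.integrableOn
          (.of_forall fun _ => abs_nonneg _)
    _ = _ := by simp [abs_mul, hf]

/-- The density `2 |φ| |∂φ/∂ξ|` on `U`. -/
def rayDensity (U : Set Plane) (φ : Test) (ξ y : Plane) : ℝ≥0∞ :=
  U.indicator (fun y => ENNReal.ofReal (2 * |φ y| * |fderiv ℝ φ y ξ|)) y

theorem measurable_rayDensity {U : Set Plane} (hU : MeasurableSet U) (φ : Test) (ξ : Plane) :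
    Measurable (rayDensity U φ ξ) := by
  refine Measurable.indicator ?_ hU
  have := φ.continuous
  have := φ.continuous_fderiv_apply ξ
  exact (ENNReal.continuous_ofReal.comp (by fun_prop)).measurable

/-- Since the open ray stays in U, the indicator in the density costs nothing. Integrating over the
whole line makes the bound independent of the starting point on that line. -/
theorem ofReal_sq_le_lintegral_rayDensity {U : Set Plane} (φ : Test) (x : Plane) {ξ : Plane}
    (hξ : ξ ≠ 0) (h : ∀ t : ℝ, 0 < t → x + t • ξ ∈ U) :
    ENNReal.ofReal (φ x ^ 2) ≤ ∫⁻ t : ℝ, rayDensity U φ ξ (x + t • ξ) := by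
  refine (φ.ofReal_sq_le_lintegral_ray x hξ).trans ?_
  refine le_trans (le_of_eq ?_) (setLIntegral_le_lintegral (Ioi (0 : ℝ)) _)
  refine setLIntegral_congr_fun measurableSet_Ioi fun t ht => ?_
  rw [rayDensity, indicator_of_mem (h t ht)]

/-- Cauchy-Schwarz. This common upper bound serves both Ladyzhenskaya's inequality and the trace
inequality. -/
theorem lintegral_rayDensity_le {U : Set Plane} (hU : MeasurableSet U) (φ : Test) (ξ : Plane) :
    ∫⁻ y, rayDensity U φ ξ y ≤
      ENNReal.ofReal (2 * ‖ξ‖ * (√(∫ x in U, φ x ^ 2) * √(∫ x in U, gradSq φ x))) := by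
  have hm1 : MemLp (fun y => |φ y|) 2 (volume.restrict U) := (φ.memLp 2 _).abs
  have hcs : HasCompactSupport fun y => fderiv ℝ φ y ξ :=
    φ.hasCompactSupport.fderiv_apply (𝕜 := ℝ) ξ
  have hm0 : MemLp (fun y => fderiv ℝ φ y ξ) 2 (volume.restrict U) :=
    (φ.continuous_fderiv_apply ξ).memLp_of_hasCompactSupport hcs
  have hm2 : MemLp (fun y => |fderiv ℝ φ y ξ|) 2 (volume.restrict U) := hm0.abs
  have hint : Integrable (fun y => 2 * |φ y| * |fderiv ℝ φ y ξ|) (volume.restrict U) := by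
    have := (hm1.integrable_mul hm2).const_mul 2
    refine this.congr (.of_forall fun y => ?_)
    simp [mul_assoc]
  have e : ∫⁻ y, rayDensity U φ ξ y =
      ENNReal.ofReal (∫ y in U, 2 * |φ y| * |fderiv ℝ φ y ξ|) := by
    rw [ofReal_integral_eq_lintegral_ofReal hint (.of_forall fun _ => by positivity),
      ← lintegral_indicator hU]
    rfl
  rw [e]
  refine ENNReal.ofReal_le_ofReal ?_
  have h1 := sq_integral_mul_le hm1 hm2
  simp only [sq_abs] at h1
  have h2 : ∫ y in U, fderiv ℝ φ y ξ ^ 2 ≤ ‖ξ‖ ^ 2 * ∫ y in U, gradSq φ y := by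
    rw [← integral_const_mul]
    exact integral_mono hm0.integrable_sq ((φ.integrable_gradSq _).const_mul _)
      fun y => φ.sq_fderiv_apply_le y ξ
  have h3 : ∫ y in U, 2 * |φ y| * |fderiv ℝ φ y ξ| =
      2 * ∫ y in U, |φ y| * |fderiv ℝ φ y ξ| := by
    rw [← integral_const_mul]
    simp [mul_assoc]
  have hA : 0 ≤ ∫ y in U, φ y ^ 2 := integral_nonneg fun _ => sq_nonneg _
  have hB : 0 ≤ ∫ y in U, gradSq φ y := integral_nonneg fun _ => gradSq_nonneg _ _
  have h4 : ∫ y in U, |φ y| * |fderiv ℝ φ y ξ| ≤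
      ‖ξ‖ * (√(∫ x in U, φ x ^ 2) * √(∫ x in U, gradSq φ x)) := by
    refine le_of_sq_le_sq ?_ (by positivity)
    rw [mul_pow, mul_pow, Real.sq_sqrt hA, Real.sq_sqrt hB]
    calc _ ≤ _ := h1
      _ ≤ _ := mul_le_mul_of_nonneg_left h2 hA
      _ = _ := by ring
  rw [h3]
  linarith

end Test

/-! ### Ladyzhenskaya and trace estimates by integration along rays. -/

/-- Integration over the plane in the linear coordinates given by a pair of vectors. -/
theorem exists_lintegral_eq_mul_lintegral_lintegral {a b : Plane}
    (hab : LinearIndependent ℝ ![a, b]) :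
    ∃ c : ℝ≥0∞, c ≠ 0 ∧ c ≠ ⊤ ∧ ∀ f : Plane → ℝ≥0∞, Measurable f →
      ∫⁻ y, f y = c * ∫⁻ t : ℝ, ∫⁻ s : ℝ, f (s • a + t • b) := by
  let T : (ℝ × ℝ) →ₗ[ℝ] Plane :=
    (LinearMap.toSpanSingleton ℝ Plane b).comp (LinearMap.fst ℝ ℝ ℝ) +
      (LinearMap.toSpanSingleton ℝ Plane a).comp (LinearMap.snd ℝ ℝ ℝ)
  have hT : ∀ p : ℝ × ℝ, T p = p.2 • a + p.1 • b := fun p => by simp [T, add_comm]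
  have hinj : Function.Injective T := by
    rw [← LinearMap.ker_eq_bot, LinearMap.ker_eq_bot']
    intro p hp
    rw [hT] at hp
    have := LinearIndependent.pair_iff.1 hab p.2 p.1 hp
    exact Prod.ext this.2 this.1
  let e : (ℝ × ℝ) ≃L[ℝ] Plane :=
    (LinearMap.linearEquivOfInjective T hinj (by simp)).toContinuousLinearEquiv
  have he : ∀ p : ℝ × ℝ, e p = p.2 • a + p.1 • b := hT
  have hh : (Measure.map e (volume : Measure (ℝ × ℝ))).IsAddHaarMeasure :=
    e.isAddHaarMeasure_map _
  have hc := Measure.isAddLeftInvariant_eq_smul (volume : Measure Plane)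
    (Measure.map e (volume : Measure (ℝ × ℝ)))
  have h0 := Measure.addHaarScalarFactor_pos_of_isAddHaarMeasure (volume : Measure Plane)
    (Measure.map e (volume : Measure (ℝ × ℝ)))
  generalize Measure.addHaarScalarFactor (volume : Measure Plane)
    (Measure.map e (volume : Measure (ℝ × ℝ))) = c at hc h0
  refine ⟨c, by exact_mod_cast h0.ne', ENNReal.coe_ne_top, fun f hf => ?_⟩
  conv_lhs => rw [hc]
  rw [lintegral_smul_measure, ENNReal.smul_def, smul_eq_mul, lintegral_map hf e.continuous.measurable,
    Measure.volume_eq_prod, lintegral_prod (fun p => f (e p)) (hf.comp e.continuous.measurable).aemeasurable]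
  simp [he]

/-- Ladyzhenskaya's inequality on a set that contains a cone of directions. -/
theorem IsConeOpen.ladyzhenskaya {U : Set Plane} {ξ₀ : Plane} {ρ : ℝ} (h : IsConeOpen U ξ₀ ρ) :
    ∃ C : ℝ, 0 ≤ C ∧ ∀ φ : Test,
      ∫ x in U, φ x ^ 4 ≤ C * (∫ x in U, φ x ^ 2) * ∫ x in U, Test.gradSq φ x := by
  have hξ₀ : ξ₀ ≠ 0 := h.ne_zero (Metric.mem_ball_self h.pos)
  obtain ⟨e, he⟩ := exists_linearIndependent_pair_of_one_lt_finrank (R := ℝ) (M := Plane)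
    (by simp) hξ₀
  have he0 : e ≠ 0 := he.ne_zero 1
  -- A second direction in the cone, independent of `ξ₀`, is obtained by tilting `ξ₀` by a vector of
  -- length ρ/2.
  set δ : ℝ := ρ / (2 * ‖e‖) with hδ
  have hδ0 : 0 < δ := div_pos h.pos (by positivity)
  set b : Plane := ξ₀ + δ • e with hb
  have hbmem : b ∈ Metric.ball ξ₀ ρ := by
    rw [mem_ball_iff_norm, hb, add_sub_cancel_left, norm_smul, Real.norm_of_nonneg hδ0.le, hδ]
    have : 0 < ‖e‖ := norm_pos_iff.2 he0
    have h2 := h.pos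
    field_simp
    linarith
  have hab : LinearIndependent ℝ ![ξ₀, b] := by
    rw [LinearIndependent.pair_iff] at he ⊢
    intro s t hst
    have h1 : (s + t) • ξ₀ + (t * δ) • e = 0 := by
      rw [← hst, hb, smul_add, smul_smul, add_smul]; abel
    obtain ⟨h2, h3⟩ := he _ _ h1
    have h4 : t = 0 := by
      rcases mul_eq_zero.1 h3 with h5 | h5
      · exact h5
      · exact absurd h5 hδ0.ne'
    exact ⟨by linarith, h4⟩
  have hb0 := h.ne_zero hbmem
  obtain ⟨c, hc0, hc1, hc⟩ := exists_lintegral_eq_mul_lintegral_lintegral hab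
  refine ⟨c⁻¹.toReal * (4 * ‖ξ₀‖ * ‖b‖), by positivity, fun φ => ?_⟩
  have hUm := h.isOpen.measurableSet
  set H : Plane → ℝ≥0∞ := U.indicator fun y => ENNReal.ofReal (φ y ^ 2) with hH
  have hHm : Measurable H := ((φ.measurable.pow_const 2).ennreal_ofReal).indicator hUm
  have hle : ∀ y : Plane, ∀ ξ ∈ Metric.ball ξ₀ ρ,
      H y ≤ ∫⁻ t : ℝ, φ.rayDensity U ξ (y + t • ξ) := by
    intro y ξ hξ
    by_cases hy : y ∈ U
    · rw [hH, indicator_of_mem hy]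
      exact φ.ofReal_sq_le_lintegral_rayDensity y (h.ne_zero hξ)
        fun t ht => h.add_mem y hy ξ hξ t ht
    · simp [hH, hy]
  have hma := φ.measurable_rayDensity hUm ξ₀
  have hmb := φ.measurable_rayDensity hUm b
  set P : ℝ → ℝ≥0∞ := fun t => ∫⁻ s : ℝ, φ.rayDensity U ξ₀ (s • ξ₀ + t • b) with hP
  set Q : ℝ → ℝ≥0∞ := fun s => ∫⁻ t : ℝ, φ.rayDensity U b (s • ξ₀ + t • b) with hQ
  have hlin : Measurable fun p : ℝ × ℝ => p.2 • ξ₀ + p.1 • b := by fun_prop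
  have hQm : Measurable Q := Measurable.lintegral_prod_left' (hmb.comp hlin)
  have hPm : Measurable P := Measurable.lintegral_prod_right' (hma.comp hlin)
  -- Translation of the integration variable absorbs s: the line integral in direction `ξ₀` depends
  -- on t alone, and below the one in direction `b` on s alone.
  have h1 : ∀ s t : ℝ, H (s • ξ₀ + t • b) ≤ P t := by
    intro s t
    refine (hle _ ξ₀ (Metric.mem_ball_self h.pos)).trans (le_of_eq ?_)
    simp only [hP]
    rw [← lintegral_add_left_eq_self
      (fun s' : ℝ => φ.rayDensity U ξ₀ (s' • ξ₀ + t • b)) s]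
    refine lintegral_congr fun r => ?_
    congr 1
    rw [add_smul]; abel
  have h2 : ∀ s t : ℝ, H (s • ξ₀ + t • b) ≤ Q s := by
    intro s t
    refine (hle _ b hbmem).trans (le_of_eq ?_)
    simp only [hQ]
    rw [← lintegral_add_left_eq_self
      (fun t' : ℝ => φ.rayDensity U b (s • ξ₀ + t' • b)) t]
    refine lintegral_congr fun r => ?_
    congr 1
    rw [add_smul]; abel
  have hIa : ∫⁻ y, φ.rayDensity U ξ₀ y = c * ∫⁻ t, P t := hc _ hma
  have hIb : ∫⁻ y, φ.rayDensity U b y = c * ∫⁻ s, Q s := by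
    rw [hc _ hmb, lintegral_lintegral_swap]
    exact (hmb.comp hlin).aemeasurable
  -- Gagliardo's device: the square of H is at most P(t) Q(s), whose double integral factors into
  -- the two integrals of ray densities.
  have key : c * ∫⁻ y, H y ^ 2 ≤
      (∫⁻ y, φ.rayDensity U ξ₀ y) * ∫⁻ y, φ.rayDensity U b y := by
    rw [hIa, hIb, hc _ (hHm.pow_const 2)]
    calc c * (c * ∫⁻ t : ℝ, ∫⁻ s : ℝ, H (s • ξ₀ + t • b) ^ 2)
        ≤ c * (c * ∫⁻ t : ℝ, ∫⁻ s : ℝ, P t * Q s) := by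
          gcongr with t s
          rw [sq]
          exact mul_le_mul' (h1 s t) (h2 s t)
      _ = c * (c * ((∫⁻ t, P t) * ∫⁻ s, Q s)) := by
          congr 2
          rw [← lintegral_mul_const _ hPm]
          refine lintegral_congr fun t => ?_
          rw [lintegral_const_mul _ hQm]
      _ = _ := by ring
  have hA : 0 ≤ ∫ y in U, φ y ^ 2 := integral_nonneg fun _ => sq_nonneg _
  have hB : 0 ≤ ∫ y in U, Test.gradSq φ y := integral_nonneg fun _ => Test.gradSq_nonneg _ _
  have hφ4 : Integrable (fun x => φ x ^ 4) (volume.restrict U) :=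
    ((φ.mul φ).integrable_sq _).congr (.of_forall fun x => by simp; ring)
  have e : ∫⁻ y, H y ^ 2 = ENNReal.ofReal (∫ x in U, φ x ^ 4) := by
    rw [ofReal_integral_eq_lintegral_ofReal hφ4 (.of_forall fun _ => by positivity),
      ← lintegral_indicator hUm]
    refine lintegral_congr fun y => ?_
    by_cases hy : y ∈ U
    · simp only [hH, indicator_of_mem hy]
      rw [← ENNReal.ofReal_pow (sq_nonneg _), ← pow_mul]
    · simp [hH, hy]
  rw [e] at key
  have key2 := key.trans (mul_le_mul' (φ.lintegral_rayDensity_le hUm ξ₀)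
    (φ.lintegral_rayDensity_le hUm b))
  rw [← ENNReal.ofReal_mul (by positivity)] at key2
  have key3 : ENNReal.ofReal (∫ x in U, φ x ^ 4) ≤ ENNReal.ofReal (c⁻¹.toReal *
      (2 * ‖ξ₀‖ * (√(∫ x in U, φ x ^ 2) * √(∫ x in U, Test.gradSq φ x)) *
        (2 * ‖b‖ * (√(∫ x in U, φ x ^ 2) * √(∫ x in U, Test.gradSq φ x))))) := by
    rw [ENNReal.ofReal_mul (by positivity), ENNReal.ofReal_toReal (ENNReal.inv_ne_top.2 hc0)]
    calc ENNReal.ofReal (∫ x in U, φ x ^ 4)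
        = c⁻¹ * (c * ENNReal.ofReal (∫ x in U, φ x ^ 4)) := by
          rw [← mul_assoc, ENNReal.inv_mul_cancel hc0 hc1, one_mul]
      _ ≤ _ := by gcongr
  have key4 := (ENNReal.ofReal_le_ofReal_iff (by positivity)).1 key3
  refine key4.trans (le_of_eq ?_)
  have := Real.mul_self_sqrt hA
  have h5 := Real.mul_self_sqrt hB
  calc _ = c⁻¹.toReal * (4 * ‖ξ₀‖ * ‖b‖) * (√(∫ x in U, φ x ^ 2) * √(∫ x in U, φ x ^ 2)) *
        (√(∫ x in U, Test.gradSq φ x) * √(∫ x in U, Test.gradSq φ x)) := by ring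
    _ = _ := by rw [this, h5]

/-- The length measure on a Lipschitz graph is controlled by the Lebesgue measure of the
parameter. -/
theorem exists_lintegral_range_le (a b : Plane) {K : ℝ≥0} {γ : ℝ → ℝ} (hγ : LipschitzWith K γ) :
    ∃ L : ℝ≥0, ∀ f : Plane → ℝ≥0∞, Measurable f →
      ∫⁻ y in range fun s => s • a + γ s • b, f y ∂(Measure.hausdorffMeasure 1 : Measure Plane) ≤
        L * ∫⁻ s : ℝ, f (s • a + γ s • b) := by
  set g : ℝ → Plane := fun s => s • a + γ s • b with hg
  have hlip : LipschitzWith (‖a‖₊ + K * ‖b‖₊) g := by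
    refine LipschitzWith.of_dist_le_mul fun s t => ?_
    have h1 : g s - g t = (s - t) • a + (γ s - γ t) • b := by
      simp only [hg, sub_smul]; abel
    have h2 := hγ.dist_le_mul s t
    rw [Real.dist_eq, Real.dist_eq] at h2
    rw [dist_eq_norm, h1, Real.dist_eq]
    refine (norm_add_le _ _).trans ?_
    rw [norm_smul, norm_smul, Real.norm_eq_abs, Real.norm_eq_abs]
    push_cast
    nlinarith [norm_nonneg b]
  have hgm : Measurable g := hlip.continuous.measurable
  refine ⟨‖a‖₊ + K * ‖b‖₊, fun f hf => ?_⟩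
  -- A piece of the graph is the image of its set of parameters, so the Lipschitz constant of the
  -- parametrization bounds its length.
  have hle : (Measure.hausdorffMeasure 1 : Measure Plane).restrict (range g) ≤
      (‖a‖₊ + K * ‖b‖₊) • Measure.map g (volume : Measure ℝ) := by
    refine Measure.le_iff.2 fun B hB => ?_
    rw [Measure.restrict_apply hB, Measure.smul_apply, Measure.map_apply hgm hB,
      ← image_preimage_eq_inter_range]
    have := hlip.hausdorffMeasure_image_le zero_le_one (g ⁻¹' B)
    rwa [hausdorffMeasure_real, ENNReal.rpow_one] at this
  refine (lintegral_mono' hle le_rfl).trans (le_of_eq ?_)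
  rw [lintegral_smul_measure, ENNReal.smul_def, smul_eq_mul, lintegral_map hf hgm]

/-- The local trace inequality on a Lipschitz graph. -/
theorem exists_lintegral_graph_sq_le {a b : Plane} (hab : LinearIndependent ℝ ![a, b]) {K : ℝ≥0}
    {γ : ℝ → ℝ} (hγ : LipschitzWith K γ) {U : Set Plane} (hUm : MeasurableSet U)
    (hU : ∀ s t : ℝ, γ s < t → s • a + t • b ∈ U) :
    ∃ C : ℝ≥0, ∀ φ : Test,
      ∫⁻ y in range fun s => s • a + γ s • b, ENNReal.ofReal (φ y ^ 2)
        ∂(Measure.hausdorffMeasure 1 : Measure Plane) ≤ C * ∫⁻ y, φ.rayDensity U b y := by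
  obtain ⟨L, hL⟩ := exists_lintegral_range_le a b hγ
  obtain ⟨c, hc0, hc1, hc⟩ := exists_lintegral_eq_mul_lintegral_lintegral hab
  have hb0 : b ≠ 0 := hab.ne_zero 1
  refine ⟨L * c⁻¹.toNNReal, fun φ => ?_⟩
  have hmb := φ.measurable_rayDensity hUm b
  have hlin : Measurable fun p : ℝ × ℝ => p.2 • a + p.1 • b := by fun_prop
  refine (hL _ (φ.measurable.pow_const 2).ennreal_ofReal).trans ?_
  have hsw := lintegral_lintegral_swap (μ := (volume : Measure ℝ)) (ν := (volume : Measure ℝ))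
    (f := fun t s => φ.rayDensity U b (s • a + t • b)) (hmb.comp hlin).aemeasurable
  rw [hc _ hmb, hsw, ENNReal.coe_mul,
    ENNReal.coe_toNNReal (ENNReal.inv_ne_top.2 hc0), mul_assoc, ← mul_assoc c⁻¹,
    ENNReal.inv_mul_cancel hc0 hc1, one_mul]
  -- For each parameter s, the ray starts on the graph and runs vertically into U.
  gcongr with s
  refine (φ.ofReal_sq_le_lintegral_rayDensity (U := U) _ hb0 fun t ht => ?_).trans (le_of_eq ?_)
  · rw [add_assoc, ← add_smul]
    exact hU _ _ (by linarith)
  · rw [← lintegral_add_left_eq_self (fun t : ℝ => φ.rayDensity U b (s • a + t • b)) (γ s)]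
    refine lintegral_congr fun r => ?_
    congr 1
    rw [add_smul]; abel

/-! ### Local structure of Lipschitz domains -/

/-- In the ball, `Ω` coincides with a set that contains a cone of directions, and a trace
inequality holds for the functions supported in the ball. -/
def IsAdaptedBall (Ω : Set Plane) (x : Plane) (r : ℝ) : Prop :=
  ∃ (U : Set Plane) (ξ₀ : Plane) (ρ : ℝ), IsConeOpen U ξ₀ ρ ∧
    (∀ y ∈ Metric.ball x r, y ∈ Ω ↔ y ∈ U) ∧
    ∃ C : ℝ, 0 ≤ C ∧ ∀ φ : Test, tsupport φ ⊆ Metric.ball x r →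
      ∫⁻ y, ENNReal.ofReal (φ y ^ 2) ∂(bdryMeasure Ω) ≤
        ENNReal.ofReal (C * ((∫ y in U, φ y ^ 2) + ∫ y in U, φ.gradSq y))

theorem linearIndependent_isometry_symm_single (A : Plane ≃ₗᵢ[ℝ] Plane) :
    LinearIndependent ℝ ![A.symm (EuclideanSpace.single 0 1), A.symm (EuclideanSpace.single 1 1)] := by
  rw [LinearIndependent.pair_iff]
  intro s t hst
  have h : A (s • A.symm (EuclideanSpace.single 0 1) + t • A.symm (EuclideanSpace.single 1 1)) = 0 := by
    rw [hst, map_zero]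
  simp only [map_add, map_smul, LinearIsometryEquiv.apply_symm_apply] at h
  have h0 := congrArg (fun v : Plane => v 0) h
  have h1 := congrArg (fun v : Plane => v 1) h
  simp at h0 h1
  exact ⟨h0, h1⟩

theorem eq_smul_isometry_symm_single (A : Plane ≃ₗᵢ[ℝ] Plane) (y : Plane) :
    y = (A y) 0 • A.symm (EuclideanSpace.single 0 1) +
      (A y) 1 • A.symm (EuclideanSpace.single 1 1) := by
  apply A.injective
  simp only [map_add, map_smul, LinearIsometryEquiv.apply_symm_apply]
  ext i
  fin_cases i <;> simp

/-- A direction within 1/(K+1) of the vertical rises by at least 1 - 1/(K+1) = K/(K+1), while its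
horizontal part makes the graph rise by at most K · 1/(K+1). A point strictly above the graph
therefore stays strictly above. -/
theorem isConeOpen_epigraph (A : Plane ≃ₗᵢ[ℝ] Plane) {K : ℝ≥0} {γ : ℝ → ℝ}
    (hγ : LipschitzWith K γ) :
    IsConeOpen {y | γ ((A y) 0) < (A y) 1} (A.symm (EuclideanSpace.single 1 1)) (1 / (K + 1)) where
  isOpen := by
    have := hγ.continuous
    have := A.continuous
    exact isOpen_lt (by fun_prop) (by fun_prop)
  pos := by positivity
  le_norm := by
    rw [LinearIsometryEquiv.norm_map, PiLp.norm_single, norm_one]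
    rw [div_le_one (by positivity)]
    have := K.coe_nonneg
    linarith
  add_mem := by
    intro y hy ξ hξ t ht
    have h1 : ‖A ξ - EuclideanSpace.single 1 1‖ < 1 / (K + 1) := by
      rw [mem_ball_iff_norm, ← A.norm_map, map_sub, A.apply_symm_apply] at hξ
      exact hξ
    have h2 : |(A ξ) 0| < 1 / (K + 1) := by
      have := PiLp.norm_apply_le (A ξ - EuclideanSpace.single 1 1) 0
      simp at this
      exact this.trans_lt h1
    have h3 : |(A ξ) 1 - 1| < 1 / (K + 1) := by
      have := PiLp.norm_apply_le (A ξ - EuclideanSpace.single 1 1) 1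
      simp at this
      exact this.trans_lt h1
    simp only [mem_ofPred_eq, map_add, map_smul, PiLp.add_apply, PiLp.smul_apply, smul_eq_mul] at hy ⊢
    have h4 := hγ.dist_le_mul ((A y) 0 + t * (A ξ) 0) ((A y) 0)
    rw [Real.dist_eq, Real.dist_eq, add_sub_cancel_left, abs_mul, abs_of_pos ht] at h4
    have h5 := (abs_le.1 h4).2
    have h6 : (K : ℝ) * |(A ξ) 0| < (A ξ) 1 ∨ (K : ℝ) * |(A ξ) 0| ≤ (A ξ) 1 := by
      right
      have hK := K.coe_nonneg
      have h7 : (K : ℝ) * |(A ξ) 0| ≤ K * (1 / (K + 1)) := by gcongr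
      have h8 : (K : ℝ) * (1 / (K + 1)) = 1 - 1 / (K + 1) := by field_simp; ring
      have := (abs_lt.1 h3).1
      linarith
    have h7 : (K : ℝ) * |(A ξ) 0| ≤ (A ξ) 1 := h6.elim le_of_lt id
    have h8 : (K : ℝ) * (t * |(A ξ) 0|) ≤ t * (A ξ) 1 := by nlinarith
    linarith

/-- At interior points the cone-stable set is the whole plane, and the trace inequality is void
because the ball misses the boundary. At boundary points the set is the local epigraph. -/
theorem IsLipschitzDomain.exists_isAdaptedBall {Ω : Set Plane} (hΩ : IsLipschitzDomain Ω)
    {x : Plane} (hx : x ∈ closure Ω) : ∃ r > 0, IsAdaptedBall Ω x r := by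
  by_cases hxΩ : x ∈ Ω
  · obtain ⟨r, hr, hball⟩ := Metric.isOpen_iff.1 hΩ.isOpen x hxΩ
    refine ⟨r, hr, univ, EuclideanSpace.single 0 1, 1, ⟨isOpen_univ, one_pos, by simp,
      fun _ _ _ _ _ _ => mem_univ _⟩, fun y hy => ⟨fun _ => mem_univ _, fun _ => hball hy⟩,
      0, le_rfl, fun φ hφ => ?_⟩
    rw [zero_mul, ENNReal.ofReal_zero, nonpos_iff_eq_zero, lintegral_eq_zero_iff
      (φ.measurable.pow_const 2).ennreal_ofReal]
    filter_upwards [ae_restrict_mem measurableSet_frontier] with y hy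
    have h0 : φ y = 0 := image_eq_zero_of_notMem_tsupport fun h => by
      have h1 := hball (hφ h)
      rw [hΩ.isOpen.frontier_eq] at hy
      exact hy.2 h1
    simp [h0]
  · have hxf : x ∈ frontier Ω := by
      rw [hΩ.isOpen.frontier_eq]; exact ⟨hx, hxΩ⟩
    obtain ⟨A, K, γ, r, hγ, hr, hU⟩ := hΩ.lipschitz_boundary x hxf
    have hcone := isConeOpen_epigraph A hγ
    set U : Set Plane := {y | γ ((A y) 0) < (A y) 1} with hUdef
    set a : Plane := A.symm (EuclideanSpace.single 0 1) with ha
    set b : Plane := A.symm (EuclideanSpace.single 1 1) with hb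
    have hab := linearIndependent_isometry_symm_single A
    have hA : ∀ s t : ℝ, A (s • a + t • b) = s • EuclideanSpace.single 0 1 +
        t • EuclideanSpace.single 1 1 := by
      intro s t
      simp [ha, hb]
    obtain ⟨C, hC⟩ := exists_lintegral_graph_sq_le hab hγ hcone.isOpen.measurableSet
      (fun s t hst => by
        rw [hUdef, mem_ofPred_eq, hA]
        simpa using hst)
    refine ⟨r, hr, U, b, _, hcone, hU, C * ‖b‖, by positivity, fun φ hφ => ?_⟩
    -- In the ball, a boundary point cannot lie above the graph, being outside the open set Ω; nor
    -- can it lie below, since it would then have a neighbourhood that misses Ω.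
    have hsub : frontier Ω ∩ Metric.ball x r ⊆ range fun s : ℝ => s • a + γ s • b := by
      rintro y ⟨hy, hyr⟩
      rw [hΩ.isOpen.frontier_eq] at hy
      have h1 : ¬ γ ((A y) 0) < (A y) 1 := fun h => hy.2 ((hU y hyr).2 h)
      have h2 : ¬ (A y) 1 < γ ((A y) 0) := by
        intro h
        have hopen : IsOpen ({y | (A y) 1 < γ ((A y) 0)} ∩ Metric.ball x r) := by
          have := hγ.continuous
          have := A.continuous
          exact (isOpen_lt (by fun_prop) (by fun_prop)).inter Metric.isOpen_ball
        obtain ⟨z, ⟨hz1, hz2⟩, hz3⟩ := mem_closure_iff.1 hy.1 _ hopen ⟨h, hyr⟩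
        exact lt_asymm hz1 ((hU z hz2).1 hz3)
      refine ⟨(A y) 0, ?_⟩
      have h3 : γ ((A y) 0) = (A y) 1 := le_antisymm (not_lt.1 h2) (not_lt.1 h1)
      simp only [h3]
      exact (eq_smul_isometry_symm_single A y).symm
    have hm : Measurable fun y => ENNReal.ofReal (φ y ^ 2) :=
      (φ.measurable.pow_const 2).ennreal_ofReal
    calc ∫⁻ y, ENNReal.ofReal (φ y ^ 2) ∂(bdryMeasure Ω)
        = ∫⁻ y in frontier Ω ∩ Metric.ball x r, ENNReal.ofReal (φ y ^ 2)
            ∂(Measure.hausdorffMeasure 1 : Measure Plane) := by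
          rw [bdryMeasure, inter_comm, ← setLIntegral_indicator measurableSet_ball]
          refine lintegral_congr fun y => ?_
          by_cases hy : y ∈ Metric.ball x r
          · rw [indicator_of_mem hy]
          · rw [indicator_of_notMem hy,
              image_eq_zero_of_notMem_tsupport fun h => hy (hφ h)]
            simp
      _ ≤ ∫⁻ y in range fun s : ℝ => s • a + γ s • b, ENNReal.ofReal (φ y ^ 2)
            ∂(Measure.hausdorffMeasure 1 : Measure Plane) := lintegral_mono_set hsub
      _ ≤ C * ∫⁻ y, φ.rayDensity U b y := hC φ
      _ ≤ C * ENNReal.ofReal (2 * ‖b‖ *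
            (√(∫ x in U, φ x ^ 2) * √(∫ x in U, Test.gradSq φ x))) := by
          gcongr
          exact φ.lintegral_rayDensity_le hcone.isOpen.measurableSet b
      _ ≤ ENNReal.ofReal (C * ‖b‖ * ((∫ y in U, φ y ^ 2) + ∫ y in U, φ.gradSq y)) := by
          rw [← ENNReal.ofReal_coe_nnreal, ← ENNReal.ofReal_mul C.coe_nonneg]
          refine ENNReal.ofReal_le_ofReal ?_
          have h1 := Real.sq_sqrt (integral_nonneg (μ := volume.restrict U)
            fun y => sq_nonneg (φ y))
          have h2 := Real.sq_sqrt (integral_nonneg (μ := volume.restrict U) φ.gradSq_nonneg)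
          have h3 := two_mul_le_add_sq (√(∫ x in U, φ x ^ 2)) (√(∫ x in U, Test.gradSq φ x))
          rw [h1, h2] at h3
          calc _ = (C : ℝ) * ‖b‖ *
                (2 * √(∫ x in U, φ x ^ 2) * √(∫ x in U, Test.gradSq φ x)) := by ring
            _ ≤ _ := by gcongr

/-! ### Partitions of unity, kernels, and multiplication by cutoffs. -/

/-- A finite smooth partition of unity on a compact set, subordinate to balls. -/
theorem exists_partition {K : Set Plane} (hK : IsCompact K) {P : Plane → ℝ → Prop}
    (h : ∀ x ∈ K, ∃ r > 0, P x r) :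
    ∃ (s : Finset Plane) (r : Plane → ℝ) (χ : Plane → Test),
      (∀ x ∈ s, P x (r x) ∧ tsupport (χ x) ⊆ Metric.ball x (r x)) ∧
      ∀ y ∈ K, ∑ x ∈ s, χ x y = 1 := by
  have h' : ∀ x, ∃ r, x ∈ K → 0 < r ∧ P x r := fun x => by
    by_cases hx : x ∈ K
    · obtain ⟨r, h1, h2⟩ := h x hx
      exact ⟨r, fun _ => ⟨h1, h2⟩⟩
    · exact ⟨0, fun hx' => absurd hx' hx⟩
  choose r hr using h'
  obtain ⟨s, hsK, hs⟩ := hK.elim_nhds_subcover (fun x => Metric.ball x (r x))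
    fun x hx => Metric.ball_mem_nhds x (hr x hx).1
  obtain ⟨f, hf⟩ := SmoothPartitionOfUnity.exists_isSubordinate (ι := s)
    (modelWithCornersSelf ℝ Plane) hK.isClosed
    (fun i => Metric.ball (i : Plane) (r i)) (fun _ => Metric.isOpen_ball)
    (fun y hy => by
      obtain ⟨x, hx, hxy⟩ := mem_iUnion₂.1 (hs hy)
      exact mem_iUnion.2 ⟨⟨x, hx⟩, hxy⟩)
  let χ : s → Test := fun i => ⟨f i, (f i).contMDiff.contDiff,
    (isCompact_closedBall (i : Plane) (r i)).of_isClosed_subset (isClosed_tsupport _)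
      ((hf i).trans Metric.ball_subset_closedBall)⟩
  classical
  refine ⟨s, r, fun x => if hx : x ∈ s then χ ⟨x, hx⟩ else 0, fun x hx => ⟨(hr x (hsK x hx)).2, ?_⟩,
    fun y hy => ?_⟩
  · simp only [hx, dif_pos]
    exact hf ⟨x, hx⟩
  · have h1 := f.sum_eq_one hy
    rw [finsum_eq_sum_of_fintype] at h1
    rw [← h1, ← Finset.sum_coe_sort s]
    refine Finset.sum_congr rfl fun i _ => ?_
    simp only [i.2, dif_pos]
    rfl

/-- A nonnegative smooth kernel of mass one, supported in a given ball. -/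
theorem exists_kernel (ξ₀ : Plane) {ρ : ℝ} (hρ : 0 < ρ) :
    ∃ k : Test, (∀ x, 0 ≤ k x) ∧ tsupport k ⊆ Metric.ball ξ₀ ρ ∧ ∫ x, k x = 1 := by
  let B : ContDiffBump ξ₀ := ⟨ρ / 4, ρ / 2, by linarith, by linarith⟩
  refine ⟨⟨B.normed volume, B.contDiff_normed, B.hasCompactSupport_normed⟩, B.nonneg_normed, ?_,
    B.integral_normed⟩
  have : tsupport (B.normed volume) = Metric.closedBall ξ₀ (ρ / 2) := B.tsupport_normed_eq
  rw [show ((⟨B.normed volume, B.contDiff_normed, B.hasCompactSupport_normed⟩ : Test) :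
    Plane → ℝ) = B.normed volume from rfl, this]
  exact Metric.closedBall_subset_ball (by linarith)

namespace Test

theorem exists_bound (χ : Test) : ∃ B : ℝ, 0 ≤ B ∧ ∀ x, |χ x| ≤ B := by
  obtain ⟨B, hB⟩ := χ.hasCompactSupport.exists_bound_of_continuous χ.continuous
  exact ⟨B, (norm_nonneg _).trans (hB 0), hB⟩

theorem exists_sq_bound (χ : Test) : ∃ B : ℝ, 0 ≤ B ∧ ∀ x, χ x ^ 2 ≤ B := by
  obtain ⟨B, h0, hB⟩ := χ.exists_bound
  exact ⟨B ^ 2, sq_nonneg _, fun x => by rw [← sq_abs]; gcongr; exact hB x⟩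

theorem exists_gradSq_bound (χ : Test) : ∃ B : ℝ, 0 ≤ B ∧ ∀ x, gradSq χ x ≤ B := by
  choose B h0 hB using fun i => (d i χ).exists_sq_bound
  exact ⟨∑ i, B i, Finset.sum_nonneg fun i _ => h0 i,
    fun x => Finset.sum_le_sum fun i _ => hB i x⟩

theorem gradSq_mul_le (χ φ : Test) (x : Plane) :
    gradSq (mul χ φ) x ≤ 2 * (χ x ^ 2 * gradSq φ x + gradSq χ x * φ x ^ 2) := by
  simp only [gradSq, d_mul, add_apply, mul_apply, Fin.sum_univ_two]
  nlinarith [sq_nonneg (χ x * d 0 φ x - d 0 χ x * φ x), sq_nonneg (χ x * d 1 φ x - d 1 χ x * φ x)]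

/-- Multiplication by a test function is bounded in `L²` and in `H¹`, on every set. -/
theorem exists_mul_bound (χ : Test) : ∃ B : ℝ, 0 ≤ B ∧ ∀ (S : Set Plane) (φ : Test),
    ∫ x in S, mul χ φ x ^ 2 ≤ B * ∫ x in S, φ x ^ 2 ∧
    ∫ x in S, gradSq (mul χ φ) x ≤ B * ((∫ x in S, φ x ^ 2) + ∫ x in S, gradSq φ x) := by
  obtain ⟨B₁, h1, hB₁⟩ := χ.exists_sq_bound
  obtain ⟨B₂, h2, hB₂⟩ := χ.exists_gradSq_bound
  refine ⟨2 * (B₁ + B₂), by positivity, fun S φ => ⟨?_, ?_⟩⟩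
  · rw [← integral_const_mul]
    refine integral_mono ((mul χ φ).integrable_sq _) ((φ.integrable_sq _).const_mul _) fun x => ?_
    simp only [mul_apply, mul_pow]
    have := hB₁ x
    gcongr
    linarith
  · rw [← integral_add (φ.integrable_sq _) (φ.integrable_gradSq _), ← integral_const_mul]
    refine integral_mono ((mul χ φ).integrable_gradSq _)
      (((φ.integrable_sq _).add (φ.integrable_gradSq _)).const_mul _) fun x => ?_
    have h3 := mul_le_mul_of_nonneg_right (hB₁ x) (φ.gradSq_nonneg x)
    have h4 := mul_le_mul_of_nonneg_right (hB₂ x) (sq_nonneg (φ x))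
    have h5 := gradSq_mul_le χ φ x
    have h6 := mul_nonneg h1 (sq_nonneg (φ x))
    have h7 := mul_nonneg h2 (φ.gradSq_nonneg x)
    nlinarith

end Test

/-- Integrals of a function supported in a ball over two sets that coincide there. -/
theorem setIntegral_eq_of_ball {Ω U B : Set Plane} (hΩ : MeasurableSet Ω) (hU : MeasurableSet U)
    (h : ∀ y ∈ B, y ∈ Ω ↔ y ∈ U) {f : Plane → ℝ} (hf : ∀ y, y ∉ B → f y = 0) :
    ∫ x in Ω, f x = ∫ x in U, f x := by
  rw [← integral_indicator hΩ, ← integral_indicator hU]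
  refine integral_congr_ae (.of_forall fun y => ?_)
  by_cases hy : y ∈ B
  · by_cases hyΩ : y ∈ Ω
    · simp [hyΩ, (h y hy).1 hyΩ]
    · simp [hyΩ, (h y hy).not.1 hyΩ]
  · simp [indicator, hf y hy]

theorem Test.gradSq_eq_zero {φ : Test} {y : Plane} (hy : y ∉ tsupport φ) : φ.gradSq y = 0 := by
  refine Finset.sum_eq_zero fun i _ => ?_
  rw [image_eq_zero_of_notMem_tsupport (f := d i φ) fun h => hy (tsupport_d_subset i φ h)]
  simp

/-! ### Averages along a cone of directions -/

/-- The average of `v` over the points `x + τ ξ`, with weight `k ξ`. -/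
def avg (k : Test) (τ : ℝ) (v : Plane → ℝ) (x : Plane) : ℝ := ∫ ξ, k ξ * v (x + τ • ξ)

theorem stronglyMeasurable_avg (k : Test) (τ : ℝ) {v : Plane → ℝ} (hv : Measurable v) :
    StronglyMeasurable (avg k τ v) := by
  have h : Measurable fun p : Plane × Plane => k p.2 * v (p.1 + τ • p.2) := by
    have := k.measurable
    have h2 : Measurable fun p : Plane × Plane => p.1 + τ • p.2 := by fun_prop
    exact (this.comp measurable_snd).mul (hv.comp h2)
  exact h.stronglyMeasurable.integral_prod_right

/-- Jensen's inequality for the square and a weight of mass one. -/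
theorem sq_integral_weight_le {k g : Plane → ℝ} (hk : ∀ x, 0 ≤ k x) (hk1 : ∫ x, k x = 1)
    (hki : Integrable k) (h1 : Integrable fun x => k x * g x)
    (h2 : Integrable fun x => k x * g x ^ 2) :
    (∫ x, k x * g x) ^ 2 ≤ ∫ x, k x * g x ^ 2 := by
  set m := ∫ x, k x * g x with hm
  have h0 : 0 ≤ ∫ x, k x * (g x - m) ^ 2 :=
    integral_nonneg fun x => mul_nonneg (hk x) (sq_nonneg _)
  have e : ∫ x, k x * (g x - m) ^ 2 =
      ∫ x, ((k x * g x ^ 2 - (2 * m) * (k x * g x)) + m ^ 2 * k x) :=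
    integral_congr_ae (.of_forall fun x => by simp only; ring)
  have h3 : Integrable fun x => k x * g x ^ 2 - (2 * m) * (k x * g x) := h2.sub (h1.const_mul _)
  rw [e, integral_add h3 (hki.const_mul _), integral_sub h2 (h1.const_mul _), integral_const_mul, integral_const_mul, hk1, ← hm] at h0
  linarith

theorem memLp_comp_add_smul {v : Plane → ℝ} (hv : MemLp v 2 volume) (x : Plane) {τ : ℝ}
    (hτ : τ ≠ 0) : MemLp (fun ξ => v (x + τ • ξ)) 2 volume := by
  have h1 : MemLp (fun z => v (x + z)) 2 volume :=
    hv.comp_measurePreserving (measurePreserving_add_left volume x)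
  have h0 := h1.1
  rw [memLp_two_iff_integrable_sq_norm] at h1 ⊢
  · exact h1.comp_smul hτ
  · have h2 : Measure.QuasiMeasurePreserving (fun ξ : Plane => τ • ξ) volume volume := by
      refine ⟨measurable_const_smul τ, ?_⟩
      rw [Measure.map_addHaar_smul _ hτ]
      exact Measure.AbsolutelyContinuous.rfl.smul_left _
    exact h0.comp_quasiMeasurePreserving h2
  · exact h0

/-- The kernel has mass one, so the difference is itself an average of increments of v, to which
Jensen's inequality applies. -/
theorem ofReal_sq_avg_sub_le {k : Test} (hk : ∀ x, 0 ≤ k x) (hk1 : ∫ x, k x = 1) {τ : ℝ}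
    (hτ : τ ≠ 0) {v : Plane → ℝ} (hv : MemLp v 2 volume) (x : Plane) :
    ENNReal.ofReal ((avg k τ v x - v x) ^ 2) ≤
      ∫⁻ ξ, ENNReal.ofReal (k ξ) * ENNReal.ofReal ((v (x + τ • ξ) - v x) ^ 2) := by
  have hm := memLp_comp_add_smul hv x hτ
  have hkv : Integrable fun ξ => k ξ * v (x + τ • ξ) := (k.memLp 2 _).integrable_mul hm
  obtain ⟨B, hB0, hB⟩ := k.exists_bound
  have hkv2 : Integrable fun ξ => k ξ * v (x + τ • ξ) ^ 2 :=
    hm.integrable_sq.bdd_mul (c := B) k.continuous.aestronglyMeasurable (.of_forall hB)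
  have hki := k.integrable volume
  have h1 : Integrable fun ξ => k ξ * (v (x + τ • ξ) - v x) :=
    (hkv.sub (hki.mul_const (v x))).congr (.of_forall fun ξ => by simp [mul_sub])
  have h2 : Integrable fun ξ => k ξ * (v (x + τ • ξ) - v x) ^ 2 :=
    ((hkv2.sub (hkv.mul_const (2 * v x))).add (hki.mul_const (v x ^ 2))).congr
      (.of_forall fun ξ => by simp; ring)
  have e : avg k τ v x - v x = ∫ ξ, k ξ * (v (x + τ • ξ) - v x) := by
    simp only [mul_sub]
    rw [integral_sub hkv (hki.mul_const _), integral_mul_const, hk1, one_mul, avg]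
  calc ENNReal.ofReal ((avg k τ v x - v x) ^ 2)
      ≤ ENNReal.ofReal (∫ ξ, k ξ * (v (x + τ • ξ) - v x) ^ 2) := by
        rw [e]
        exact ENNReal.ofReal_le_ofReal (sq_integral_weight_le hk hk1 hki h1 h2)
    _ = _ := by
        rw [ofReal_integral_eq_lintegral_ofReal h2
          (.of_forall fun ξ => mul_nonneg (hk ξ) (sq_nonneg _))]
        exact lintegral_congr fun ξ => ENNReal.ofReal_mul (hk ξ)

theorem lintegral_ofReal_kernel {k : Test} (hk : ∀ x, 0 ≤ k x) (hk1 : ∫ x, k x = 1) :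
    ∫⁻ ξ, ENNReal.ofReal (k ξ) = 1 := by
  rw [← ofReal_integral_eq_lintegral_ofReal (k.integrable _) (.of_forall hk), hk1,
    ENNReal.ofReal_one]

/-- Averages of a square integrable function converge to it in `L²`. -/
theorem tendsto_lintegral_avg_sub {k : Test} (hk : ∀ x, 0 ≤ k x) (hk1 : ∫ x, k x = 1)
    {v : Plane → ℝ} (hvm : Measurable v) (hv : MemLp v 2 volume) :
    Tendsto (fun τ => ∫⁻ x, ENNReal.ofReal ((avg k τ v x - v x) ^ 2)) (𝓝[>] 0) (𝓝 0) := by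
  obtain ⟨R, hR⟩ := k.hasCompactSupport.isCompact.isBounded.exists_norm_le
  let T : Plane → C(Plane, Plane) := fun a => ⟨fun x => x + a, by fun_prop⟩
  have hT : Continuous T := by
    refine ContinuousMap.continuous_of_continuous_uncurry _ ?_
    show Continuous fun p : Plane × Plane => p.2 + p.1
    fun_prop
  have hTm : ∀ a, MeasurePreserving (T a) volume volume :=
    fun a => measurePreserving_add_right volume a
  have hcont : Continuous fun a => Lp.compMeasurePreserving (T a) (hTm a) (hv.toLp v) :=
    Continuous.compMeasurePreservingLp continuous_const hT hTm (by simp)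
  set W : Plane → ℝ≥0∞ := fun a => ∫⁻ x, ENNReal.ofReal ((v (x + a) - v x) ^ 2) with hW
  have hW_eq : ∀ a, W a =
      ENNReal.ofReal (‖Lp.compMeasurePreserving (T a) (hTm a) (hv.toLp v) - hv.toLp v‖ ^ 2) := by
    intro a
    have h1 : MemLp (fun x => v (x + a) - v x) 2 volume :=
      (hv.comp_measurePreserving (hTm a)).sub hv
    have h2 : Lp.compMeasurePreserving (T a) (hTm a) (hv.toLp v) - hv.toLp v = h1.toLp _ := by
      rw [Lp.toLp_compMeasurePreserving, ← MemLp.toLp_sub]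
      rfl
    rw [h2, ← real_inner_self_eq_norm_sq, L2.inner_def, hW]
    simp only
    rw [← ofReal_integral_eq_lintegral_ofReal h1.integrable_sq (.of_forall fun _ => sq_nonneg _)]
    congr 1
    refine integral_congr_ae ?_
    filter_upwards [h1.coeFn_toLp] with x hx
    simp [hx]
  have hW0 : Tendsto W (𝓝 0) (𝓝 0) := by
    have h1 : ContinuousAt (fun a => ENNReal.ofReal
        (‖Lp.compMeasurePreserving (T a) (hTm a) (hv.toLp v) - hv.toLp v‖ ^ 2)) 0 :=
      (ENNReal.continuous_ofReal.comp ((hcont.sub continuous_const).norm.pow 2)).continuousAt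
    have h2 : W = fun a => ENNReal.ofReal
        (‖Lp.compMeasurePreserving (T a) (hTm a) (hv.toLp v) - hv.toLp v‖ ^ 2) := funext hW_eq
    rw [← h2] at h1
    have h3 : W 0 = 0 := by simp [hW]
    rwa [ContinuousAt, h3] at h1
  rw [ENNReal.tendsto_nhds_zero] at hW0 ⊢
  intro ε hε
  obtain ⟨δ, hδ, hball⟩ := Metric.eventually_nhds_iff_ball.1 (hW0 ε hε)
  have hev : ∀ᶠ τ : ℝ in 𝓝[>] 0, 0 < τ ∧ τ * (|R| + 1) < δ := by
    have h1 : Tendsto (fun τ : ℝ => τ * (|R| + 1)) (𝓝[>] 0) (𝓝 0) := by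
      have : Continuous fun τ : ℝ => τ * (|R| + 1) := by fun_prop
      simpa using (this.tendsto 0).mono_left nhdsWithin_le_nhds
    exact eventually_mem_nhdsWithin.and (h1.eventually (gt_mem_nhds hδ))
  filter_upwards [hev] with τ ⟨hτ, hτδ⟩
  have hmeas : Measurable (Function.uncurry fun (x ξ : Plane) => ENNReal.ofReal (k ξ) *
      ENNReal.ofReal ((v (x + τ • ξ) - v x) ^ 2)) := by
    have h1 : Measurable fun p : Plane × Plane => p.1 + τ • p.2 := by fun_prop
    exact (k.measurable.comp measurable_snd).ennreal_ofReal.mul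
      (((hvm.comp h1).sub (hvm.comp measurable_fst)).pow_const 2).ennreal_ofReal
  -- After Fubini the inner integral is the squared L² distance between v and its translate by τξ.
  -- It is uniformly small for ξ in the bounded support of k, by continuity of translations.
  calc ∫⁻ x, ENNReal.ofReal ((avg k τ v x - v x) ^ 2)
      ≤ ∫⁻ x, ∫⁻ ξ, ENNReal.ofReal (k ξ) * ENNReal.ofReal ((v (x + τ • ξ) - v x) ^ 2) :=
        lintegral_mono fun x => ofReal_sq_avg_sub_le hk hk1 hτ.ne' hv x
    _ = ∫⁻ ξ, ∫⁻ x, ENNReal.ofReal (k ξ) * ENNReal.ofReal ((v (x + τ • ξ) - v x) ^ 2) :=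
        lintegral_lintegral_swap hmeas.aemeasurable
    _ = ∫⁻ ξ, ENNReal.ofReal (k ξ) * W (τ • ξ) := by
        refine lintegral_congr fun ξ => ?_
        rw [lintegral_const_mul]
        exact (((hvm.comp (measurable_add_const _)).sub hvm).pow_const 2).ennreal_ofReal
    _ ≤ ∫⁻ ξ, ENNReal.ofReal (k ξ) * ε := by
        refine lintegral_mono fun ξ => ?_
        by_cases hξ : ξ ∈ tsupport k
        · refine mul_le_mul' le_rfl (hball _ ?_)
          rw [mem_ball_zero_iff, norm_smul, Real.norm_of_nonneg hτ.le]
          have := hR ξ hξ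
          have h3 := le_abs_self R
          calc τ * ‖ξ‖ ≤ τ * (|R| + 1) := by gcongr; linarith
            _ < δ := hτδ
        · simp [image_eq_zero_of_notMem_tsupport hξ]
    _ = ε := by
        rw [lintegral_mul_const _ k.measurable.ennreal_ofReal, lintegral_ofReal_kernel hk hk1,
          one_mul]

/-- The fundamental theorem of calculus and Cauchy-Schwarz on an interval of length τ, which
produces the factor τ. Integration in x will produce the second one. -/
theorem Test.ofReal_sq_increment_le (φ : Test) (x ξ : Plane) {τ : ℝ} (hτ : 0 < τ) :
    ENNReal.ofReal ((φ (x + τ • ξ) - φ x) ^ 2) ≤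
      ENNReal.ofReal (τ * ‖ξ‖ ^ 2) *
        ∫⁻ s in Ioc 0 τ, ENNReal.ofReal (φ.gradSq (x + s • ξ)) := by
  have hline : Continuous fun t : ℝ => x + t • ξ := by fun_prop
  have hc : Continuous fun t : ℝ => fderiv ℝ φ (x + t • ξ) ξ :=
    (φ.continuous_fderiv_apply ξ).comp hline
  have hg : Continuous fun t : ℝ => φ.gradSq (x + t • ξ) := φ.continuous_gradSq.comp hline
  have h1 : ∫ t in 0..τ, fderiv ℝ φ (x + t • ξ) ξ = φ (x + τ • ξ) - φ x := by
    rw [intervalIntegral.integral_eq_sub_of_hasDerivAt (fun t _ => φ.hasDerivAt_ray x ξ t)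
      (hc.intervalIntegrable _ _)]
    simp
  have hmem : ∀ {f : ℝ → ℝ}, Continuous f → MemLp f 2 (volume.restrict (Ioc 0 τ)) := by
    intro f hf
    obtain ⟨B, hB⟩ := (isCompact_Icc (a := (0 : ℝ)) (b := τ)).exists_bound_of_continuousOn
      hf.continuousOn
    refine MemLp.of_bound hf.aestronglyMeasurable B ?_
    filter_upwards [ae_restrict_mem measurableSet_Ioc] with t ht
    exact hB t (Ioc_subset_Icc_self ht)
  have h2 := sq_integral_mul_le (hmem (f := fun _ => (1 : ℝ)) continuous_const) (hmem hc)
  rw [intervalIntegral.integral_of_le hτ.le] at h1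
  simp only [one_mul, one_pow, h1] at h2
  have hgi : IntegrableOn (fun s => φ.gradSq (x + s • ξ)) (Ioc 0 τ) :=
    (hg.integrableOn_Icc).mono_set Ioc_subset_Icc_self
  rw [← ofReal_integral_eq_lintegral_ofReal hgi (.of_forall fun _ => φ.gradSq_nonneg _),
    ← ENNReal.ofReal_mul (by positivity)]
  refine ENNReal.ofReal_le_ofReal (h2.trans ?_)
  have h3 : ∫ t in Ioc 0 τ, (1 : ℝ) = τ := by simp [hτ.le]
  rw [h3, mul_assoc]
  refine mul_le_mul_of_nonneg_left ?_ hτ.le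
  rw [← integral_const_mul]
  exact integral_mono (hmem hc).integrable_sq (hgi.const_mul _)
    fun s => φ.sq_fderiv_apply_le _ _

/-- Averages along a cone of directions approximate a function at first order. -/
theorem IsConeOpen.exists_avg_sub_le {U : Set Plane} {ξ₀ : Plane} {ρ : ℝ}
    (h : IsConeOpen U ξ₀ ρ) {k : Test} (hk : ∀ x, 0 ≤ k x) (hk1 : ∫ x, k x = 1)
    (hks : tsupport k ⊆ Metric.ball ξ₀ ρ) :
    ∃ M : ℝ, 0 ≤ M ∧ ∀ τ : ℝ, 0 < τ → ∀ φ : Test,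
      ∫⁻ x in U, ENNReal.ofReal ((avg k τ φ x - φ x) ^ 2) ≤
        ENNReal.ofReal (M * τ ^ 2 * ∫ x in U, φ.gradSq x) := by
  obtain ⟨R, hR⟩ := k.hasCompactSupport.isCompact.isBounded.exists_norm_le
  have hUm := h.isOpen.measurableSet
  refine ⟨R ^ 2, sq_nonneg _, fun τ hτ φ => ?_⟩
  -- Extension by zero is harmless because the rays that start in U remain there; it makes the
  -- translation invariance of the plane available.
  set G : Plane → ℝ≥0∞ := U.indicator fun y => ENNReal.ofReal (φ.gradSq y) with hG
  have hGm : Measurable G := (φ.continuous_gradSq.measurable.ennreal_ofReal).indicator hUm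
  have hGi : ∫⁻ y, G y = ENNReal.ofReal (∫ x in U, φ.gradSq x) := by
    rw [hG, lintegral_indicator hUm, ofReal_integral_eq_lintegral_ofReal (φ.integrable_gradSq _)
      (.of_forall φ.gradSq_nonneg)]
  have hpt : ∀ x ∈ U, ENNReal.ofReal ((avg k τ φ x - φ x) ^ 2) ≤
      ∫⁻ ξ, ENNReal.ofReal (k ξ) * (ENNReal.ofReal (τ * R ^ 2) *
        ∫⁻ s in Ioc 0 τ, G (x + s • ξ)) := by
    intro x hx
    refine (ofReal_sq_avg_sub_le hk hk1 hτ.ne' (φ.memLp 2 _) x).trans ?_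
    refine lintegral_mono fun ξ => ?_
    by_cases hξ : ξ ∈ tsupport k
    · refine mul_le_mul' le_rfl ((φ.ofReal_sq_increment_le x ξ hτ).trans (mul_le_mul' ?_ ?_))
      · refine ENNReal.ofReal_le_ofReal ?_
        have := hR ξ hξ
        gcongr
      · refine le_of_eq (setLIntegral_congr_fun measurableSet_Ioc fun s hs => ?_)
        simp only [hG]
        rw [indicator_of_mem (h.add_mem x hx ξ (hks hξ) s hs.1)]
    · simp [image_eq_zero_of_notMem_tsupport hξ]
  have hm3 : Measurable fun q : (Plane × Plane) × ℝ => G (q.1.1 + q.2 • q.1.2) :=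
    hGm.comp (by fun_prop)
  have hm2 : Measurable fun p : Plane × Plane => ∫⁻ s in Ioc 0 τ, G (p.1 + s • p.2) :=
    hm3.lintegral_prod_right'
  have hm1 : Measurable (Function.uncurry fun x ξ : Plane => ENNReal.ofReal (k ξ) *
      (ENNReal.ofReal (τ * R ^ 2) * ∫⁻ s in Ioc 0 τ, G (x + s • ξ))) :=
    (k.measurable.comp measurable_snd).ennreal_ofReal.mul (measurable_const.mul hm2)
  have hin : ∀ ξ, ∫⁻ x, ∫⁻ s in Ioc 0 τ, G (x + s • ξ) = ENNReal.ofReal τ * ∫⁻ y, G y := by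
    intro ξ
    rw [lintegral_lintegral_swap]
    · simp only [lintegral_add_right_eq_self]
      rw [setLIntegral_const, Real.volume_Ioc, sub_zero, mul_comm]
    · exact (hGm.comp (by fun_prop : Measurable fun p : Plane × ℝ => p.1 + p.2 • ξ)).aemeasurable
  calc ∫⁻ x in U, ENNReal.ofReal ((avg k τ φ x - φ x) ^ 2)
      ≤ ∫⁻ x in U, ∫⁻ ξ, ENNReal.ofReal (k ξ) * (ENNReal.ofReal (τ * R ^ 2) *
        ∫⁻ s in Ioc 0 τ, G (x + s • ξ)) := setLIntegral_mono' hUm hpt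
    _ ≤ ∫⁻ x, ∫⁻ ξ, ENNReal.ofReal (k ξ) * (ENNReal.ofReal (τ * R ^ 2) *
        ∫⁻ s in Ioc 0 τ, G (x + s • ξ)) := setLIntegral_le_lintegral _ _
    _ = ∫⁻ ξ, ∫⁻ x, ENNReal.ofReal (k ξ) * (ENNReal.ofReal (τ * R ^ 2) *
        ∫⁻ s in Ioc 0 τ, G (x + s • ξ)) := lintegral_lintegral_swap hm1.aemeasurable
    _ = ∫⁻ ξ, ENNReal.ofReal (k ξ) * (ENNReal.ofReal (τ * R ^ 2) *
        (ENNReal.ofReal τ * ∫⁻ y, G y)) := by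
        refine lintegral_congr fun ξ => ?_
        have hm0 : Measurable fun x : Plane => ∫⁻ s in Ioc 0 τ, G (x + s • ξ) :=
          hm2.comp (measurable_id.prodMk measurable_const)
        rw [lintegral_const_mul _ (hm0.const_mul _), lintegral_const_mul _ hm0, hin]
    _ = _ := by
        rw [lintegral_mul_const _ k.measurable.ennreal_ofReal, lintegral_ofReal_kernel hk hk1,
          one_mul, hGi, ← ENNReal.ofReal_mul hτ.le, ← ENNReal.ofReal_mul (by positivity)]
        congr 1
        ring

/-! ### Trace, Ladyzhenskaya and Rellich estimates on Lipschitz domains -/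

theorem IsLipschitzDomain.measurableSet {Ω : Set Plane} (hΩ : IsLipschitzDomain Ω) :
    MeasurableSet Ω := hΩ.isOpen.measurableSet

theorem IsLipschitzDomain.exists_partition {Ω : Set Plane} (hΩ : IsLipschitzDomain Ω) :
    ∃ (s : Finset Plane) (r : Plane → ℝ) (χ : Plane → Test),
      (∀ x ∈ s, IsAdaptedBall Ω x (r x) ∧ tsupport (χ x) ⊆ Metric.ball x (r x)) ∧
      ∀ y ∈ closure Ω, ∑ x ∈ s, χ x y = 1 :=
  FvK.exists_partition hΩ.isBounded.isCompact_closure fun _ hx => hΩ.exists_isAdaptedBall hx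

theorem eq_sum_mul {s : Finset Plane} {χ : Plane → Test} {y : Plane} (h : ∑ x ∈ s, χ x y = 1)
    (φ : Test) : φ y = ∑ x ∈ s, (χ x).mul φ y := by
  simp only [Test.mul_apply]
  rw [← Finset.sum_mul, h, one_mul]

theorem Test.mul_eq_zero_of_notMem {χ φ : Test} {B : Set Plane} (h : tsupport χ ⊆ B) {y : Plane}
    (hy : y ∉ B) : mul χ φ y = 0 := by
  rw [mul_apply, image_eq_zero_of_notMem_tsupport fun h' => hy (h h'), zero_mul]

theorem Test.gradSq_mul_eq_zero_of_notMem {χ φ : Test} {B : Set Plane} (h : tsupport χ ⊆ B)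
    {y : Plane} (hy : y ∉ B) : gradSq (mul χ φ) y = 0 :=
  gradSq_eq_zero fun h' => hy (h (tsupport_mul_subset_left χ φ h'))

/-- The trace inequality for test functions on a Lipschitz domain. -/
theorem IsLipschitzDomain.exists_trace_le {Ω : Set Plane} (hΩ : IsLipschitzDomain Ω) :
    ∃ C : ℝ, 0 ≤ C ∧ ∀ φ : Test, ∫⁻ y, ENNReal.ofReal (φ y ^ 2) ∂(bdryMeasure Ω) ≤
      ENNReal.ofReal (C * ((∫ y in Ω, φ y ^ 2) + ∫ y in Ω, φ.gradSq y)) := by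
  obtain ⟨s, r, χ, hs, hχ⟩ := hΩ.exists_partition
  have hloc : ∀ x, ∃ C : ℝ, 0 ≤ C ∧ (x ∈ s → ∀ φ : Test,
      ∫⁻ y, ENNReal.ofReal ((χ x).mul φ y ^ 2) ∂(bdryMeasure Ω) ≤
        ENNReal.ofReal (C * ((∫ y in Ω, φ y ^ 2) + ∫ y in Ω, φ.gradSq y))) := by
    intro x
    by_cases hx : x ∈ s
    · obtain ⟨⟨U, ξ₀, ρ, hU, hUΩ, C, hC0, hC⟩, hsupp⟩ := hs x hx
      obtain ⟨B, hB0, hB⟩ := (χ x).exists_mul_bound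
      refine ⟨C * (2 * B), by positivity, fun _ φ => ?_⟩
      refine (hC _ ((Test.tsupport_mul_subset_left _ _).trans hsupp)).trans
        (ENNReal.ofReal_le_ofReal ?_)
      rw [← setIntegral_eq_of_ball hΩ.measurableSet hU.isOpen.measurableSet hUΩ
          (fun y hy => by rw [Test.mul_eq_zero_of_notMem hsupp hy]; simp),
        ← setIntegral_eq_of_ball hΩ.measurableSet hU.isOpen.measurableSet hUΩ
          (fun y hy => Test.gradSq_mul_eq_zero_of_notMem hsupp hy), mul_assoc]
      refine mul_le_mul_of_nonneg_left ?_ hC0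
      obtain ⟨h1, h2⟩ := hB Ω φ
      have h3 : 0 ≤ ∫ y in Ω, φ.gradSq y := integral_nonneg φ.gradSq_nonneg
      nlinarith [mul_nonneg hB0 h3]
    · exact ⟨0, le_rfl, fun h => absurd h hx⟩
  choose C hC0 hC using hloc
  -- The cardinality comes from Cauchy-Schwarz for the finite sum over the partition.
  refine ⟨s.card * ∑ x ∈ s, C x,
    mul_nonneg (Nat.cast_nonneg _) (Finset.sum_nonneg fun x _ => hC0 x), fun φ => ?_⟩
  set N : ℝ := (∫ y in Ω, φ y ^ 2) + ∫ y in Ω, φ.gradSq y with hN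
  have hN0 : 0 ≤ N :=
    add_nonneg (integral_nonneg fun _ => sq_nonneg _) (integral_nonneg φ.gradSq_nonneg)
  calc ∫⁻ y, ENNReal.ofReal (φ y ^ 2) ∂(bdryMeasure Ω)
      ≤ ∫⁻ y, (s.card : ℝ≥0∞) * ∑ x ∈ s, ENNReal.ofReal ((χ x).mul φ y ^ 2)
          ∂(bdryMeasure Ω) := by
        refine lintegral_mono_ae ?_
        filter_upwards [ae_restrict_mem measurableSet_frontier] with y hy
        rw [eq_sum_mul (hχ y (frontier_subset_closure hy)) φ,
          ← ENNReal.ofReal_sum_of_nonneg fun x _ => sq_nonneg _,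
          ← ENNReal.ofReal_natCast, ← ENNReal.ofReal_mul (Nat.cast_nonneg _)]
        exact ENNReal.ofReal_le_ofReal sq_sum_le_card_mul_sum_sq
    _ = (s.card : ℝ≥0∞) * ∑ x ∈ s,
          ∫⁻ y, ENNReal.ofReal ((χ x).mul φ y ^ 2) ∂(bdryMeasure Ω) := by
        rw [lintegral_const_mul, lintegral_finsetSum]
        · exact fun x _ => (((χ x).mul φ).measurable.pow_const 2).ennreal_ofReal
        · exact Finset.measurable_fun_sum _ fun x _ =>
            (((χ x).mul φ).measurable.pow_const 2).ennreal_ofReal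
    _ ≤ (s.card : ℝ≥0∞) * ∑ x ∈ s, ENNReal.ofReal (C x * N) := by
        gcongr with x hx
        exact hC x hx φ
    _ = _ := by
        rw [← ENNReal.ofReal_sum_of_nonneg fun x _ => mul_nonneg (hC0 x) hN0,
          ← ENNReal.ofReal_natCast, ← ENNReal.ofReal_mul (Nat.cast_nonneg _), ← Finset.sum_mul,
          mul_assoc]

/-- Ladyzhenskaya's inequality for test functions on a Lipschitz domain. -/
theorem IsLipschitzDomain.exists_ladyzhenskaya {Ω : Set Plane} (hΩ : IsLipschitzDomain Ω) :
    ∃ C : ℝ, 0 ≤ C ∧ ∀ φ : Test, ∫ y in Ω, φ y ^ 4 ≤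
      C * (∫ y in Ω, φ y ^ 2) * ((∫ y in Ω, φ y ^ 2) + ∫ y in Ω, φ.gradSq y) := by
  obtain ⟨s, r, χ, hs, hχ⟩ := hΩ.exists_partition
  have hloc : ∀ x, ∃ C : ℝ, 0 ≤ C ∧ (x ∈ s → ∀ φ : Test,
      ∫ y in Ω, (χ x).mul φ y ^ 4 ≤
        C * (∫ y in Ω, φ y ^ 2) * ((∫ y in Ω, φ y ^ 2) + ∫ y in Ω, φ.gradSq y)) := by
    intro x
    by_cases hx : x ∈ s
    · obtain ⟨⟨U, ξ₀, ρ, hU, hUΩ, -⟩, hsupp⟩ := hs x hx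
      obtain ⟨B, hB0, hB⟩ := (χ x).exists_mul_bound
      obtain ⟨C, hC0, hC⟩ := hU.ladyzhenskaya
      refine ⟨C * B * B, by positivity, fun _ φ => ?_⟩
      have h0 := hC ((χ x).mul φ)
      rw [← setIntegral_eq_of_ball hΩ.measurableSet hU.isOpen.measurableSet hUΩ
          (fun y hy => by rw [Test.mul_eq_zero_of_notMem hsupp hy]; simp),
        ← setIntegral_eq_of_ball hΩ.measurableSet hU.isOpen.measurableSet hUΩ
          (fun y hy => by rw [Test.mul_eq_zero_of_notMem hsupp hy]; simp),
        ← setIntegral_eq_of_ball hΩ.measurableSet hU.isOpen.measurableSet hUΩ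
          (fun y hy => Test.gradSq_mul_eq_zero_of_notMem hsupp hy)] at h0
      obtain ⟨h1, h2⟩ := hB Ω φ
      refine h0.trans ?_
      have h3 : 0 ≤ ∫ y in Ω, φ y ^ 2 := integral_nonneg fun _ => sq_nonneg _
      calc _ ≤ C * (B * ∫ y in Ω, φ y ^ 2) *
            (B * ((∫ y in Ω, φ y ^ 2) + ∫ y in Ω, φ.gradSq y)) := by
            gcongr
            exact integral_nonneg (Test.gradSq_nonneg _)
        _ = _ := by ring
    · exact ⟨0, le_rfl, fun h => absurd h hx⟩
  choose C hC0 hC using hloc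
  -- Cauchy-Schwarz applied twice to a fourth power: a factor n² from squaring the first bound, and
  -- n from the second.
  refine ⟨(s.card : ℝ) ^ 3 * ∑ x ∈ s, C x,
    mul_nonneg (by positivity) (Finset.sum_nonneg fun x _ => hC0 x), fun φ => ?_⟩
  have hint : ∀ ψ : Test, Integrable (fun y => ψ y ^ 4) (volume.restrict Ω) := fun ψ =>
    ((ψ.mul ψ).integrable_sq _).congr (.of_forall fun x => by simp; ring)
  have hsum : Integrable (fun y => ∑ x ∈ s, (χ x).mul φ y ^ 4) (volume.restrict Ω) :=
    integrable_finsetSum _ fun x _ => hint _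
  calc ∫ y in Ω, φ y ^ 4
      ≤ ∫ y in Ω, (s.card : ℝ) ^ 3 * ∑ x ∈ s, (χ x).mul φ y ^ 4 := by
        refine setIntegral_mono_on (hint φ) (hsum.const_mul _) hΩ.measurableSet fun y hy => ?_
        rw [eq_sum_mul (hχ y (subset_closure hy)) φ]
        have h1 := sq_sum_le_card_mul_sum_sq (s := s) (f := fun x => (χ x).mul φ y)
        have h2 := sq_sum_le_card_mul_sum_sq (s := s) (f := fun x => (χ x).mul φ y ^ 2)
        calc _ = ((∑ x ∈ s, (χ x).mul φ y) ^ 2) ^ 2 := by ring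
          _ ≤ ((s.card : ℝ) * ∑ x ∈ s, (χ x).mul φ y ^ 2) ^ 2 := by gcongr
          _ = (s.card : ℝ) ^ 2 * (∑ x ∈ s, (χ x).mul φ y ^ 2) ^ 2 := by ring
          _ ≤ (s.card : ℝ) ^ 2 * ((s.card : ℝ) * ∑ x ∈ s, ((χ x).mul φ y ^ 2) ^ 2) := by gcongr
          _ = _ := by simp only [← pow_mul]; ring
    _ = (s.card : ℝ) ^ 3 * ∑ x ∈ s, ∫ y in Ω, (χ x).mul φ y ^ 4 := by
        rw [integral_const_mul, integral_finsetSum _ fun x _ => hint _]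
    _ ≤ (s.card : ℝ) ^ 3 * ∑ x ∈ s,
          C x * (∫ y in Ω, φ y ^ 2) * ((∫ y in Ω, φ y ^ 2) + ∫ y in Ω, φ.gradSq y) := by
        gcongr with x hx
        exact hC x hx φ
    _ = _ := by rw [← Finset.sum_mul, ← Finset.sum_mul]; ring

/-- The rescaled kernel `y ↦ k ((y - x) / τ)`. -/
def Test.rescale (k : Test) {τ : ℝ} (hτ : τ ≠ 0) (x : Plane) : Test :=
  ⟨fun y => k (τ⁻¹ • (y - x)),
    k.contDiff.comp (by fun_prop : ContDiff ℝ ∞ fun y : Plane => τ⁻¹ • (y - x)),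
    k.hasCompactSupport.comp_isClosedEmbedding (g := fun y => τ⁻¹ • (y - x))
      (((Homeomorph.subRight x).trans
        (Homeomorph.smulOfNeZero τ⁻¹ (inv_ne_zero hτ))).isClosedEmbedding)⟩

/-- The change of variables y = x + τξ has Jacobian τ² in the plane. In this form the average at x
is a pairing of v with a fixed test function. -/
theorem avg_eq_integral_rescale (k : Test) {τ : ℝ} (hτ : τ ≠ 0) (v : Plane → ℝ) (x : Plane) :
    avg k τ v x = (τ ^ 2)⁻¹ * ∫ y, k.rescale hτ x y * v y := by
  have h1 := Measure.integral_comp_smul (volume : Measure Plane)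
    (fun z => k (τ⁻¹ • z) * v (x + z)) τ
  have h2 : ∀ ξ : Plane, τ⁻¹ • τ • ξ = ξ := fun ξ => inv_smul_smul₀ hτ ξ
  simp only [h2] at h1
  rw [avg, h1, finrank_euclideanSpace_fin, abs_of_nonneg (by positivity), smul_eq_mul,
    ← integral_sub_right_eq_self _ x]
  congr 1
  refine integral_congr_ae (.of_forall fun y => ?_)
  simp only [add_sub_cancel]
  rfl

/-- Rellich's theorem, localized. Averages at a fixed scale τ tend to zero by weak convergence and
domination, while the error made by averaging is O(τ) in L², uniformly in n. The averages at points
of Ω see only Ω, so no extension operator is needed. -/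
theorem IsAdaptedBall.tendsto_integral_sq {Ω : Set Plane} (hΩm : MeasurableSet Ω)
    (hΩb : Bornology.IsBounded Ω) {x₀ : Plane} {r : ℝ} (hb : IsAdaptedBall Ω x₀ r) {χ : Test}
    (hχ : tsupport χ ⊆ Metric.ball x₀ r) {φ : ℕ → Test} {M : ℝ}
    (hM : ∀ n, (∫ y in Ω, φ n y ^ 2) + ∫ y in Ω, (φ n).gradSq y ≤ M)
    (hw : ∀ g : Test, Tendsto (fun n => ∫ y in Ω, φ n y * g y) atTop (𝓝 0)) :
    Tendsto (fun n => ∫ y in Ω, χ.mul (φ n) y ^ 2) atTop (𝓝 0) := by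
  obtain ⟨U, ξ₀, ρ, hU, hUΩ, -⟩ := hb
  obtain ⟨k, hk, hks, hk1⟩ := exists_kernel ξ₀ hU.pos
  obtain ⟨A, hA0, hA⟩ := hU.exists_avg_sub_le hk hk1 hks
  obtain ⟨B, hB0, hB⟩ := χ.exists_mul_bound
  have hUm := hU.isOpen.measurableSet
  set η : ℕ → Test := fun n => χ.mul (φ n) with hη
  set D : Set Plane := Ω ∩ Metric.ball x₀ r with hD
  have hDm : MeasurableSet D := hΩm.inter measurableSet_ball
  have hDU : D ⊆ U := fun y hy => (hUΩ y hy.2).1 hy.1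
  have hΩfin : volume Ω < ⊤ := hΩb.measure_lt_top
  have hDfin : volume D < ⊤ := (measure_mono inter_subset_left).trans_lt hΩfin
  have hη1 : ∀ n, ∫ y in Ω, η n y ^ 2 ≤ B * M := fun n => by
    refine (hB Ω (φ n)).1.trans (mul_le_mul_of_nonneg_left ?_ hB0)
    have : 0 ≤ ∫ y in Ω, (φ n).gradSq y := integral_nonneg (Test.gradSq_nonneg _)
    linarith [hM n]
  have hη2 : ∀ n, ∫ y in U, (η n).gradSq y ≤ B * M := fun n => by
    rw [← setIntegral_eq_of_ball hΩm hUm hUΩ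
      (fun y hy => Test.gradSq_mul_eq_zero_of_notMem hχ hy)]
    exact (hB Ω (φ n)).2.trans (mul_le_mul_of_nonneg_left (hM n) hB0)
  -- For x in D the rescaled kernel is supported in U. Inside the ball U agrees with Ω, and outside
  -- it the localized function vanishes.
  have havg : ∀ (τ : ℝ) (hτ : 0 < τ) (n : ℕ), ∀ x ∈ D,
      avg k τ (η n) x = (τ ^ 2)⁻¹ * ∫ y in Ω, η n y * k.rescale hτ.ne' x y := by
    intro τ hτ n x hx
    rw [avg_eq_integral_rescale k hτ.ne', setIntegral_eq_integral_of_forall_compl_eq_zero]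
    · simp only [mul_comm]
    · intro y hy
      by_cases hyB : y ∈ Metric.ball x₀ r
      · have hyU : y ∉ U := fun h => hy ((hUΩ y hyB).2 h)
        have : k.rescale hτ.ne' x y = 0 := by
          refine image_eq_zero_of_notMem_tsupport (f := k) fun h => hyU ?_
          have := hU.add_mem x (hDU hx) _ (hks h) τ hτ
          rwa [smul_inv_smul₀ hτ.ne', add_sub_cancel] at this
        rw [this, mul_zero]
      · rw [hη, Test.mul_eq_zero_of_notMem hχ hyB, zero_mul]
  obtain ⟨K, hK0, hK⟩ := k.exists_sq_bound
  -- At fixed τ, weak convergence gives pointwise convergence; Cauchy-Schwarz gives a constant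
  -- bound, integrable because D has finite measure.
  have hpt : ∀ τ : ℝ, 0 < τ → Tendsto (fun n => ∫⁻ x in D, ENNReal.ofReal (avg k τ (η n) x ^ 2))
      atTop (𝓝 0) := by
    intro τ hτ
    have hlim := tendsto_lintegral_of_dominated_convergence (μ := volume.restrict D)
      (F := fun n x => ENNReal.ofReal (avg k τ (η n) x ^ 2)) (f := fun _ => 0)
      (fun _ => ENNReal.ofReal (((τ ^ 2)⁻¹) ^ 2 * (B * M * (K * volume.real Ω))))
      (fun n => ((stronglyMeasurable_avg k τ (η n).measurable).measurable.pow_const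
        2).ennreal_ofReal) ?_ ?_ ?_
    · simpa using hlim
    · intro n
      filter_upwards [ae_restrict_mem hDm] with x hx
      refine ENNReal.ofReal_le_ofReal ?_
      rw [havg τ hτ n x hx, mul_pow]
      refine mul_le_mul_of_nonneg_left ?_ (sq_nonneg _)
      refine (sq_integral_mul_le ((η n).memLp 2 _) ((k.rescale hτ.ne' x).memLp 2 _)).trans ?_
      refine mul_le_mul (hη1 n) ?_ (integral_nonneg fun _ => sq_nonneg _)
        ((integral_nonneg fun _ => sq_nonneg _).trans (hη1 n))
      have : ∫ y in Ω, k.rescale hτ.ne' x y ^ 2 ≤ ∫ y in Ω, K := by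
        refine integral_mono ((k.rescale hτ.ne' x).integrable_sq _) ?_ fun y => hK _
        exact integrableOn_const hΩfin.ne
      simpa [mul_comm] using this
    · simp only [lintegral_const, Measure.restrict_apply MeasurableSet.univ, univ_inter]
      exact ENNReal.mul_ne_top ENNReal.ofReal_ne_top hDfin.ne
    · filter_upwards [ae_restrict_mem hDm] with x hx
      have h1 := hw (χ.mul (k.rescale hτ.ne' x))
      have h2 : Tendsto (fun n => avg k τ (η n) x) atTop (𝓝 0) := by
        have h3 := h1.const_mul ((τ ^ 2)⁻¹)
        rw [mul_zero] at h3
        refine h3.congr fun n => ?_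
        rw [havg τ hτ n x hx]
        congr 1
        refine integral_congr_ae (.of_forall fun y => ?_)
        simp only [hη, Test.mul_apply]
        ring
      have h4 := (ENNReal.continuous_ofReal.tendsto _).comp (h2.pow 2)
      simpa [Function.comp_def] using h4
  -- From a² ≤ 2b² + 2(b - a)²; the second part is estimated by the first order approximation along
  -- the cone.
  have hmain : ∀ (τ : ℝ), 0 < τ → ∀ n, ENNReal.ofReal (∫ y in Ω, η n y ^ 2) ≤
      2 * (∫⁻ x in D, ENNReal.ofReal (avg k τ (η n) x ^ 2)) +
        2 * ENNReal.ofReal (A * τ ^ 2 * (B * M)) := by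
    intro τ hτ n
    have e : ENNReal.ofReal (∫ y in Ω, η n y ^ 2) = ∫⁻ y in D, ENNReal.ofReal (η n y ^ 2) := by
      rw [ofReal_integral_eq_lintegral_ofReal ((η n).integrable_sq _)
        (.of_forall fun _ => sq_nonneg _), hD, inter_comm, ← setLIntegral_indicator
        measurableSet_ball]
      refine lintegral_congr fun y => ?_
      by_cases hy : y ∈ Metric.ball x₀ r
      · rw [indicator_of_mem hy]
      · rw [indicator_of_notMem hy, hη, Test.mul_eq_zero_of_notMem hχ hy]
        simp
    have hma : Measurable fun x => ENNReal.ofReal (avg k τ (η n) x ^ 2) :=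
      ((stronglyMeasurable_avg k τ (η n).measurable).measurable.pow_const 2).ennreal_ofReal
    have hms : Measurable fun x => ENNReal.ofReal ((avg k τ (η n) x - η n x) ^ 2) :=
      (((stronglyMeasurable_avg k τ (η n).measurable).measurable.sub
        (η n).measurable).pow_const 2).ennreal_ofReal
    rw [e]
    calc ∫⁻ y in D, ENNReal.ofReal (η n y ^ 2)
        ≤ ∫⁻ y in D, (2 * ENNReal.ofReal (avg k τ (η n) y ^ 2) +
            2 * ENNReal.ofReal ((avg k τ (η n) y - η n y) ^ 2)) := by
          refine lintegral_mono fun y => ?_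
          have h2 : (2 : ℝ≥0∞) = ENNReal.ofReal 2 := by simp
          rw [h2, ← ENNReal.ofReal_mul zero_le_two, ← ENNReal.ofReal_mul zero_le_two,
            ← ENNReal.ofReal_add (by positivity) (by positivity)]
          refine ENNReal.ofReal_le_ofReal ?_
          nlinarith [sq_nonneg (2 * avg k τ (η n) y - η n y)]
      _ = 2 * (∫⁻ x in D, ENNReal.ofReal (avg k τ (η n) x ^ 2)) +
            2 * ∫⁻ x in D, ENNReal.ofReal ((avg k τ (η n) x - η n x) ^ 2) := by
          rw [lintegral_add_left (hma.const_mul _), lintegral_const_mul _ hma,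
            lintegral_const_mul _ hms]
      _ ≤ _ := by
          gcongr
          refine (lintegral_mono_set hDU).trans ((hA τ hτ (η n)).trans ?_)
          refine ENNReal.ofReal_le_ofReal ?_
          have := hη2 n
          gcongr
  have hlim : Tendsto (fun n => ENNReal.ofReal (∫ y in Ω, η n y ^ 2)) atTop (𝓝 0) := by
    rw [ENNReal.tendsto_nhds_zero]
    intro ε hε
    have hε2 : 0 < ε / 2 := ENNReal.div_pos hε.ne' (by simp)
    have h1 : Tendsto (fun τ : ℝ => 2 * ENNReal.ofReal (A * τ ^ 2 * (B * M))) (𝓝[>] 0) (𝓝 0) := by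
      have hc : Continuous fun τ : ℝ => A * τ ^ 2 * (B * M) := by fun_prop
      have h2 := (ENNReal.continuous_ofReal.tendsto _).comp
        ((hc.tendsto 0).mono_left (nhdsWithin_le_nhds (s := Ioi 0)))
      have h3 := ENNReal.Tendsto.const_mul h2 (.inr (by simp : (2 : ℝ≥0∞) ≠ ⊤))
      simpa [Function.comp_def] using h3
    obtain ⟨τ, hτε, hτ⟩ := (((ENNReal.tendsto_nhds_zero.1 h1) _ hε2).and
      eventually_mem_nhdsWithin).exists
    have h2 := ENNReal.Tendsto.const_mul (hpt τ hτ) (.inr (by simp : (2 : ℝ≥0∞) ≠ ⊤))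
    rw [mul_zero] at h2
    filter_upwards [(ENNReal.tendsto_nhds_zero.1 h2) _ hε2] with n hn
    calc _ ≤ _ := hmain τ hτ n
      _ ≤ ε / 2 + ε / 2 := add_le_add hn hτε
      _ = ε := ENNReal.add_halves ε
  have h5 := (ENNReal.tendsto_toReal ENNReal.zero_ne_top).comp hlim
  refine h5.congr fun n => ?_
  exact ENNReal.toReal_ofReal (integral_nonneg fun _ => sq_nonneg _)

/-- Rellich's theorem for test functions on a Lipschitz domain. -/
theorem IsLipschitzDomain.tendsto_integral_sq {Ω : Set Plane} (hΩ : IsLipschitzDomain Ω)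
    {φ : ℕ → Test} {M : ℝ}
    (hM : ∀ n, (∫ y in Ω, φ n y ^ 2) + ∫ y in Ω, (φ n).gradSq y ≤ M)
    (hw : ∀ g : Test, Tendsto (fun n => ∫ y in Ω, φ n y * g y) atTop (𝓝 0)) :
    Tendsto (fun n => ∫ y in Ω, φ n y ^ 2) atTop (𝓝 0) := by
  obtain ⟨s, r, χ, hs, hχ⟩ := hΩ.exists_partition
  have h1 : Tendsto (fun n => (s.card : ℝ) * ∑ x ∈ s, ∫ y in Ω, (χ x).mul (φ n) y ^ 2) atTop
      (𝓝 ((s.card : ℝ) * ∑ x ∈ s, 0)) :=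
    (tendsto_finsetSum _ fun x hx => (hs x hx).1.tendsto_integral_sq hΩ.measurableSet
      hΩ.isBounded (hs x hx).2 hM hw).const_mul _
  rw [Finset.sum_const_zero, mul_zero] at h1
  refine squeeze_zero (fun n => integral_nonneg fun _ => sq_nonneg _) (fun n => ?_) h1
  have hint : ∀ x ∈ s, Integrable (fun y => (χ x).mul (φ n) y ^ 2) (volume.restrict Ω) :=
    fun x _ => ((χ x).mul (φ n)).integrable_sq _
  rw [← integral_finsetSum _ hint, ← integral_const_mul]
  refine setIntegral_mono_on ((φ n).integrable_sq _)
    ((integrable_finsetSum _ hint).const_mul _) hΩ.measurableSet fun y hy => ?_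
  rw [eq_sum_mul (hχ y (subset_closure hy)) (φ n)]
  exact sq_sum_le_card_mul_sum_sq

/-! ### Density of smooth functions -/

theorem H1.ext {Ω : Set Plane} {u v : H1 Ω} (h : valH1 u = valH1 v)
    (h' : ∀ i, derivH1 u i = derivH1 v i) : u = v := by
  refine Subtype.ext ((WithLp.ext_iff 2).2 (Prod.ext h ((WithLp.ext_iff 2).2 (funext h'))))

theorem memLp_test_mul {Ω : Set Plane} (χ : Test) (f : L2 Ω) :
    MemLp (fun x => χ x * f x) 2 (volume.restrict Ω) := by
  obtain ⟨B, hB0, hB⟩ := χ.exists_bound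
  refine (Lp.memLp f).of_le_mul (c := B)
    (χ.continuous.aestronglyMeasurable.mul (Lp.aestronglyMeasurable f)) (.of_forall fun x => ?_)
  rw [norm_mul]
  exact mul_le_mul_of_nonneg_right (hB x) (norm_nonneg _)

theorem memLp_test_mul_add {Ω : Set Plane} (χ χ' : Test) (f f' : L2 Ω) :
    MemLp (fun x => χ x * f x + χ' x * f' x) 2 (volume.restrict Ω) :=
  (memLp_test_mul χ f).add (memLp_test_mul χ' f')

theorem integrable_test_mul {Ω : Set Plane} (f : L2 Ω) (ψ : Test) :
    Integrable (fun x => f x * ψ x) (volume.restrict Ω) :=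
  (Lp.memLp f).integrable_mul (ψ.memLp 2 _)

/-- The integration by parts formula for the product of an element of `H¹(Ω)` with a cutoff. -/
theorem setIntegral_cutoff_mul_d {Ω : Set Plane} (u : H1 Ω) (χ ψ : Test)
    (h : tsupport (χ.mul ψ) ⊆ Ω) (i : Fin 2) :
    ∫ x in Ω, (χ x * valH1 u x) * Test.d i ψ x =
      -∫ x in Ω, (χ x * derivH1 u i x + Test.d i χ x * valH1 u x) * ψ x := by
  have h1 := u.2 i (χ.mul ψ) (χ.mul ψ).contDiff (χ.mul ψ).hasCompactSupport h
  have h2 : ∀ x, pderiv i (χ.mul ψ) x = χ x * Test.d i ψ x + Test.d i χ x * ψ x := fun x => by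
    rw [← Test.d_apply, Test.d_mul]; simp
  simp only [h2] at h1
  have e1 : ∫ x in Ω, u.1.fst x * (χ x * Test.d i ψ x + Test.d i χ x * ψ x) =
      (∫ x in Ω, (χ x * valH1 u x) * Test.d i ψ x) +
        ∫ x in Ω, (Test.d i χ x * valH1 u x) * ψ x := by
    rw [← integral_add]
    · refine integral_congr_ae (.of_forall fun x => ?_)
      simp only [valH1]
      ring
    · exact (integrable_test_mul (valH1 u) (χ.mul (Test.d i ψ))).congr
        (.of_forall fun x => by simp; ring)
    · exact (integrable_test_mul (valH1 u) ((Test.d i χ).mul ψ)).congr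
        (.of_forall fun x => by simp; ring)
  have e2 : ∫ x in Ω, (χ x * derivH1 u i x + Test.d i χ x * valH1 u x) * ψ x =
      (∫ x in Ω, u.1.snd i x * χ.mul ψ x) + ∫ x in Ω, (Test.d i χ x * valH1 u x) * ψ x := by
    rw [← integral_add]
    · refine integral_congr_ae (.of_forall fun x => ?_)
      simp only [derivH1, Test.mul_apply]
      ring
    · exact integrable_test_mul (derivH1 u i) (χ.mul ψ)
    · exact (integrable_test_mul (valH1 u) ((Test.d i χ).mul ψ)).congr
        (.of_forall fun x => by simp; ring)
  rw [e1] at h1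
  rw [e2]
  linarith

/-- The product of an element of `H¹(Ω)` with a test function. -/
def mulH1 {Ω : Set Plane} (χ : Test) (u : H1 Ω) : H1 Ω :=
  ⟨WithLp.toLp 2 ((memLp_test_mul χ (valH1 u)).toLp _, WithLp.toLp 2 fun i =>
    (memLp_test_mul_add χ (Test.d i χ) (derivH1 u i) (valH1 u)).toLp _), by
    intro i ψ h1 h2 h3
    have h4 : tsupport (χ.mul ⟨ψ, h1, h2⟩) ⊆ Ω := (Test.tsupport_mul_subset_right _ _).trans h3
    have h := setIntegral_cutoff_mul_d u χ ⟨ψ, h1, h2⟩ h4 i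
    calc _ = ∫ x in Ω, (χ x * valH1 u x) * Test.d i ⟨ψ, h1, h2⟩ x := by
          refine integral_congr_ae ?_
          filter_upwards [(memLp_test_mul χ (valH1 u)).coeFn_toLp] with x hx
          exact congrArg (· * pderiv i ψ x) hx
      _ = _ := h
      _ = _ := by
          congr 1
          refine integral_congr_ae ?_
          filter_upwards [(memLp_test_mul_add χ (Test.d i χ) (derivH1 u i)
            (valH1 u)).coeFn_toLp] with x hx
          exact congrArg (· * ψ x) hx.symm⟩

theorem valH1_mulH1 {Ω : Set Plane} (χ : Test) (u : H1 Ω) :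
    valH1 (mulH1 χ u) =ᵐ[volume.restrict Ω] fun x => χ x * valH1 u x :=
  (memLp_test_mul χ (valH1 u)).coeFn_toLp

theorem derivH1_mulH1 {Ω : Set Plane} (χ : Test) (u : H1 Ω) (i : Fin 2) :
    derivH1 (mulH1 χ u) i =ᵐ[volume.restrict Ω]
      fun x => χ x * derivH1 u i x + Test.d i χ x * valH1 u x :=
  (memLp_test_mul_add χ (Test.d i χ) (derivH1 u i) (valH1 u)).coeFn_toLp

theorem coeFn_finsetSum {Ω : Set Plane} {ι : Type*} (s : Finset ι) (f : ι → L2 Ω) :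
    (∑ j ∈ s, f j : L2 Ω) =ᵐ[volume.restrict Ω] fun x => ∑ j ∈ s, f j x := by
  classical
  induction s using Finset.induction_on with
  | empty =>
    filter_upwards [Lp.coeFn_zero ℝ 2 (volume.restrict Ω)] with x hx
    simpa using hx
  | insert a s ha ih =>
    rw [Finset.sum_insert ha]
    filter_upwards [Lp.coeFn_add (f a) (∑ j ∈ s, f j), ih] with x h1 h2
    rw [h1, Pi.add_apply, h2, Finset.sum_insert ha]

theorem Test.d_sum (i : Fin 2) {ι : Type*} (s : Finset ι) (φ : ι → Test) :
    d i (∑ j ∈ s, φ j) = ∑ j ∈ s, d i (φ j) :=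
  map_sum ({ toFun := d i, map_add' := d_add i, map_smul' := d_smul i } : Test →ₗ[ℝ] Test) φ s

/-- The cutoffs add up to one on an open set, hence their derivatives add up to zero there, and the
extra terms of the product rule cancel. -/
theorem eq_sum_mulH1 {Ω : Set Plane} (hΩ : IsOpen Ω) {s : Finset Plane} {χ : Plane → Test}
    (hχ : ∀ y ∈ Ω, ∑ x ∈ s, χ x y = 1) (u : H1 Ω) : u = ∑ x ∈ s, mulH1 (χ x) u := by
  have hd : ∀ i, ∀ y ∈ Ω, ∑ x ∈ s, Test.d i (χ x) y = 0 := by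
    intro i y hy
    rw [← Test.sum_apply, ← Test.d_sum, Test.d_apply, pderiv]
    have : (∑ x ∈ s, χ x : Test) =ᶠ[𝓝 y] fun _ => (1 : ℝ) := by
      filter_upwards [hΩ.mem_nhds hy] with z hz
      rw [Test.sum_apply, hχ z hz]
    rw [this.fderiv_eq]
    simp
  refine H1.ext ?_ fun i => ?_
  · rw [← valL_apply (∑ x ∈ s, mulH1 (χ x) u), map_sum]
    refine Lp.ext ?_
    have h1 : ∀ᵐ y ∂(volume.restrict Ω), ∀ x ∈ s, valH1 (mulH1 (χ x) u) y = χ x y * valH1 u y :=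
      (Finset.eventually_all s).2 fun x _ => valH1_mulH1 (χ x) u
    filter_upwards [coeFn_finsetSum s fun x => valL Ω (mulH1 (χ x) u), h1,
      ae_restrict_mem hΩ.measurableSet] with y h2 h3 h4
    simp only [valL_apply] at h2 ⊢
    rw [h2, Finset.sum_congr rfl h3, ← Finset.sum_mul, hχ y h4, one_mul]
  · rw [← derivL_apply (∑ x ∈ s, mulH1 (χ x) u), map_sum]
    refine Lp.ext ?_
    have h1 : ∀ᵐ y ∂(volume.restrict Ω), ∀ x ∈ s, derivH1 (mulH1 (χ x) u) i y =
        χ x y * derivH1 u i y + Test.d i (χ x) y * valH1 u y :=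
      (Finset.eventually_all s).2 fun x _ => derivH1_mulH1 (χ x) u i
    filter_upwards [coeFn_finsetSum s fun x => derivL Ω i (mulH1 (χ x) u), h1,
      ae_restrict_mem hΩ.measurableSet] with y h2 h3 h4
    simp only [derivL_apply] at h2 ⊢
    rw [h2, Finset.sum_congr rfl h3, Finset.sum_add_distrib, ← Finset.sum_mul, ← Finset.sum_mul,
      hχ y h4, hd i y h4, one_mul, zero_mul, add_zero]

theorem Test.d_rescale (k : Test) {τ : ℝ} (hτ : τ ≠ 0) (x : Plane) (i : Fin 2) :
    d i (k.rescale hτ x) = τ⁻¹ • (d i k).rescale hτ x := by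
  ext y
  have h1 : HasFDerivAt (fun y : Plane => τ⁻¹ • (y - x)) (τ⁻¹ • ContinuousLinearMap.id ℝ Plane) y :=
    ((hasFDerivAt_id y).sub_const x).const_smul τ⁻¹
  have h2 := (k.differentiable (τ⁻¹ • (y - x))).hasFDerivAt.comp y h1
  have h3 : fderiv ℝ (k.rescale hτ x) y = _ := h2.fderiv
  simp only [d_apply, smul_apply, pderiv, h3]
  simp [rescale, pderiv, d]

section Mollify

variable (k : Test) {τ : ℝ} {v : Plane → ℝ}

/-- The average looks forward along x + τξ, so it is a convolution with the reflected kernel; hence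
the scale -τ. -/
theorem avg_eq_convolution (hτ : τ ≠ 0) (v : Plane → ℝ) (x : Plane) :
    avg k τ v x = (τ ^ 2)⁻¹ *
      convolution v (k.rescale (neg_ne_zero.2 hτ) 0) (ContinuousLinearMap.mul ℝ ℝ) volume x := by
  rw [avg_eq_integral_rescale k hτ, convolution]
  congr 1
  refine integral_congr_ae (.of_forall fun y => ?_)
  simp only [ContinuousLinearMap.mul_apply', Test.rescale, sub_zero, inv_neg, neg_smul,
    ← smul_neg, neg_sub]
  ring

theorem contDiff_avg (hτ : τ ≠ 0) (hv : LocallyIntegrable v volume) : ContDiff ℝ ∞ (avg k τ v) := by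
  have h : avg k τ v = fun x => (τ ^ 2)⁻¹ *
      convolution v (k.rescale (neg_ne_zero.2 hτ) 0) (ContinuousLinearMap.mul ℝ ℝ) volume x :=
    funext (avg_eq_convolution k hτ v)
  rw [h]
  refine contDiff_const.mul ?_
  exact (Test.hasCompactSupport _).contDiff_convolution_right _ hv (Test.contDiff _)

/-- The derivative falls on the kernel, and the x-derivative of k((y - x)/τ) is minus its
y-derivative. This form can be matched with the definition of the weak derivative. -/
theorem pderiv_avg (hτ : τ ≠ 0) (hv : LocallyIntegrable v volume) (i : Fin 2) (x : Plane) :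
    pderiv i (avg k τ v) x = -((τ ^ 2)⁻¹ * ∫ y, v y * Test.d i (k.rescale hτ x) y) := by
  set κ := k.rescale (neg_ne_zero.2 hτ) 0 with hκ
  have h : avg k τ v = fun x => (τ ^ 2)⁻¹ *
      convolution v κ (ContinuousLinearMap.mul ℝ ℝ) volume x :=
    funext (avg_eq_convolution k hτ v)
  have hd := κ.hasCompactSupport.hasFDerivAt_convolution_right (ContinuousLinearMap.mul ℝ ℝ) hv
    (κ.contDiff.of_le (by simp)) x
  rw [h, pderiv, (hd.const_mul _).fderiv, _root_.smul_apply,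
    convolution_precompR_apply _ hv (κ.hasCompactSupport.fderiv ℝ)
      (κ.contDiff.continuous_fderiv (by simp)), smul_eq_mul, ← mul_neg, ← integral_neg, convolution]
  congr 1
  refine integral_congr_ae (.of_forall fun y => ?_)
  have h2 : fderiv ℝ κ (x - y) (EuclideanSpace.single i 1) = Test.d i κ (x - y) := rfl
  simp only [h2, ContinuousLinearMap.mul_apply']
  rw [hκ, Test.d_rescale, Test.d_rescale]
  simp only [Test.smul_apply, Test.rescale, sub_zero, inv_neg, neg_smul, ← smul_neg, neg_sub]
  ring

theorem support_avg_subset {K : Set Plane} {R δ : ℝ} (hR : ∀ ξ ∈ tsupport k, ‖ξ‖ ≤ R)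
    (hτ0 : 0 < τ) (hτδ : τ * R ≤ δ) (hv : ∀ x, x ∉ K → v x = 0) :
    Function.support (avg k τ v) ⊆ Metric.cthickening δ K := by
  intro x hx
  by_contra hxK
  refine hx ?_
  have : ∀ ξ, k ξ * v (x + τ • ξ) = 0 := by
    intro ξ
    by_cases hξ : ξ ∈ tsupport k
    · rw [hv, mul_zero]
      intro hmem
      refine hxK (Metric.mem_cthickening_of_dist_le x _ δ K hmem ?_)
      rw [dist_self_add_right, norm_smul, Real.norm_of_nonneg hτ0.le]
      exact (mul_le_mul_of_nonneg_left (hR ξ hξ) hτ0.le).trans hτδ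
    · rw [image_eq_zero_of_notMem_tsupport hξ, zero_mul]
  simp [avg, this]

end Mollify

theorem norm_toL2_sub_sq {Ω : Set Plane} (φ : Test) (f : L2 Ω) {g : Plane → ℝ}
    (h : f =ᵐ[volume.restrict Ω] g) :
    ‖Test.toL2 Ω φ - f‖ ^ 2 = (∫⁻ x in Ω, ENNReal.ofReal ((φ x - g x) ^ 2)).toReal := by
  rw [← real_inner_self_eq_norm_sq, L2.inner_def, ← integral_toReal]
  · refine integral_congr_ae ?_
    filter_upwards [Lp.coeFn_sub (Test.toL2 Ω φ) f, Test.coeFn_toL2 Ω φ, h] with x h1 h2 h3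
    rw [ENNReal.toReal_ofReal (sq_nonneg _), h1, Pi.sub_apply, h2, h3]
    simp
  · have hg : AEMeasurable g (volume.restrict Ω) :=
      (Lp.aestronglyMeasurable f).aemeasurable.congr h
    exact ((φ.measurable.aemeasurable.sub hg).pow_const 2).ennreal_ofReal
  · exact .of_forall fun _ => ENNReal.ofReal_lt_top

/-- Mollification along the inward cone. Extended by zero, χu may jump across the boundary of Ω, but
the kernel centred at a point of Ω in the ball is supported in U. There the extended functions still
satisfy the weak derivative identity, so averaging commutes with differentiation on Ω. -/
theorem IsAdaptedBall.mulH1_mem_closure {Ω : Set Plane} (hΩm : MeasurableSet Ω) {x₀ : Plane}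
    {r : ℝ} (hb : IsAdaptedBall Ω x₀ r) {χ : Test} (hχ : tsupport χ ⊆ Metric.ball x₀ r)
    (u : H1 Ω) : mulH1 χ u ∈ closure (range (Test.toH1 Ω)) := by
  obtain ⟨U, ξ₀, ρ, hU, hUΩ, -⟩ := hb
  obtain ⟨k, hk, hks, hk1⟩ := exists_kernel ξ₀ hU.pos
  obtain ⟨R, hR⟩ := k.hasCompactSupport.isCompact.isBounded.exists_norm_le
  obtain ⟨δ, hδ0, hδ⟩ := χ.hasCompactSupport.isCompact.exists_cthickening_subset_open
    Metric.isOpen_ball hχ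
  set v : Plane → ℝ := Ω.indicator fun y => χ y * valH1 u y with hv
  set w : Fin 2 → Plane → ℝ := fun i =>
    Ω.indicator fun y => χ y * derivH1 u i y + Test.d i χ y * valH1 u y with hw
  have hmeas : ∀ f : L2 Ω, Measurable f := fun f => (Lp.stronglyMeasurable f).measurable
  have hvm : Measurable v := (χ.measurable.mul (hmeas _)).indicator hΩm
  have hwm : ∀ i, Measurable (w i) := fun i =>
    ((χ.measurable.mul (hmeas _)).add ((Test.d i χ).measurable.mul (hmeas _))).indicator hΩm
  have hvL : MemLp v 2 volume := (memLp_indicator_iff_restrict hΩm).2 (memLp_test_mul _ _)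
  have hwL : ∀ i, MemLp (w i) 2 volume := fun i =>
    (memLp_indicator_iff_restrict hΩm).2 (memLp_test_mul_add _ _ _ _)
  have hvK : ∀ x, x ∉ tsupport χ → v x = 0 := fun x hx => by
    simp [hv, indicator, image_eq_zero_of_notMem_tsupport hx]
  have hwK : ∀ i x, x ∉ tsupport χ → w i x = 0 := fun i x hx => by
    have : Test.d i χ x = 0 :=
      image_eq_zero_of_notMem_tsupport fun h => hx (Test.tsupport_d_subset i χ h)
    simp only [hw, indicator, image_eq_zero_of_notMem_tsupport hx, this]
    simp
  have hvloc : LocallyIntegrable v volume := hvL.locallyIntegrable (by norm_num)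
  -- The support of ψ need only lie in U: multiplication by χ confines it to the ball, where U and Ω
  -- agree.
  have hweak : ∀ (i : Fin 2) (ψ : Test), tsupport ψ ⊆ U →
      ∫ y, v y * Test.d i ψ y = -∫ y, w i y * ψ y := by
    intro i ψ hψ
    have h1 : tsupport (χ.mul ψ) ⊆ Ω := fun y hy =>
      (hUΩ y (hχ (Test.tsupport_mul_subset_left _ _ hy))).2
        (hψ (Test.tsupport_mul_subset_right _ _ hy))
    have h2 := setIntegral_cutoff_mul_d u χ ψ h1 i
    rw [← integral_indicator hΩm, ← integral_indicator hΩm] at h2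
    have e1 : ∀ y, v y * Test.d i ψ y =
        Ω.indicator (fun x => (χ x * valH1 u x) * Test.d i ψ x) y := fun y => by
      by_cases hy : y ∈ Ω <;> simp [hv, hy]
    have e2 : ∀ y, w i y * ψ y = Ω.indicator
        (fun x => (χ x * derivH1 u i x + Test.d i χ x * valH1 u x) * ψ x) y := fun y => by
      by_cases hy : y ∈ Ω <;> simp [hw, hy]
    simp only [e1, e2]
    exact h2
  have hsupp : ∀ τ : ℝ, 0 < τ → τ * R ≤ δ → tsupport (avg k τ v) ⊆ Metric.cthickening δ (tsupport χ) :=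
    fun τ h1 h2 => closure_minimal (support_avg_subset k hR h1 h2 hvK) Metric.isClosed_cthickening
  have hcomp : ∀ τ : ℝ, 0 < τ → τ * R ≤ δ → HasCompactSupport (avg k τ v) := fun τ h1 h2 =>
    (χ.hasCompactSupport.isCompact.cthickening).of_isClosed_subset (isClosed_tsupport _)
      (hsupp τ h1 h2)
  classical
  -- The condition on τ keeps the support of the average in a thickening of that of χ, inside the
  -- ball. The value zero for other τ is irrelevant in the limit.
  let Φ : ℝ → Test := fun τ => if h : 0 < τ ∧ τ * R ≤ δ then
    ⟨avg k τ v, contDiff_avg k h.1.ne' hvloc, hcomp τ h.1 h.2⟩ else 0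
  have hev : ∀ᶠ τ : ℝ in 𝓝[>] 0, 0 < τ ∧ τ * R ≤ δ := by
    have h1 : Tendsto (fun τ : ℝ => τ * R) (𝓝[>] 0) (𝓝 0) := by
      have : Continuous fun τ : ℝ => τ * R := by fun_prop
      simpa using (this.tendsto 0).mono_left nhdsWithin_le_nhds
    exact eventually_mem_nhdsWithin.and ((h1.eventually (gt_mem_nhds hδ0)).mono fun _ h => h.le)
  have hΦ : ∀ τ, 0 < τ ∧ τ * R ≤ δ → ∀ x, Φ τ x = avg k τ v x := by
    intro τ h x
    simp only [Φ, h, and_self, dif_pos]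
  -- Equality holds inside the ball. Outside it the terms on the left vanish, and the inequality is
  -- all that is needed.
  have hΦd : ∀ τ, 0 < τ ∧ τ * R ≤ δ → ∀ i, ∀ x ∈ Ω,
      (Test.d i (Φ τ) x - w i x) ^ 2 ≤ (avg k τ (w i) x - w i x) ^ 2 := by
    intro τ h i x hx
    by_cases hxB : x ∈ Metric.ball x₀ r
    · have hxU : x ∈ U := (hUΩ x hxB).1 hx
      refine le_of_eq ?_
      congr 2
      have h1 : Test.d i (Φ τ) x = pderiv i (avg k τ v) x := by
        simp only [Φ, h, and_self, dif_pos]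
        rfl
      rw [h1, pderiv_avg k h.1.ne' hvloc, hweak, mul_neg, neg_neg, avg_eq_integral_rescale k h.1.ne']
      · simp only [mul_comm]
      · intro y hy
        have h2 : τ⁻¹ • (y - x) ∈ tsupport k :=
          tsupport_comp_subset_preimage k (f := fun y => τ⁻¹ • (y - x)) (by fun_prop) hy
        have h3 := hU.add_mem x hxU _ (hks h2) τ h.1
        rwa [smul_inv_smul₀ h.1.ne', add_sub_cancel] at h3
    · have h1 : Test.d i (Φ τ) x = 0 := by
        refine image_eq_zero_of_notMem_tsupport fun h2 => hxB (hδ (hsupp τ h.1 h.2 ?_))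
        have h3 := Test.tsupport_d_subset i _ h2
        have h4 : ((Φ τ : Test) : Plane → ℝ) = avg k τ v := funext (hΦ τ h)
        rwa [h4] at h3
      rw [h1, hwK i x fun h2 => hxB (hχ h2)]
      simpa using sq_nonneg _
  have hval : Tendsto (fun τ => ‖Test.toL2 Ω (Φ τ) - valH1 (mulH1 χ u)‖ ^ 2) (𝓝[>] 0) (𝓝 0) := by
    have h0 := (ENNReal.tendsto_toReal ENNReal.zero_ne_top).comp
      (tendsto_lintegral_avg_sub hk hk1 hvm hvL)
    have hfin := tendsto_lintegral_avg_sub hk hk1 hvm hvL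
    refine squeeze_zero' (.of_forall fun _ => sq_nonneg _) ?_ h0
    filter_upwards [hev, hfin.eventually (gt_mem_nhds (ENNReal.zero_lt_top))] with τ h hlt
    have hg : valH1 (mulH1 χ u) =ᵐ[volume.restrict Ω] v := by
      filter_upwards [valH1_mulH1 χ u, ae_restrict_mem hΩm] with x h1 h2
      rw [h1, hv, indicator_of_mem h2]
    rw [norm_toL2_sub_sq _ _ hg]
    refine ENNReal.toReal_mono hlt.ne ?_
    refine (setLIntegral_le_lintegral _ _).trans (le_of_eq ?_)
    simp only [hΦ τ h]
  have hder : ∀ i, Tendsto (fun τ => ‖Test.toL2 Ω (Test.d i (Φ τ)) - derivH1 (mulH1 χ u) i‖ ^ 2)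
      (𝓝[>] 0) (𝓝 0) := by
    intro i
    have hfin := tendsto_lintegral_avg_sub hk hk1 (hwm i) (hwL i)
    have h0 := (ENNReal.tendsto_toReal ENNReal.zero_ne_top).comp hfin
    refine squeeze_zero' (.of_forall fun _ => sq_nonneg _) ?_ h0
    filter_upwards [hev, hfin.eventually (gt_mem_nhds (ENNReal.zero_lt_top))] with τ h hlt
    have hg : derivH1 (mulH1 χ u) i =ᵐ[volume.restrict Ω] w i := by
      filter_upwards [derivH1_mulH1 χ u i, ae_restrict_mem hΩm] with x h1 h2
      rw [h1, hw]
      simp only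
      rw [indicator_of_mem h2]
    rw [norm_toL2_sub_sq _ _ hg]
    refine ENNReal.toReal_mono hlt.ne ?_
    refine (setLIntegral_mono' hΩm fun x hx => ENNReal.ofReal_le_ofReal (hΦd τ h i x hx)).trans ?_
    exact setLIntegral_le_lintegral _ _
  refine mem_closure_of_tendsto (f := fun τ => Test.toH1 Ω (Φ τ)) (b := 𝓝[>] (0 : ℝ)) ?_
    (.of_forall fun τ => mem_range_self _)
  rw [tendsto_iff_norm_sub_tendsto_zero]
  have hsq : Tendsto (fun τ => ‖Test.toH1 Ω (Φ τ) - mulH1 χ u‖ ^ 2) (𝓝[>] 0) (𝓝 0) := by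
    have h1 := hval.add (tendsto_finsetSum Finset.univ fun i _ => hder i)
    simp only [Finset.sum_const_zero, add_zero] at h1
    refine h1.congr fun τ => ?_
    rw [norm_sq_H1]
    rfl
  have h2 := hsq.sqrt
  simpa [Real.sqrt_sq (norm_nonneg _)] using h2

/-- Restrictions of test functions are dense in `H¹(Ω)`. -/
theorem IsLipschitzDomain.denseRange_toH1 {Ω : Set Plane} (hΩ : IsLipschitzDomain Ω) :
    DenseRange (Test.toH1 Ω) := by
  intro u
  obtain ⟨s, r, χ, hs, hχ⟩ := hΩ.exists_partition
  rw [eq_sum_mulH1 hΩ.isOpen (fun y hy => hχ y (subset_closure hy)) u]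
  have h : ((LinearMap.range (Test.toH1 Ω)).topologicalClosure : Set (H1 Ω)) =
      closure (range (Test.toH1 Ω)) := rfl
  rw [← h]
  exact Submodule.sum_mem _ fun x hx =>
    (hs x hx).1.mulH1_mem_closure hΩ.measurableSet (hs x hx).2 u

section

/-! ### A singular integral bound -/

open scoped FourierTransform SchwartzMap

/-- A test function, as a complex valued Schwartz function. -/
def Test.schwartz (φ : Test) : 𝓢(Plane, ℂ) :=
  HasCompactSupport.toSchwartzMap (f := fun x => (φ x : ℂ))
    (φ.hasCompactSupport.comp_left (g := fun r : ℝ => (r : ℂ)) Complex.ofReal_zero)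
    (Complex.ofRealCLM.contDiff.comp φ.contDiff)

theorem Test.schwartz_apply (φ : Test) (x : Plane) : φ.schwartz x = (φ x : ℂ) := rfl

/-- The translate of a test function. -/
def Test.shift (φ : Test) (v : Plane) : Test :=
  ⟨fun y => φ (y - v), φ.contDiff.comp (by fun_prop : ContDiff ℝ ∞ fun y : Plane => y - v),
    φ.hasCompactSupport.comp_isClosedEmbedding (g := fun y => y - v)
      (Homeomorph.subRight v).isClosedEmbedding⟩

@[simp] theorem Test.shift_apply (φ : Test) (v y : Plane) : φ.shift v y = φ (y - v) := rfl

theorem fourier_shift (φ : Test) (v p : Plane) :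
    𝓕 (φ.shift v).schwartz p = Real.fourierChar (-inner ℝ v p) • 𝓕 φ.schwartz p := by
  have h := congrFun (VectorFourier.fourierIntegral_comp_add_right Real.fourierChar
    (volume : Measure Plane) (innerₗ Plane) (φ.schwartz : Plane → ℂ) (-v)) p
  have e : ((φ.shift v).schwartz : Plane → ℂ) = (φ.schwartz : Plane → ℂ) ∘ fun y => y + -v := by
    ext y
    simp [Test.schwartz_apply, sub_eq_add_neg]
  rw [SchwartzMap.fourier_coe, SchwartzMap.fourier_coe, e]
  refine h.trans ?_
  simp only [innerₗ_apply_apply, inner_neg_left]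
  rfl

theorem fourier_d (φ : Test) (j : Fin 2) (p : Plane) :
    𝓕 (Test.d j φ).schwartz p = (2 * Real.pi * Complex.I * (p j : ℂ)) * 𝓕 φ.schwartz p := by
  have h := SchwartzMap.fourier_lineDerivOp_eq φ.schwartz (EuclideanSpace.single j (1 : ℝ))
  have e : (Test.d j φ).schwartz = LineDeriv.lineDerivOp (EuclideanSpace.single j (1 : ℝ)) φ.schwartz := by
    ext x
    rw [SchwartzMap.lineDerivOp_apply_eq_fderiv, Test.schwartz_apply]
    have h1 : HasFDerivAt (φ.schwartz : Plane → ℂ) (Complex.ofRealCLM.comp (fderiv ℝ φ x)) x :=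
      Complex.ofRealCLM.hasFDerivAt.comp x (φ.differentiable x).hasFDerivAt
    rw [h1.fderiv]
    rfl
  rw [e, h]
  simp only [_root_.smul_apply]
  rw [SchwartzMap.smulLeftCLM_apply_apply (by fun_prop)]
  simp [EuclideanSpace.inner_single_right]
  ring

/-- Plancherel's theorem, for the pairing of a square integrable function with test functions. -/
theorem exists_fourier_pairing {F : Plane → ℝ} (hF : MemLp F 2 volume) :
    ∃ G : Plane → ℂ, Measurable G ∧ MemLp G 2 volume ∧ ∫ p, ‖G p‖ ^ 2 = ∫ x, F x ^ 2 ∧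
      ∀ φ : Test, ((∫ x, F x * φ x : ℝ) : ℂ) = ∫ p, G p * 𝓕 φ.schwartz p := by
  have hFc : MemLp (fun x => (F x : ℂ)) 2 volume := hF.ofReal
  set f : Lp ℂ 2 (volume : Measure Plane) := hFc.toLp _ with hf
  set g : Lp ℂ 2 (volume : Measure Plane) := 𝓕 f with hg
  -- The complex inner product is conjugate linear in its first argument, so the conjugate of the
  -- transform of F gives a bilinear pairing.
  refine ⟨fun p => (starRingEnd ℂ) (g p), ?_, ?_, ?_, fun φ => ?_⟩
  · exact Complex.continuous_conj.measurable.comp (Lp.stronglyMeasurable g).measurable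
  · exact (Lp.memLp g).star
  · have h1 : ‖g‖ = ‖f‖ := Lp.norm_fourier_eq f
    have h2 : ∀ k : Lp ℂ 2 (volume : Measure Plane), ‖k‖ ^ 2 = ∫ x, ‖k x‖ ^ 2 := by
      intro k
      have h3 : ((‖k‖ ^ 2 : ℝ) : ℂ) = ((∫ x, ‖k x‖ ^ 2 : ℝ) : ℂ) := by
        have h4 := inner_self_eq_norm_sq_to_K (𝕜 := ℂ) k
        rw [L2.inner_def] at h4
        push_cast at h4 ⊢
        refine h4.symm.trans ?_
        rw [← integral_complex_ofReal]
        refine integral_congr_ae (.of_forall fun x => ?_)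
        simp only
        rw [inner_self_eq_norm_sq_to_K]
        push_cast
        rfl
      exact_mod_cast h3
    have h3 := h2 g
    rw [h1, h2 f] at h3
    simp only [RCLike.norm_conj]
    rw [← h3]
    refine integral_congr_ae ?_
    filter_upwards [hFc.coeFn_toLp] with x hx
    rw [hf, hx]
    simp
  · have h1 := Lp.inner_fourier_eq f (φ.schwartz.toLp 2)
    rw [SchwartzMap.toLp_fourier_eq, L2.inner_def, L2.inner_def] at h1
    have h2 : ((∫ x, F x * φ x : ℝ) : ℂ) = ∫ x, inner ℂ (f x) (φ.schwartz.toLp 2 volume x) := by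
      rw [← integral_complex_ofReal]
      refine integral_congr_ae ?_
      filter_upwards [hFc.coeFn_toLp, φ.schwartz.coeFn_toLp 2 volume] with x h3 h4
      rw [hf, h3, h4, Test.schwartz_apply]
      simp [mul_comm]
    rw [h2, ← h1]
    refine integral_congr_ae ?_
    filter_upwards [(𝓕 φ.schwartz).coeFn_toLp 2 volume] with x h3
    rw [h3]
    simp [hg, mul_comm]

theorem integral_norm_sq_fourier_test (ψ : Test) :
    ∫ p, ‖𝓕 ψ.schwartz p‖ ^ 2 = ∫ x, ψ x ^ 2 := by
  rw [SchwartzMap.integral_norm_sq_fourier]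
  simp [Test.schwartz_apply]

/-- The Fourier transform of a test function decays fast enough for its integrals along rays
through the origin to be bounded. -/
theorem exists_lintegral_fourier_ray_le (m : Test) : ∃ C : ℝ, 0 ≤ C ∧ ∀ (R : ℝ) (p : Plane), 0 < R →
    ENNReal.ofReal ‖p‖ * ∫⁻ t in Ioc 0 R, ‖𝓕 m.schwartz (t • p)‖ₑ ≤ ENNReal.ofReal C := by
  obtain ⟨C₀, hC₀, h0⟩ := (𝓕 m.schwartz).decay 0 0
  obtain ⟨C₂, hC₂, h2⟩ := (𝓕 m.schwartz).decay 2 0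
  simp only [pow_zero, one_mul, norm_iteratedFDeriv_zero] at h0 h2
  have hdec : ∀ q, ‖𝓕 m.schwartz q‖ ≤ (C₀ + C₂) / (1 + ‖q‖ ^ 2) := by
    intro q
    rw [le_div_iff₀ (by positivity)]
    linarith [h0 q, h2 q]
  refine ⟨(C₀ + C₂) * (Real.pi / 2), by positivity, fun R p hR => ?_⟩
  -- With decay 1/(1 + |q|²), the ray integral multiplied by |p| is an arctangent increment, bounded
  -- by π/2 uniformly in p and R.
  have hd : ∀ t : ℝ, HasDerivAt (fun t => Real.arctan (t * ‖p‖))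
      (1 / (1 + (t * ‖p‖) ^ 2) * ‖p‖) t := fun t => by
    have := (Real.hasDerivAt_arctan (t * ‖p‖)).comp t ((hasDerivAt_id t).mul_const ‖p‖)
    simpa [Function.comp_def] using this
  have hc : Continuous fun t : ℝ => 1 / (1 + (t * ‖p‖) ^ 2) * ‖p‖ := by
    refine (continuous_const.div (by fun_prop) fun t => ?_).mul continuous_const
    positivity
  have hint : ∫ t in Ioc 0 R, 1 / (1 + (t * ‖p‖) ^ 2) * ‖p‖ ≤ Real.pi / 2 := by
    rw [← intervalIntegral.integral_of_le hR.le,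
      intervalIntegral.integral_eq_sub_of_hasDerivAt (fun t _ => hd t) (hc.intervalIntegrable _ _)]
    simp only [zero_mul, Real.arctan_zero, sub_zero]
    exact (Real.arctan_lt_pi_div_two _).le
  rw [← lintegral_const_mul']
  swap
  · exact ENNReal.ofReal_ne_top
  calc ∫⁻ t in Ioc 0 R, ENNReal.ofReal ‖p‖ * ‖𝓕 m.schwartz (t • p)‖ₑ
      ≤ ∫⁻ t in Ioc 0 R, ENNReal.ofReal ((C₀ + C₂) * (1 / (1 + (t * ‖p‖) ^ 2) * ‖p‖)) := by
        refine lintegral_mono fun t => ?_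
        rw [← ofReal_norm, ← ENNReal.ofReal_mul (norm_nonneg _)]
        refine ENNReal.ofReal_le_ofReal ?_
        have h3 := hdec (t • p)
        rw [norm_smul, mul_pow, Real.norm_eq_abs, sq_abs, ← mul_pow] at h3
        calc _ ≤ ‖p‖ * ((C₀ + C₂) / (1 + (t * ‖p‖) ^ 2)) := by gcongr
          _ = _ := by ring
    _ = ENNReal.ofReal (∫ t in Ioc 0 R, (C₀ + C₂) * (1 / (1 + (t * ‖p‖) ^ 2) * ‖p‖)) := by
        rw [ofReal_integral_eq_lintegral_ofReal]
        · exact ((hc.integrableOn_Icc).mono_set Ioc_subset_Icc_self).const_mul _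
        · exact .of_forall fun t => by positivity
    _ ≤ _ := by
        refine ENNReal.ofReal_le_ofReal ?_
        rw [integral_const_mul]
        gcongr

theorem integrable_ray_prod (m : Test) {c : Plane → ℝ} (hc : Continuous c) {B : ℝ}
    (hB : ∀ v, |c v| ≤ B) (R : ℝ) :
    Integrable (fun q : ℝ × Plane => m q.2 * c (q.1 • q.2))
      ((volume.restrict (Ioc 0 R)).prod volume) := by
  have h1 : Integrable (fun q : ℝ × Plane => (1 : ℝ) * m q.2)
      ((volume.restrict (Ioc 0 R)).prod volume) :=
    Integrable.mul_prod (f := fun _ : ℝ => (1 : ℝ)) (integrable_const _) (m.integrable _)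
  have h2 : Continuous fun q : ℝ × Plane => c (q.1 • q.2) := hc.comp (by fun_prop)
  refine (h1.bdd_mul (c := B) h2.aestronglyMeasurable (.of_forall fun q => hB _)).congr
    (.of_forall fun q => ?_)
  simp only
  ring

/-- The bound for the singular integral with kernel `∂ⱼ ∫ m(ξ) δ_{tξ} dξ dt`. -/
theorem exists_singular_integral_le (m : Test) : ∃ C : ℝ, 0 ≤ C ∧ ∀ (R : ℝ), 0 < R →
    ∀ (F : Plane → ℝ), MemLp F 2 volume → ∀ (ψ : Test) (j : Fin 2) (c : Plane → ℝ),
      Continuous c → (∃ B, ∀ v, |c v| ≤ B) →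
      (∀ v, c v = ∫ y, F y * (Test.d j ψ).shift v y) →
      |∫ q : ℝ × Plane, m q.2 * c (q.1 • q.2) ∂((volume.restrict (Ioc 0 R)).prod volume)| ≤
        C * (√(∫ x, F x ^ 2) * √(∫ x, ψ x ^ 2)) := by
  obtain ⟨C, hC0, hC⟩ := exists_lintegral_fourier_ray_le m
  refine ⟨2 * Real.pi * C, by positivity, fun R hR F hF ψ j c hcont ⟨B, hB⟩ hc => ?_⟩
  obtain ⟨G, hGm, hG2, hGn, hG⟩ := exists_fourier_pairing hF
  set M : 𝓢(Plane, ℂ) := 𝓕 m.schwartz with hM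
  set Ψ : 𝓢(Plane, ℂ) := 𝓕 ψ.schwartz with hΨ
  set N : Plane → ℂ := fun p => G p * 𝓕 (Test.d j ψ).schwartz p with hN
  have hΨ2 : MemLp Ψ 2 volume := Ψ.memLp 2 volume
  have hNi : Integrable N := hG2.integrable_mul ((𝓕 (Test.d j ψ).schwartz).memLp 2 volume)
  have hNm : Measurable N := hGm.mul (𝓕 (Test.d j ψ).schwartz).continuous.measurable
  have hcv : ∀ v, (c v : ℂ) = ∫ p, Real.fourierChar (-inner ℝ v p) • N p := by
    intro v
    rw [hc, hG]
    refine integral_congr_ae (.of_forall fun p => ?_)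
    -- A shift becomes a character, so c is the Fourier transform of the integrable function N.
    simp only [fourier_shift, hN]
    rw [mul_smul_comm]
  -- Fubini: integrating the characters in ξ against m gives the transform of m at tp, so that t
  -- enters only through the multiplier.
  have hswap : ∀ t : ℝ, ((∫ ξ, m ξ * c (t • ξ) : ℝ) : ℂ) = ∫ p, M (t • p) * N p := by
    intro t
    have h1 : ∀ ξ, ((m ξ * c (t • ξ) : ℝ) : ℂ) =
        ∫ p, Real.fourierChar (-inner ℝ (t • ξ) p) • ((m ξ : ℂ) * N p) := by
      intro ξ
      rw [Complex.ofReal_mul, hcv, ← integral_const_mul]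
      refine integral_congr_ae (.of_forall fun p => ?_)
      simp only [mul_smul_comm]
    rw [← integral_complex_ofReal]
    rw [integral_congr_ae (.of_forall h1), integral_integral_swap]
    · refine integral_congr_ae (.of_forall fun p => ?_)
      simp only [hM]
      rw [SchwartzMap.fourier_coe, Real.fourier_eq, ← integral_mul_const]
      refine integral_congr_ae (.of_forall fun ξ => ?_)
      simp only [Test.schwartz_apply]
      rw [real_inner_smul_left, real_inner_smul_right, smul_mul_assoc]
    · have h2 : Integrable (fun q : Plane × Plane => (m q.1 : ℂ) * N q.2) (volume.prod volume) :=
        Integrable.mul_prod (f := fun ξ => (m ξ : ℂ)) ((m.integrable volume).ofReal) hNi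
      have h3 : Continuous fun q : Plane × Plane =>
          ((Real.fourierChar (-inner ℝ (t • q.1) q.2) : Circle) : ℂ) := by
        have := Real.continuous_fourierChar
        fun_prop
      refine (h2.bdd_mul (c := 1) h3.aestronglyMeasurable (.of_forall fun q => ?_)).congr
        (.of_forall fun q => rfl)
      exact (Circle.norm_coe _).le
  have hle : ‖((∫ q : ℝ × Plane, m q.2 * c (q.1 • q.2)
      ∂((volume.restrict (Ioc 0 R)).prod volume) : ℝ) : ℂ)‖ₑ ≤
      ENNReal.ofReal (2 * Real.pi * C * (√(∫ x, F x ^ 2) * √(∫ x, ψ x ^ 2))) := by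
    rw [integral_prod _ (integrable_ray_prod m hcont hB R), ← integral_complex_ofReal]
    calc _ ≤ ∫⁻ t in Ioc 0 R, ‖((∫ ξ, m ξ * c (t • ξ) : ℝ) : ℂ)‖ₑ :=
          enorm_integral_le_lintegral_enorm _
      _ ≤ ∫⁻ t in Ioc 0 R, ∫⁻ p, ‖M (t • p)‖ₑ * ‖N p‖ₑ := by
          refine lintegral_mono fun t => ?_
          rw [hswap]
          refine (enorm_integral_le_lintegral_enorm _).trans (le_of_eq ?_)
          exact lintegral_congr fun p => enorm_mul _ _
      _ = ∫⁻ p, ∫⁻ t in Ioc 0 R, ‖M (t • p)‖ₑ * ‖N p‖ₑ := by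
          refine lintegral_lintegral_swap ?_
          have h1 : Continuous fun q : ℝ × Plane => M (q.1 • q.2) :=
            M.continuous.comp (by fun_prop)
          exact (h1.measurable.enorm.mul (hNm.comp measurable_snd).enorm).aemeasurable
      -- The derivative contributes a symbol of size at most 2π|p|, and |p| times the ray integral
      -- of the transform of m is bounded by C: the operator has order zero, with a bound that does
      -- not depend on R.
      _ ≤ ∫⁻ p, ENNReal.ofReal (2 * Real.pi * C * (‖G p‖ * ‖Ψ p‖)) := by
          refine lintegral_mono fun p => ?_
          rw [lintegral_mul_const']
          swap
          · exact enorm_ne_top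
          have h1 : ‖N p‖ₑ ≤ ENNReal.ofReal ‖p‖ * ENNReal.ofReal (2 * Real.pi * (‖G p‖ * ‖Ψ p‖)) := by
            rw [← ENNReal.ofReal_mul (norm_nonneg _), ← ofReal_norm]
            refine ENNReal.ofReal_le_ofReal ?_
            simp only [hN]
            rw [fourier_d, norm_mul, norm_mul, norm_mul, norm_mul, norm_mul]
            have h2 := PiLp.norm_apply_le p j
            simp only [Complex.norm_I, Complex.norm_real, RCLike.norm_ofNat, mul_one,
              Real.norm_of_nonneg Real.pi_pos.le]
            calc _ ≤ ‖G p‖ * (2 * Real.pi * ‖p‖ * ‖Ψ p‖) := by gcongr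
              _ = _ := by ring
          calc _ ≤ (∫⁻ t in Ioc 0 R, ‖M (t • p)‖ₑ) *
                (ENNReal.ofReal ‖p‖ * ENNReal.ofReal (2 * Real.pi * (‖G p‖ * ‖Ψ p‖))) := by gcongr
            _ = (ENNReal.ofReal ‖p‖ * ∫⁻ t in Ioc 0 R, ‖M (t • p)‖ₑ) *
                ENNReal.ofReal (2 * Real.pi * (‖G p‖ * ‖Ψ p‖)) := by ring
            _ ≤ ENNReal.ofReal C * ENNReal.ofReal (2 * Real.pi * (‖G p‖ * ‖Ψ p‖)) := by
                gcongr
                exact hC R p hR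
            _ = _ := by
                rw [← ENNReal.ofReal_mul hC0]
                congr 1
                ring
      _ = ENNReal.ofReal (∫ p, 2 * Real.pi * C * (‖G p‖ * ‖Ψ p‖)) := by
          rw [ofReal_integral_eq_lintegral_ofReal]
          · exact (hG2.norm.integrable_mul hΨ2.norm).const_mul _
          · exact .of_forall fun p => by positivity
      _ ≤ _ := by
          refine ENNReal.ofReal_le_ofReal ?_
          rw [integral_const_mul]
          refine mul_le_mul_of_nonneg_left ?_ (by positivity)
          refine le_of_sq_le_sq ?_ (by positivity)
          rw [mul_pow, Real.sq_sqrt (integral_nonneg fun _ => sq_nonneg _),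
            Real.sq_sqrt (integral_nonneg fun _ => sq_nonneg _), ← hGn,
            ← integral_norm_sq_fourier_test]
          exact sq_integral_mul_le hG2.norm hΨ2.norm
  rw [← ofReal_norm, Complex.norm_real, Real.norm_eq_abs] at hle
  exact (ENNReal.ofReal_le_ofReal_iff (by positivity)).1 hle

end

/-! ### Korn's inequality -/

/-- The product of a coordinate and a test function. -/
def Test.coordMul (a : Fin 2) (φ : Test) : Test :=
  ⟨fun x => x a * φ x, (by fun_prop : ContDiff ℝ ∞ fun x : Plane => x a).mul φ.contDiff,
    φ.hasCompactSupport.mul_left (f := fun x : Plane => x a)⟩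

@[simp] theorem Test.coordMul_apply (a : Fin 2) (φ : Test) (x : Plane) :
    φ.coordMul a x = x a * φ x := rfl

/-- Integration by parts. These first moments of ∂ᵢk are what selects the single component uᵢ from ξ
· u in the representation of a field by its strain. -/
theorem Test.integral_coordMul_d (a i : Fin 2) (φ : Test) :
    ∫ x, (Test.d i φ).coordMul a x = if a = i then -∫ x, φ x else 0 := by
  have h1 : ∀ x : Plane, HasFDerivAt (fun x : Plane => x a)
      (EuclideanSpace.proj a : Plane →L[ℝ] ℝ) x :=
    fun x => (EuclideanSpace.proj a : Plane →L[ℝ] ℝ).hasFDerivAt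
  have e : ∀ x, fderiv ℝ (fun x : Plane => x a) x (EuclideanSpace.single i 1) =
      if a = i then 1 else 0 := fun x => by
    rw [(h1 x).fderiv]
    simp
  have h := integral_mul_fderiv_eq_neg_fderiv_mul_of_integrable (μ := volume)
    (f := fun x : Plane => x a) (g := φ) (v := EuclideanSpace.single i 1) ?_ ?_ ?_
    (fun x _ => (h1 x).differentiableAt) (fun x _ => φ.differentiable x)
  · refine h.trans ?_
    simp only [e]
    split_ifs <;> simp
  · simp only [e]
    split_ifs
    · simpa using φ.integrable _
    · simp
  · exact ((Test.d i φ).coordMul a).integrable _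
  · exact (φ.coordMul a).integrable _

/-- The symmetric part of the gradient of a smooth vector field. -/
def Test.strain (u : Fin 2 → Test) (a b : Fin 2) : Test :=
  (1 / 2 : ℝ) • (Test.d b (u a) + Test.d a (u b))

theorem Test.strain_apply (u : Fin 2 → Test) (a b : Fin 2) (x : Plane) :
    Test.strain u a b x = (Test.d b (u a) x + Test.d a (u b) x) / 2 := by
  simp only [strain, smul_apply, add_apply]
  ring

theorem continuous_integral_mul_shift {F : Plane → ℝ} (hF : Integrable F) (ψ : Test) :
    Continuous fun v => ∫ y, F y * ψ.shift v y := by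
  have hs : HasCompactSupport fun z => ψ (-z) :=
    ψ.hasCompactSupport.comp_homeomorph (Homeomorph.neg Plane)
  have h := hs.continuous_convolution_right (ContinuousLinearMap.mul ℝ ℝ) (μ := volume)
    hF.locallyIntegrable (ψ.continuous.comp continuous_neg)
  refine h.congr fun v => ?_
  simp [MeasureTheory.convolution]

theorem exists_abs_integral_mul_shift_le {F : Plane → ℝ} (hF : Integrable F) (ψ : Test) :
    ∃ B, ∀ v, |∫ y, F y * ψ.shift v y| ≤ B := by
  obtain ⟨B, h0, hB⟩ := ψ.exists_bound
  refine ⟨∫ y, |F y| * B, fun v => (abs_integral_le_integral_abs).trans ?_⟩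
  refine integral_mono_of_nonneg (.of_forall fun _ => abs_nonneg _) (hF.abs.mul_const _)
    (.of_forall fun y => ?_)
  simp only [abs_mul]
  gcongr
  exact hB _

/-- Integration along a segment of the directional derivative. -/
theorem integral_ray_fderiv (V ψ : Test) (ξ : Plane) {R : ℝ} (hR : 0 < R)
    (h : ∀ x ∈ tsupport ψ, V (x + R • ξ) = 0) :
    ∫ t in Ioc 0 R, ∫ x, ψ x * fderiv ℝ V (x + t • ξ) ξ = -∫ x, ψ x * V x := by
  have hcs : HasCompactSupport fun y => fderiv ℝ V y ξ :=
    V.hasCompactSupport.fderiv_apply (𝕜 := ℝ) ξ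
  obtain ⟨B, hB⟩ := hcs.exists_bound_of_continuous (V.continuous_fderiv_apply ξ)
  have hint : Integrable (fun q : ℝ × Plane => ψ q.2 * fderiv ℝ V (q.2 + q.1 • ξ) ξ)
      ((volume.restrict (Ioc 0 R)).prod volume) := by
    have h1 : Integrable (fun q : ℝ × Plane => (1 : ℝ) * ψ q.2)
        ((volume.restrict (Ioc 0 R)).prod volume) :=
      Integrable.mul_prod (f := fun _ : ℝ => (1 : ℝ)) (integrable_const _) (ψ.integrable _)
    have h2 : Continuous fun q : ℝ × Plane => fderiv ℝ V (q.2 + q.1 • ξ) ξ :=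
      (V.continuous_fderiv_apply ξ).comp (by fun_prop)
    refine (h1.bdd_mul (c := B) h2.aestronglyMeasurable (.of_forall fun q => hB _)).congr
      (.of_forall fun q => ?_)
    simp only
    ring
  rw [integral_integral_swap hint, ← integral_neg]
  refine integral_congr_ae (.of_forall fun x => ?_)
  simp only
  rw [integral_const_mul]
  by_cases hx : x ∈ tsupport ψ
  · rw [← intervalIntegral.integral_of_le hR.le,
      intervalIntegral.integral_eq_sub_of_hasDerivAt (fun t _ => V.hasDerivAt_ray x ξ t)
        (((V.continuous_fderiv_apply ξ).comp (by fun_prop)).intervalIntegrable _ _), h x hx]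
    simp
  · rw [image_eq_zero_of_notMem_tsupport hx]
    simp

/-- A representation of a vector field by its strain, in a domain that contains with each of its
points a truncated cone. -/
theorem IsConeOpen.integral_mul_d_eq {U : Set Plane} {ξ₀ : Plane} {ρ : ℝ} (hU : IsConeOpen U ξ₀ ρ)
    {k : Test} (hk : tsupport k ⊆ Metric.ball ξ₀ ρ) (hk1 : ∫ x, k x = 1) (u : Fin 2 → Test)
    {η : Test} (hη : tsupport η ⊆ U) (i : Fin 2) {R : ℝ} (hR : 0 < R)
    (h : ∀ x ∈ tsupport η, ∀ ξ ∈ tsupport k, ∀ a, u a (x + R • ξ) = 0) :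
    ∫ x, u i x * η x = ∑ a, ∑ b, ∫ q : ℝ × Plane,
      ((Test.d i k).coordMul b).coordMul a q.2 *
        (∫ y, U.indicator (Test.strain u a b) y * η.shift (q.1 • q.2) y)
        ∂((volume.restrict (Ioc 0 R)).prod volume) := by
  have hF : ∀ a b, Integrable (U.indicator (Test.strain u a b)) := fun a b =>
    ((Test.strain u a b).integrable _).indicator hU.isOpen.measurableSet
  have hint : ∀ a b, Integrable (fun q : ℝ × Plane =>
      ((Test.d i k).coordMul b).coordMul a q.2 *
        (∫ y, U.indicator (Test.strain u a b) y * η.shift (q.1 • q.2) y))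
        ((volume.restrict (Ioc 0 R)).prod volume) := fun a b => by
    obtain ⟨B, hB⟩ := exists_abs_integral_mul_shift_le (hF a b) η
    exact integrable_ray_prod (c := fun v => ∫ y, U.indicator (Test.strain u a b) y * η.shift v y)
      _ (continuous_integral_mul_shift (hF a b) η) hB R
  have hsum : Integrable (fun q : ℝ × Plane => ∑ a, ∑ b,
      ((Test.d i k).coordMul b).coordMul a q.2 *
        (∫ y, U.indicator (Test.strain u a b) y * η.shift (q.1 • q.2) y))
        ((volume.restrict (Ioc 0 R)).prod volume) :=
    integrable_finsetSum _ fun a _ => integrable_finsetSum _ fun b _ => hint a b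
  -- Contraction of the strain with ξ ⊗ ξ gives the derivative in direction ξ of ξ · u, for fixed ξ;
  -- the antisymmetric part of the gradient drops out. The indicator disappears because the
  -- translate by tξ stays in U, and for ξ outside the support of k both sides vanish.
  have e1 : ∀ q : ℝ × Plane, 0 < q.1 → ∑ a, ∑ b,
      ((Test.d i k).coordMul b).coordMul a q.2 *
        (∫ y, U.indicator (Test.strain u a b) y * η.shift (q.1 • q.2) y) =
      Test.d i k q.2 * ∫ x, η x * fderiv ℝ (∑ a, q.2 a • u a : Test) (x + q.1 • q.2) q.2 := by
    rintro ⟨t, ξ⟩ ht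
    simp only at ht ⊢
    by_cases hξ : ξ ∈ tsupport k
    · have e2 : ∀ a b, ∫ y, U.indicator (Test.strain u a b) y * η.shift (t • ξ) y =
          ∫ x, η x * Test.strain u a b (x + t • ξ) := fun a b => by
        rw [← integral_add_right_eq_self _ (t • ξ)]
        refine integral_congr_ae (.of_forall fun x => ?_)
        simp only [Test.shift_apply, add_sub_cancel_right]
        by_cases hx : x ∈ tsupport η
        · rw [indicator_of_mem (hU.add_mem x (hη hx) ξ (hk hξ) t ht), mul_comm]
        · rw [image_eq_zero_of_notMem_tsupport hx]
          simp
      have hi : ∀ a b, Integrable fun x => η x * Test.strain u a b (x + t • ξ) := fun a b => by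
        refine ((Continuous.mul η.continuous ((Test.strain u a b).continuous.comp
          (by fun_prop))).integrable_of_hasCompactSupport ?_)
        exact η.hasCompactSupport.mul_right
      simp only [e2]
      have e3 : ∀ x, η x * fderiv ℝ (∑ a, ξ a • u a : Test) (x + t • ξ) ξ =
          ∑ a, ∑ b, ξ a * ξ b * (η x * Test.strain u a b (x + t • ξ)) := fun x => by
        have h2 : ∀ b (c : ℝ) (φ : Test), Test.d b (c • φ) = c • Test.d b φ :=
          fun b c φ => Test.d_smul b c φ
        rw [Test.fderiv_apply]
        simp only [Fin.sum_univ_two, Test.d_add, h2, Test.strain_apply, Test.add_apply,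
          Test.smul_apply]
        ring
      simp only [e3]
      rw [integral_finsetSum _ fun a _ => integrable_finsetSum _ fun b _ => (hi a b).const_mul _]
      rw [Finset.mul_sum]
      refine Finset.sum_congr rfl fun a _ => ?_
      rw [integral_finsetSum _ fun b _ => (hi a b).const_mul _, Finset.mul_sum]
      refine Finset.sum_congr rfl fun b _ => ?_
      rw [integral_const_mul]
      simp only [Test.coordMul_apply]
      ring
    · have : Test.d i k ξ = 0 :=
        image_eq_zero_of_notMem_tsupport fun h' => hξ (Test.tsupport_d_subset i k h')
      simp only [Test.coordMul_apply, this]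
      simp
  -- The fundamental theorem of calculus along the ray; by the choice of R the field vanishes at the
  -- far end.
  have e4 : ∀ ξ, (∫ t in Ioc 0 R, Test.d i k ξ *
      ∫ x, η x * fderiv ℝ (∑ a, ξ a • u a : Test) (x + t • ξ) ξ) =
      -∑ a, (Test.d i k).coordMul a ξ * ∫ x, η x * u a x := by
    intro ξ
    by_cases hξ : ξ ∈ tsupport k
    · rw [integral_const_mul, integral_ray_fderiv _ _ _ hR]
      · have e5 : ∀ x, η x * (∑ a, ξ a • u a : Test) x = ∑ a, ξ a * (η x * u a x) := fun x => by
          simp only [Test.sum_apply, Test.smul_apply, Finset.mul_sum]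
          refine Finset.sum_congr rfl fun a _ => by ring
        simp only [e5]
        rw [integral_finsetSum _ fun a _ => Integrable.const_mul (f := fun x => η x * u a x)
          ((η.mul (u a)).integrable _) _, mul_neg, Finset.mul_sum]
        congr 1
        refine Finset.sum_congr rfl fun a _ => ?_
        rw [integral_const_mul, Test.coordMul_apply]
        ring
      · intro x hx
        simp only [Test.sum_apply, Test.smul_apply]
        exact Finset.sum_eq_zero fun a _ => by rw [h x hx ξ hξ a, mul_zero]
    · have : Test.d i k ξ = 0 :=
        image_eq_zero_of_notMem_tsupport fun h' => hξ (Test.tsupport_d_subset i k h')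
      simp only [Test.coordMul_apply, this]
      simp
  simp_rw [← integral_finsetSum _ fun b _ => hint _ b]
  rw [← integral_finsetSum _ fun a _ => integrable_finsetSum _ fun b _ => hint a b,
    integral_prod_symm _ hsum]
  have e6 : ∀ ξ, (∫ t in Ioc 0 R, ∑ a, ∑ b, ((Test.d i k).coordMul b).coordMul a ξ *
        (∫ y, U.indicator (Test.strain u a b) y * η.shift (t • ξ) y)) =
        -∑ a, (Test.d i k).coordMul a ξ * ∫ x, η x * u a x := fun ξ => by
    rw [← e4]
    exact setIntegral_congr_fun measurableSet_Ioc fun t ht => e1 (t, ξ) ht.1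
  simp only [e6]
  -- The moments of ∂ᵢk are -1 for a = i and 0 otherwise; this sign cancels the one from the near
  -- end of the ray.
  rw [integral_neg, integral_finsetSum _ fun a _ => ((Test.d i k).coordMul a |>.integrable _).mul_const _]
  simp only [integral_mul_const, Test.integral_coordMul_d, hk1, ite_mul, zero_mul,
    Finset.sum_ite_eq', Finset.mem_univ, if_true]
  simp [mul_comm]

/-- The support of k has positive distance δ from the origin, so for large R the displacement Rξ
carries the bounded support of η beyond the supports of all components. -/
theorem exists_ray_eq_zero (u : Fin 2 → Test) (η k : Test) (hk : (0 : Plane) ∉ tsupport k) :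
    ∃ R : ℝ, 0 < R ∧ ∀ x ∈ tsupport η, ∀ ξ ∈ tsupport k, ∀ a, u a (x + R • ξ) = 0 := by
  obtain ⟨δ, hδ, hball⟩ := Metric.mem_nhds_iff.1 ((isClosed_tsupport k).isOpen_compl.mem_nhds hk)
  obtain ⟨M, hM⟩ := η.hasCompactSupport.isCompact.isBounded.exists_norm_le
  choose N hN using fun a => (u a).hasCompactSupport.isCompact.isBounded.exists_norm_le
  refine ⟨(|M| + |N 0| + |N 1| + 1) / δ, by positivity, fun x hx ξ hξ a => ?_⟩
  by_contra h
  have h1 := hN a _ (subset_tsupport _ h)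
  have h2 : δ ≤ ‖ξ‖ := by
    by_contra! h3
    exact hball (mem_ball_zero_iff.2 h3) hξ
  have h3 := norm_sub_norm_le (((|M| + |N 0| + |N 1| + 1) / δ) • ξ) (-x)
  rw [sub_neg_eq_add, norm_neg, add_comm _ x, norm_smul, Real.norm_of_nonneg (by positivity)] at h3
  have h4 : |M| + |N 0| + |N 1| + 1 ≤ (|M| + |N 0| + |N 1| + 1) / δ * ‖ξ‖ := by
    rw [div_mul_eq_mul_div, le_div_iff₀ hδ]
    gcongr
  have h5 := hM x hx
  have h6 : N a ≤ |N 0| + |N 1| := by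
    have := abs_nonneg (N 0)
    have := abs_nonneg (N 1)
    have := le_abs_self (N a)
    fin_cases a <;> simp at this ⊢ <;> linarith
  linarith [le_abs_self M]

/-- A dual form of Korn's inequality: the representation of uᵢ by the strain is tested with ∂ⱼψ, and
the singular integral bound applies to each entry. That bound is uniform in R, which matters because
R depends on the supports of u and ψ. -/
theorem IsConeOpen.exists_abs_integral_mul_d_le {U : Set Plane} {ξ₀ : Plane} {ρ : ℝ}
    (hU : IsConeOpen U ξ₀ ρ) : ∃ C : ℝ, 0 ≤ C ∧ ∀ (u : Fin 2 → Test) (ψ : Test), tsupport ψ ⊆ U →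
      ∀ i j, |∫ x, u i x * Test.d j ψ x| ≤
        C * (∑ a, ∑ b, √(∫ x in U, Test.strain u a b x ^ 2)) * √(∫ x, ψ x ^ 2) := by
  obtain ⟨k, -, hk, hk1⟩ := exists_kernel ξ₀ hU.pos
  have hk0 : (0 : Plane) ∉ tsupport k := fun h => hU.ne_zero (hk h) rfl
  choose C hC0 hC using fun i a b =>
    exists_singular_integral_le (((Test.d i k).coordMul b).coordMul a)
  refine ⟨∑ i, ∑ a, ∑ b, C i a b, Finset.sum_nonneg fun i _ => Finset.sum_nonneg fun a _ =>
    Finset.sum_nonneg fun b _ => hC0 i a b, fun u ψ hψ i j => ?_⟩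
  have hη : tsupport (Test.d j ψ) ⊆ U := (Test.tsupport_d_subset j ψ).trans hψ
  obtain ⟨R, hR, hz⟩ := exists_ray_eq_zero u (Test.d j ψ) k hk0
  have hCK : ∀ a b, C i a b ≤ ∑ i, ∑ a, ∑ b, C i a b := fun a b =>
    calc C i a b ≤ ∑ b, C i a b := Finset.single_le_sum (fun b _ => hC0 i a b) (Finset.mem_univ b)
      _ ≤ ∑ a, ∑ b, C i a b := Finset.single_le_sum (f := fun a => ∑ b, C i a b)
          (fun a _ => Finset.sum_nonneg fun b _ => hC0 i a b) (Finset.mem_univ a)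
      _ ≤ _ := Finset.single_le_sum (f := fun i => ∑ a, ∑ b, C i a b)
          (fun i _ => Finset.sum_nonneg fun a _ => Finset.sum_nonneg fun b _ => hC0 i a b)
          (Finset.mem_univ i)
  generalize ∑ i, ∑ a, ∑ b, C i a b = K at hCK
  rw [hU.integral_mul_d_eq hk hk1 u hη i hR hz, mul_assoc, Finset.sum_mul]
  refine (Finset.abs_sum_le_sum_abs _ _).trans ?_
  rw [Finset.mul_sum]
  refine Finset.sum_le_sum fun a _ => ?_
  refine (Finset.abs_sum_le_sum_abs _ _).trans ?_
  rw [Finset.sum_mul, Finset.mul_sum]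
  refine Finset.sum_le_sum fun b _ => ?_
  have hFi : Integrable (U.indicator (Test.strain u a b)) :=
    ((Test.strain u a b).integrable _).indicator hU.isOpen.measurableSet
  have hF2 : MemLp (U.indicator (Test.strain u a b)) 2 volume :=
    ((Test.strain u a b).memLp 2 _).indicator hU.isOpen.measurableSet
  have h1 := hC i a b R hR _ hF2 ψ j _ (continuous_integral_mul_shift hFi (Test.d j ψ))
    (exists_abs_integral_mul_shift_le hFi (Test.d j ψ)) fun v => rfl
  have h2 : ∫ x, U.indicator (Test.strain u a b) x ^ 2 = ∫ x in U, Test.strain u a b x ^ 2 := by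
    rw [← integral_indicator hU.isOpen.measurableSet]
    refine integral_congr_ae (.of_forall fun x => ?_)
    by_cases hx : x ∈ U <;> simp [hx]
  rw [h2] at h1
  refine h1.trans ?_
  gcongr
  exact hCK a b

/-- Cut-offs exhausting an open set. -/
theorem exists_cutoff {U : Set Plane} (hU : IsOpen U) : ∃ θ : ℕ → Plane → ℝ,
    (∀ n, ContDiff ℝ ∞ (θ n)) ∧ (∀ n, tsupport (θ n) ⊆ U) ∧ (∀ n x, θ n x ∈ Icc (0 : ℝ) 1) ∧
    ∀ x ∈ U, Tendsto (fun n => θ n x) atTop (𝓝 1) := by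
  obtain ⟨f, hf, hfd, hfr⟩ := hU.exists_contDiff_support_eq (n := ⊤)
  have h01 : ∀ x, f x ∈ Icc (0 : ℝ) 1 := fun x => hfr (mem_range_self x)
  -- The transition vanishes where n f ≤ 1, which keeps the support inside U, and equals one where n
  -- f ≥ 2, hence eventually at each point of U.
  refine ⟨fun n x => Real.smoothTransition (n * f x - 1), fun n => ?_, fun n => ?_, fun n x => ?_,
    fun x hx => ?_⟩
  · exact Real.smoothTransition.contDiff.comp ((contDiff_const.mul hfd).sub contDiff_const)
  · have h1 : tsupport (fun x => Real.smoothTransition (n * f x - 1)) ⊆ {x | 1 ≤ n * f x} := by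
      refine closure_minimal (fun x hx => ?_)
        (isClosed_le continuous_const (continuous_const.mul hfd.continuous))
      by_contra h
      exact hx (Real.smoothTransition.zero_of_nonpos (by simp at h; linarith))
    refine h1.trans fun x hx => ?_
    rw [← hf]
    intro h0
    simp only [mem_ofPred_eq, h0, mul_zero] at hx
    linarith
  · exact ⟨Real.smoothTransition.nonneg _, Real.smoothTransition.le_one _⟩
  · have hpos : 0 < f x := lt_of_le_of_ne (h01 x).1 (Ne.symm (by rw [← hf] at hx; exact hx))
    refine tendsto_const_nhds.congr' ?_
    filter_upwards [eventually_ge_atTop ⌈2 / f x⌉₊] with n hn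
    refine (Real.smoothTransition.one_of_one_le ?_).symm
    have h1 := (Nat.le_ceil _).trans (Nat.cast_le.2 hn)
    rw [div_le_iff₀ hpos] at h1
    linarith

/-- Korn's inequality in a domain that contains with each of its points a truncated cone. -/
theorem IsConeOpen.exists_korn {U : Set Plane} {ξ₀ : Plane} {ρ : ℝ} (hU : IsConeOpen U ξ₀ ρ) :
    ∃ C : ℝ, 0 ≤ C ∧ ∀ (u : Fin 2 → Test) (i j : Fin 2), ∫ x in U, Test.d j (u i) x ^ 2 ≤
      C * ∑ a, ∑ b, ∫ x in U, Test.strain u a b x ^ 2 := by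
  obtain ⟨C, hC0, hC⟩ := hU.exists_abs_integral_mul_d_le
  obtain ⟨θ, hθd, hθs, hθ01, hθ1⟩ := exists_cutoff hU.isOpen
  -- The factor 4 is the number of entries of the strain, from bounding the square of a sum of four
  -- norms.
  refine ⟨C ^ 2 * 4, by positivity, fun u i j => ?_⟩
  set K : ℝ := C * ∑ a, ∑ b, √(∫ x in U, Test.strain u a b x ^ 2) with hK
  have hK0 : 0 ≤ K := mul_nonneg hC0 (Finset.sum_nonneg fun a _ => Finset.sum_nonneg fun b _ =>
    Real.sqrt_nonneg _)
  set v : Test := Test.d j (u i) with hv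
  have hbd : ∀ n, ∫ x in U, θ n x * v x ^ 2 ≤ K ^ 2 := by
    intro n
    -- The dual estimate is tested with the truncated derivative itself. As θ² ≤ θ, the quantity S
    -- satisfies S ≤ K √S, hence S ≤ K²; the truncation is then removed by dominated convergence.
    let ψ : Test := ⟨fun x => θ n x * v x, (hθd n).mul v.contDiff, v.hasCompactSupport.mul_left⟩
    have hψ : tsupport ψ ⊆ U :=
      (closure_mono (Function.support_mul_subset_left _ _)).trans (hθs n)
    have h1 := hC u ψ hψ i j
    rw [Test.integral_mul_d, abs_neg] at h1
    have hint : Integrable (fun x => θ n x * v x ^ 2) := (v.mul ψ).integrable volume |>.congr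
      (.of_forall fun x => by simp only [Test.mul_apply]; simp only [ψ]; ring)
    have h2 : ∫ x, v x * ψ x = ∫ x, θ n x * v x ^ 2 := by
      refine integral_congr_ae (.of_forall fun x => ?_)
      simp only [ψ]
      ring
    have h3 : ∫ x, ψ x ^ 2 ≤ ∫ x, θ n x * v x ^ 2 := by
      refine integral_mono (ψ.integrable_sq _) hint fun x => ?_
      simp only [ψ]
      have := hθ01 n x
      rw [mul_pow]
      gcongr
      nlinarith [this.1, this.2]
    set S := ∫ x, θ n x * v x ^ 2 with hS
    have hS0 : 0 ≤ S := integral_nonneg fun x => mul_nonneg (hθ01 n x).1 (sq_nonneg _)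
    have h4 : S ≤ K * √S := by
      rw [← hv, h2, abs_of_nonneg hS0] at h1
      exact h1.trans (by gcongr)
    have h5 : S ≤ K ^ 2 := by
      have h6 := Real.sq_sqrt hS0
      have h7 := Real.sqrt_nonneg S
      rcases h7.eq_or_lt with h8 | h8
      · rw [← h8] at h6
        nlinarith [sq_nonneg K]
      · have h9 : √S ≤ K := by
          by_contra! h10
          nlinarith
        calc S = √S ^ 2 := h6.symm
          _ ≤ K ^ 2 := by gcongr
    refine le_trans (setIntegral_le_integral hint (.of_forall fun x => ?_)) h5
    exact mul_nonneg (hθ01 n x).1 (sq_nonneg _)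
  have hlim : Tendsto (fun n => ∫ x in U, θ n x * v x ^ 2) atTop (𝓝 (∫ x in U, v x ^ 2)) := by
    refine tendsto_integral_of_dominated_convergence (fun x => v x ^ 2)
      (fun n => ((hθd n).continuous.mul (v.continuous.pow 2)).aestronglyMeasurable)
      (v.integrable_sq _) (fun n => .of_forall fun x => ?_) ?_
    · rw [Real.norm_of_nonneg (mul_nonneg (hθ01 n x).1 (sq_nonneg _))]
      exact mul_le_of_le_one_left (sq_nonneg _) (hθ01 n x).2
    · refine (ae_restrict_iff' hU.isOpen.measurableSet).2 (.of_forall fun x hx => ?_)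
      simpa using (hθ1 x hx).mul_const (v x ^ 2)
  refine (le_of_tendsto' hlim hbd).trans ?_
  rw [hK, mul_pow, mul_assoc]
  refine mul_le_mul_of_nonneg_left ?_ (sq_nonneg _)
  have hI : ∀ a b, 0 ≤ ∫ x in U, Test.strain u a b x ^ 2 :=
    fun a b => integral_nonneg fun _ => sq_nonneg _
  have hsq := fun a b => Real.sq_sqrt (hI a b)
  simp only [Fin.sum_univ_two]
  rw [← hsq 0 0, ← hsq 0 1, ← hsq 1 0, ← hsq 1 1]
  simp only [Real.sqrt_sq (Real.sqrt_nonneg _)]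
  generalize √(∫ x in U, Test.strain u 0 0 x ^ 2) = p
  generalize √(∫ x in U, Test.strain u 0 1 x ^ 2) = q
  generalize √(∫ x in U, Test.strain u 1 0 x ^ 2) = r
  generalize √(∫ x in U, Test.strain u 1 1 x ^ 2) = s
  nlinarith [sq_nonneg (p - q), sq_nonneg (p - r), sq_nonneg (p - s), sq_nonneg (q - r),
    sq_nonneg (q - s), sq_nonneg (r - s)]

/-- The strain of χu is χ times the strain of u, plus the symmetrized product of ∇χ and u, which is
of order zero in u. -/
theorem Test.exists_strain_mul_bound (χ : Test) : ∃ B : ℝ, 0 ≤ B ∧ ∀ (S : Set Plane)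
    (u : Fin 2 → Test) (a b : Fin 2), ∫ x in S, Test.strain (fun i => χ.mul (u i)) a b x ^ 2 ≤
      B * ((∫ x in S, Test.strain u a b x ^ 2) + ∑ i, ∫ x in S, u i x ^ 2) := by
  obtain ⟨B₁, h1, hB₁⟩ := χ.exists_sq_bound
  choose B₂ h2 hB₂ using fun i => (Test.d i χ).exists_sq_bound
  have hBi : ∀ i, B₂ i ≤ B₂ 0 + B₂ 1 := fun i => by
    have := h2 0
    have := h2 1
    fin_cases i <;> simp <;> assumption
  refine ⟨2 * (B₁ + (B₂ 0 + B₂ 1)), by have := h2 0; have := h2 1; positivity, fun S u a b => ?_⟩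
  rw [← integral_finsetSum _ fun i _ => (u i).integrable_sq _,
    ← integral_add ((Test.strain u a b).integrable_sq _)
      (integrable_finsetSum _ fun i _ => (u i).integrable_sq _), ← integral_const_mul]
  refine integral_mono ((Test.strain _ a b).integrable_sq _)
    ((((Test.strain u a b).integrable_sq _).add
      (integrable_finsetSum _ fun i _ => (u i).integrable_sq _)).const_mul _) fun x => ?_
  have e : Test.strain (fun i => χ.mul (u i)) a b x = χ x * Test.strain u a b x +
      (Test.d b χ x * u a x + Test.d a χ x * u b x) / 2 := by
    simp only [Test.strain_apply, Test.d_mul, Test.add_apply, Test.mul_apply]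
    ring
  simp only [e]
  have hua : ∀ i, u i x ^ 2 ≤ ∑ i, u i x ^ 2 := fun i =>
    Finset.single_le_sum (f := fun i => u i x ^ 2) (fun _ _ => sq_nonneg _) (Finset.mem_univ i)
  have t1 : χ x ^ 2 * Test.strain u a b x ^ 2 ≤ B₁ * Test.strain u a b x ^ 2 :=
    mul_le_mul_of_nonneg_right (hB₁ x) (sq_nonneg _)
  have t2 : ∀ i j, (Test.d i χ x * u j x) ^ 2 ≤ (B₂ 0 + B₂ 1) * ∑ i, u i x ^ 2 := fun i j => by
    rw [mul_pow]
    exact mul_le_mul ((hB₂ i x).trans (hBi i)) (hua j) (sq_nonneg _)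
      (add_nonneg (h2 0) (h2 1))
  have t3 := t2 b a
  have t4 := t2 a b
  have t5 : 0 ≤ B₁ * ∑ i, u i x ^ 2 := mul_nonneg h1 (Finset.sum_nonneg fun _ _ => sq_nonneg _)
  have t6 : 0 ≤ (B₂ 0 + B₂ 1) * Test.strain u a b x ^ 2 :=
    mul_nonneg (add_nonneg (h2 0) (h2 1)) (sq_nonneg _)
  set P := χ x * Test.strain u a b x
  have hP : P ^ 2 ≤ B₁ * Test.strain u a b x ^ 2 := by rw [mul_pow]; exact t1
  nlinarith [sq_nonneg (P - (Test.d b χ x * u a x + Test.d a χ x * u b x) / 2),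
    sq_nonneg (Test.d b χ x * u a x - Test.d a χ x * u b x)]

/-- Korn's second inequality, for smooth fields on a Lipschitz domain. -/
theorem IsLipschitzDomain.exists_korn {Ω : Set Plane} (hΩ : IsLipschitzDomain Ω) :
    ∃ C : ℝ, 0 ≤ C ∧ ∀ (u : Fin 2 → Test) (i j : Fin 2), ∫ x in Ω, Test.d j (u i) x ^ 2 ≤
      C * ((∑ a, ∑ b, ∫ x in Ω, Test.strain u a b x ^ 2) + ∑ a, ∫ x in Ω, u a x ^ 2) := by
  obtain ⟨s, r, χ, hs, hχ⟩ := hΩ.exists_partition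
  have hloc : ∀ x, ∃ C : ℝ, 0 ≤ C ∧ (x ∈ s → ∀ (u : Fin 2 → Test) (i j : Fin 2),
      ∫ y in Ω, ((χ x).mul (Test.d j (u i)) y) ^ 2 ≤
        C * ((∑ a, ∑ b, ∫ x in Ω, Test.strain u a b x ^ 2) + ∑ a, ∫ x in Ω, u a x ^ 2)) := by
    intro x
    by_cases hx : x ∈ s
    · obtain ⟨⟨U, ξ₀, ρ, hU, hUΩ, -⟩, hsupp⟩ := hs x hx
      obtain ⟨B, hB0, hB⟩ := (χ x).exists_strain_mul_bound
      obtain ⟨C, hC0, hC⟩ := hU.exists_korn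
      choose B' hB'0 hB' using fun j => (Test.d j (χ x)).exists_sq_bound
      refine ⟨2 * (C * (4 * B) + (B' 0 + B' 1)), by
        have := hB'0 0; have := hB'0 1; positivity, fun _ u i j => ?_⟩
      set E := ∑ a, ∑ b, ∫ x in Ω, Test.strain u a b x ^ 2 with hE
      set N := ∑ a, ∫ x in Ω, u a x ^ 2 with hN
      have hE0 : 0 ≤ E := Finset.sum_nonneg fun a _ => Finset.sum_nonneg fun b _ =>
        integral_nonneg fun _ => sq_nonneg _
      have hN0 : 0 ≤ N := Finset.sum_nonneg fun a _ => integral_nonneg fun _ => sq_nonneg _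
      have h0 := hC (fun i => (χ x).mul (u i)) i j
      have hz : ∀ (φ : Test) (j : Fin 2) (y : Plane), y ∉ Metric.ball x (r x) →
          Test.d j ((χ x).mul φ) y = 0 := fun φ j y hy =>
        image_eq_zero_of_notMem_tsupport fun h' =>
          hy (hsupp (Test.tsupport_mul_subset_left (χ x) φ (Test.tsupport_d_subset j _ h')))
      -- Everything localized by χ lives in the ball, where U and Ω agree, so Korn's inequality on U
      -- becomes an estimate on Ω.
      have e1 : ∀ φ : Test, (∀ y, y ∉ Metric.ball x (r x) → φ y = 0) →
          ∫ y in U, φ y ^ 2 = ∫ y in Ω, φ y ^ 2 := fun φ hφ =>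
        (setIntegral_eq_of_ball hΩ.measurableSet hU.isOpen.measurableSet hUΩ
          (fun y hy => by rw [hφ y hy]; simp)).symm
      rw [e1 _ (hz _ j)] at h0
      simp only [fun a b => e1 (Test.strain (fun i => (χ x).mul (u i)) a b) fun y hy => by
        rw [Test.strain_apply, hz _ b y hy, hz _ a y hy]; simp] at h0
      have h1 : ∫ y in Ω, Test.d j ((χ x).mul (u i)) y ^ 2 ≤ C * (4 * B * (E + N)) := by
        refine h0.trans (mul_le_mul_of_nonneg_left ?_ hC0)
        calc _ ≤ ∑ a, ∑ b, B * ((∫ x in Ω, Test.strain u a b x ^ 2) + N) :=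
              Finset.sum_le_sum fun a _ => Finset.sum_le_sum fun b _ => hB Ω u a b
          _ = B * (E + 4 * N) := by
              rw [hE]
              simp only [Fin.sum_univ_two]
              ring
          _ ≤ _ := by nlinarith [mul_nonneg hB0 hE0]
      have h2 : ∫ y in Ω, (Test.d j (χ x)).mul (u i) y ^ 2 ≤ (B' 0 + B' 1) * N := by
        have h3 : ∫ y in Ω, (Test.d j (χ x)).mul (u i) y ^ 2 ≤ (B' 0 + B' 1) * ∫ y in Ω, u i y ^ 2 := by
          rw [← integral_const_mul]
          refine integral_mono (((Test.d j (χ x)).mul (u i)).integrable_sq _)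
            (((u i).integrable_sq _).const_mul _) fun y => ?_
          simp only [Test.mul_apply, mul_pow]
          refine mul_le_mul_of_nonneg_right ((hB' j y).trans ?_) (sq_nonneg _)
          have := hB'0 0
          have := hB'0 1
          fin_cases j <;> simp <;> assumption
        refine h3.trans (mul_le_mul_of_nonneg_left ?_ (add_nonneg (hB'0 0) (hB'0 1)))
        exact Finset.single_le_sum (f := fun i => ∫ x in Ω, u i x ^ 2)
          (fun i _ => integral_nonneg fun _ => sq_nonneg _) (Finset.mem_univ i)
      calc ∫ y in Ω, ((χ x).mul (Test.d j (u i)) y) ^ 2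
          ≤ ∫ y in Ω, (2 * Test.d j ((χ x).mul (u i)) y ^ 2 +
              2 * (Test.d j (χ x)).mul (u i) y ^ 2) := by
            refine integral_mono (Test.integrable_sq _ _) (((Test.integrable_sq _ _).const_mul _).add
              ((Test.integrable_sq _ _).const_mul _)) fun y => ?_
            simp only [Test.d_mul, Test.add_apply]
            nlinarith [sq_nonneg ((χ x).mul (Test.d j (u i)) y + 2 * (Test.d j (χ x)).mul (u i) y)]
        _ = 2 * (∫ y in Ω, Test.d j ((χ x).mul (u i)) y ^ 2) +
              2 * ∫ y in Ω, (Test.d j (χ x)).mul (u i) y ^ 2 := by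
            rw [integral_add ((Test.integrable_sq _ _).const_mul _)
              ((Test.integrable_sq _ _).const_mul _), integral_const_mul, integral_const_mul]
        _ ≤ _ := by
            nlinarith [mul_nonneg (add_nonneg (hB'0 0) (hB'0 1)) hE0]
    · exact ⟨0, le_rfl, fun h => absurd h hx⟩
  choose C hC0 hC using hloc
  refine ⟨(s.card : ℝ) * ∑ x ∈ s, C x,
    mul_nonneg (by positivity) (Finset.sum_nonneg fun x _ => hC0 x), fun u i j => ?_⟩
  have hsum : Integrable (fun y => ∑ x ∈ s, (χ x).mul (Test.d j (u i)) y ^ 2)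
      (volume.restrict Ω) := integrable_finsetSum _ fun x _ => Test.integrable_sq _ _
  calc ∫ y in Ω, Test.d j (u i) y ^ 2
      ≤ ∫ y in Ω, (s.card : ℝ) * ∑ x ∈ s, (χ x).mul (Test.d j (u i)) y ^ 2 := by
        refine setIntegral_mono_on (Test.integrable_sq _ _) (hsum.const_mul _) hΩ.measurableSet
          fun y hy => ?_
        rw [eq_sum_mul (hχ y (subset_closure hy)) (Test.d j (u i))]
        exact sq_sum_le_card_mul_sum_sq
    _ = (s.card : ℝ) * ∑ x ∈ s, ∫ y in Ω, (χ x).mul (Test.d j (u i)) y ^ 2 := by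
        rw [integral_const_mul, integral_finsetSum _ fun x _ => Test.integrable_sq _ _]
    _ ≤ (s.card : ℝ) * ∑ x ∈ s, C x *
          ((∑ a, ∑ b, ∫ x in Ω, Test.strain u a b x ^ 2) + ∑ a, ∫ x in Ω, u a x ^ 2) := by
        gcongr with x hx
        exact hC x hx u i j
    _ = _ := by rw [← Finset.sum_mul]; ring

/-! ### The Sobolev spaces are complete and separable -/

theorem inner_toL2 {Ω : Set Plane} (φ : Test) (f : L2 Ω) :
    inner ℝ (Test.toL2 Ω φ) f = ∫ x in Ω, f x * φ x := by
  rw [L2.inner_def]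
  refine integral_congr_ae ?_
  filter_upwards [Test.coeFn_toL2 Ω φ] with x hx
  simp [hx]

theorem isWeakDeriv_iff {Ω : Set Plane} {i : Fin 2} {f g : L2 Ω} :
    IsWeakDeriv i f g ↔ ∀ φ : Test, tsupport φ ⊆ Ω →
      inner ℝ (Test.toL2 Ω (Test.d i φ)) f = -inner ℝ (Test.toL2 Ω φ) g := by
  simp only [inner_toL2]
  exact ⟨fun h φ hφ => h φ φ.contDiff φ.hasCompactSupport hφ,
    fun h φ h1 h2 h3 => h ⟨φ, h1, h2⟩ h3⟩

/-- Each weak derivative identity equates two continuous functionals on the product space, so H¹ is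
an intersection of closed sets. -/
theorem isClosed_H1 (Ω : Set Plane) :
    IsClosed (H1 Ω : Set (WithLp 2 (L2 Ω × PiLp 2 (fun _ : Fin 2 => L2 Ω)))) := by
  have : (H1 Ω : Set (WithLp 2 (L2 Ω × PiLp 2 (fun _ : Fin 2 => L2 Ω)))) =
      ⋂ i : Fin 2, ⋂ φ : Test, ⋂ _ : tsupport φ ⊆ Ω,
        {u | inner ℝ (Test.toL2 Ω (Test.d i φ)) u.fst = -inner ℝ (Test.toL2 Ω φ) (u.snd i)} := by
    ext u
    simp only [mem_iInter]
    exact forall_congr' fun i => isWeakDeriv_iff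
  rw [this]
  refine isClosed_iInter fun i => isClosed_iInter fun φ => isClosed_iInter fun _ => ?_
  have h1 : Continuous fun u : WithLp 2 (L2 Ω × PiLp 2 (fun _ : Fin 2 => L2 Ω)) => u.fst :=
    (WithLp.fstL 2 ℝ _ _).continuous
  have h2 : Continuous fun u : WithLp 2 (L2 Ω × PiLp 2 (fun _ : Fin 2 => L2 Ω)) => u.snd i :=
    ((PiLp.proj 2 (fun _ : Fin 2 => L2 Ω) i : _ →L[ℝ] _).comp (WithLp.sndL 2 ℝ _ _)).continuous
  exact isClosed_eq (continuous_const.inner h1) (continuous_const.inner h2).neg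

instance completeSpace_H1 (Ω : Set Plane) : CompleteSpace (H1 Ω) :=
  (isClosed_H1 Ω).completeSpace_coe

instance separableSpace_H1 (Ω : Set Plane) : TopologicalSpace.SeparableSpace (H1 Ω) := by
  have : Fact ((2 : ℝ≥0∞) ≠ ⊤) := ⟨by simp⟩
  have h1 : SecondCountableTopology (L2 Ω) := inferInstance
  have h2 : SecondCountableTopology (PiLp 2 (fun _ : Fin 2 => L2 Ω)) :=
    (PiLp.homeomorph 2 _).secondCountableTopology
  have h3 : SecondCountableTopology (WithLp 2 (L2 Ω × PiLp 2 (fun _ : Fin 2 => L2 Ω))) :=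
    (WithLp.homeomorphProd 2 _ _).secondCountableTopology
  infer_instance

instance separableSpace_H1Vec (Ω : Set Plane) : TopologicalSpace.SeparableSpace (H1Vec Ω) := by
  have : SecondCountableTopology (H1 Ω) := UniformSpace.secondCountable_of_separable _
  have : SecondCountableTopology (H1Vec Ω) :=
    (PiLp.homeomorph 2 _).secondCountableTopology
  infer_instance

/-- Sequential weak compactness of bounded sequences in a separable Hilbert space. -/
theorem exists_subseq_weakly {E : Type*} [NormedAddCommGroup E] [InnerProductSpace ℝ E]
    [CompleteSpace E] [TopologicalSpace.SeparableSpace E] {u : ℕ → E} {M : ℝ}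
    (hu : ∀ n, ‖u n‖ ≤ M) : ∃ (v : E) (s : ℕ → ℕ), StrictMono s ∧
      ∀ g : E, Tendsto (fun n => inner ℝ (u (s n)) g) atTop (𝓝 (inner ℝ v g)) := by
  have h := WeakDual.isSeqCompact_closedBall ℝ E 0 M
  obtain ⟨ℓ, -, s, hs, hlim⟩ := h (x := fun n => StrongDual.toWeakDual (InnerProductSpace.toDual ℝ E (u n)))
    (fun n => by simpa using hu n)
  refine ⟨(InnerProductSpace.toDual ℝ E).symm (WeakDual.toStrongDual ℓ), s, hs, fun g => ?_⟩
  rw [InnerProductSpace.toDual_symm_apply]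
  exact tendsto_iff_forall_eval_tendsto_topDualPairing.1 hlim g

/-! ### The compact embedding and the embedding in `L⁴` -/

/-- Rellich's theorem: weakly convergent sequences in `H¹(Ω)` converge in `L²(Ω)`. -/
theorem IsLipschitzDomain.tendsto_valH1 {Ω : Set Plane} (hΩ : IsLipschitzDomain Ω)
    {u : ℕ → H1 Ω} {M : ℝ} (hM : ∀ n, ‖u n‖ ≤ M)
    (hw : ∀ g : L2 Ω, Tendsto (fun n => inner ℝ g (valH1 (u n))) atTop (𝓝 0)) :
    Tendsto (fun n => valH1 (u n)) atTop (𝓝 0) := by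
  -- Test functions within 1/(n+1) of the sequence inherit its bound, up to 1, and its weak limit,
  -- so the smooth version of Rellich's theorem applies to them.
  choose φ hφ using fun n : ℕ =>
    Metric.denseRange_iff.1 hΩ.denseRange_toH1 (u n) (1 / (n + 1)) Nat.one_div_pos_of_nat
  have hdist : Tendsto (fun n => valH1 (u n) - Test.toL2 Ω (φ n)) atTop (𝓝 0) := by
    have h1 : Tendsto (fun n => u n - Test.toH1 Ω (φ n)) atTop (𝓝 0) := by
      rw [tendsto_zero_iff_norm_tendsto_zero]
      refine squeeze_zero (fun _ => norm_nonneg _) (fun n => ?_) tendsto_one_div_add_atTop_nhds_zero_nat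
      rw [← dist_eq_norm]
      exact (hφ n).le
    have h2 := (valL Ω).continuous.tendsto 0 |>.comp h1
    rw [map_zero] at h2
    exact h2
  have hsq : Tendsto (fun n => ∫ y in Ω, φ n y ^ 2) atTop (𝓝 0) := by
    refine hΩ.tendsto_integral_sq (M := (M + 1) ^ 2) (fun n => ?_) fun g => ?_
    · rw [← Test.norm_toH1_sq]
      have h1 : ‖Test.toH1 Ω (φ n)‖ ≤ M + 1 := by
        have h2 := norm_le_insert (u n) (Test.toH1 Ω (φ n))
        rw [← dist_eq_norm] at h2
        have h3 : 1 / ((n : ℝ) + 1) ≤ 1 := by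
          rw [div_le_one (by positivity)]
          linarith [n.cast_nonneg (α := ℝ)]
        linarith [hM n, hφ n]
      gcongr
    · have h1 : Tendsto (fun n => inner ℝ (Test.toL2 Ω g) (valH1 (u n)) -
          inner ℝ (Test.toL2 Ω g) (valH1 (u n) - Test.toL2 Ω (φ n))) atTop (𝓝 (0 - 0)) := by
        refine (hw _).sub ?_
        simpa using (tendsto_const_nhds (x := Test.toL2 Ω g)).inner (𝕜 := ℝ) hdist
      rw [sub_zero] at h1
      refine h1.congr fun n => ?_
      rw [← inner_sub_right, sub_sub_cancel, inner_toL2]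
      refine integral_congr_ae ?_
      filter_upwards [Test.coeFn_toL2 Ω (φ n)] with x hx
      rw [hx]
  have h3 : Tendsto (fun n => Test.toL2 Ω (φ n)) atTop (𝓝 0) := by
    rw [tendsto_zero_iff_norm_tendsto_zero]
    have h4 := hsq.sqrt
    rw [Real.sqrt_zero] at h4
    refine h4.congr fun n => ?_
    rw [← Test.norm_toL2_sq, Real.sqrt_sq (norm_nonneg _)]
  have h5 := hdist.add h3
  simpa using h5

theorem exists_seq_tendsto_toH1 {Ω : Set Plane} (hΩ : IsLipschitzDomain Ω) (u : H1 Ω) :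
    ∃ φ : ℕ → Test, Tendsto (fun n => Test.toH1 Ω (φ n)) atTop (𝓝 u) := by
  obtain ⟨v, hv, hlim⟩ := mem_closure_iff_seq_limit.1 (hΩ.denseRange_toH1 u)
  choose φ hφ using hv
  exact ⟨φ, by simpa [hφ] using hlim⟩

/-- Ladyzhenskaya's inequality passes from test functions to H¹ by density: the right side
converges, and Fatou's lemma along an almost everywhere convergent subsequence handles the left
side. -/
theorem IsLipschitzDomain.exists_lintegral_pow_four_le {Ω : Set Plane} (hΩ : IsLipschitzDomain Ω) :
    ∃ C : ℝ, 0 ≤ C ∧ ∀ u : H1 Ω, ∫⁻ x in Ω, ENNReal.ofReal (valH1 u x ^ 4) ≤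
      ENNReal.ofReal (C * ‖valH1 u‖ ^ 2 * ‖u‖ ^ 2) := by
  obtain ⟨C, hC0, hC⟩ := hΩ.exists_ladyzhenskaya
  refine ⟨C, hC0, fun u => ?_⟩
  obtain ⟨φ, hφ⟩ := exists_seq_tendsto_toH1 hΩ u
  have hval : Tendsto (fun n => Test.toL2 Ω (φ n)) atTop (𝓝 (valH1 u)) :=
    ((valL Ω).continuous.tendsto u).comp hφ
  obtain ⟨s, hs, hae⟩ := (tendstoInMeasure_of_tendsto_Lp hval).exists_seq_tendsto_ae
  have hle : ∀ n, ∫⁻ x in Ω, ENNReal.ofReal (φ n x ^ 4) ≤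
      ENNReal.ofReal (C * ‖Test.toL2 Ω (φ n)‖ ^ 2 * ‖Test.toH1 Ω (φ n)‖ ^ 2) := fun n => by
    rw [← ofReal_integral_eq_lintegral_ofReal]
    · rw [Test.norm_toL2_sq, Test.norm_toH1_sq]
      exact ENNReal.ofReal_le_ofReal (hC _)
    · exact (((φ n).mul (φ n)).integrable_sq _).congr (.of_forall fun x => by simp; ring)
    · exact .of_forall fun x => by positivity
  have hlim : Tendsto (fun n => ENNReal.ofReal (C * ‖Test.toL2 Ω (φ (s n))‖ ^ 2 *
      ‖Test.toH1 Ω (φ (s n))‖ ^ 2)) atTop (𝓝 (ENNReal.ofReal (C * ‖valH1 u‖ ^ 2 * ‖u‖ ^ 2))) := by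
    refine ENNReal.tendsto_ofReal (((tendsto_const_nhds.mul (hval.norm.pow 2)).mul
      (hφ.norm.pow 2)).comp hs.tendsto_atTop)
  calc ∫⁻ x in Ω, ENNReal.ofReal (valH1 u x ^ 4)
      ≤ ∫⁻ x in Ω, liminf (fun n => ENNReal.ofReal (φ (s n) x ^ 4)) atTop := by
        refine lintegral_mono_ae ?_
        have h1 : ∀ᵐ x ∂(volume.restrict Ω), ∀ n, Test.toL2 Ω (φ n) x = φ n x :=
          ae_all_iff.2 fun n => Test.coeFn_toL2 Ω (φ n)
        filter_upwards [hae, h1] with x hx h1x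
        simp only [h1x] at hx
        exact (ENNReal.tendsto_ofReal (hx.pow 4)).liminf_eq.ge
    _ ≤ liminf (fun n => ∫⁻ x in Ω, ENNReal.ofReal (φ (s n) x ^ 4)) atTop :=
        lintegral_liminf_le fun n => ((φ (s n)).measurable.pow_const 4).ennreal_ofReal
    _ ≤ liminf (fun n => ENNReal.ofReal (C * ‖Test.toL2 Ω (φ (s n))‖ ^ 2 *
          ‖Test.toH1 Ω (φ (s n))‖ ^ 2)) atTop := liminf_le_liminf (.of_forall fun n => hle (s n))
    _ = _ := hlim.liminf_eq

theorem aestronglyMeasurable_valH1 {Ω : Set Plane} (u : H1 Ω) :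
    AEStronglyMeasurable (valH1 u) (volume.restrict Ω) := Lp.aestronglyMeasurable _

/-- Products of functions in `H¹(Ω)` are square integrable. -/
theorem IsLipschitzDomain.exists_mul_le {Ω : Set Plane} (hΩ : IsLipschitzDomain Ω) :
    ∃ C : ℝ, 0 ≤ C ∧ ∀ u v : H1 Ω, MemLp (fun x => valH1 u x * valH1 v x) 2 (volume.restrict Ω) ∧
      (∫ x in Ω, (valH1 u x * valH1 v x) ^ 2) ^ 2 ≤
        C * (‖valH1 u‖ * ‖u‖ * ‖valH1 v‖ * ‖v‖) ^ 2 := by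
  obtain ⟨C, hC0, hC⟩ := hΩ.exists_lintegral_pow_four_le
  have hm : ∀ u : H1 Ω, AEStronglyMeasurable (fun x => valH1 u x ^ 4) (volume.restrict Ω) :=
    fun u => (aestronglyMeasurable_valH1 u).pow 4
  have hint : ∀ u : H1 Ω, Integrable (fun x => valH1 u x ^ 4) (volume.restrict Ω) := fun u => by
    refine (lintegral_ofReal_ne_top_iff_integrable (hm u) (.of_forall fun x => by positivity)).1 ?_
    exact ((hC u).trans_lt ENNReal.ofReal_lt_top).ne
  have hint2 : ∀ u : H1 Ω, MemLp (fun x => valH1 u x ^ 2) 2 (volume.restrict Ω) := fun u => by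
    refine (memLp_two_iff_integrable_sq ((aestronglyMeasurable_valH1 u).pow 2)).2 ?_
    exact (hint u).congr (.of_forall fun x => by simp only [Pi.pow_apply]; ring)
  have hle : ∀ u : H1 Ω, ∫ x in Ω, (valH1 u x ^ 2) ^ 2 ≤ C * ‖valH1 u‖ ^ 2 * ‖u‖ ^ 2 := fun u => by
    have h1 : ∫ x in Ω, (valH1 u x ^ 2) ^ 2 = ∫ x in Ω, valH1 u x ^ 4 := by
      simp only [← pow_mul]
    rw [h1, integral_eq_lintegral_of_nonneg_ae (.of_forall fun x => by positivity) (hm u)]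
    exact ENNReal.toReal_le_of_le_ofReal (by positivity) (hC u)
  have hmul : ∀ u v : H1 Ω, Integrable (fun x => (valH1 u x * valH1 v x) ^ 2) (volume.restrict Ω) :=
    fun u v => ((hint2 u).integrable_mul (hint2 v)).congr
      (.of_forall fun x => by simp only [Pi.mul_apply]; ring)
  refine ⟨C ^ 2, by positivity, fun u v => ⟨?_, ?_⟩⟩
  · exact (memLp_two_iff_integrable_sq
      ((aestronglyMeasurable_valH1 u).mul (aestronglyMeasurable_valH1 v))).2 (hmul u v)
  · have h1 := sq_integral_mul_le (hint2 u) (hint2 v)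
    have h2 : ∫ x in Ω, (valH1 u x * valH1 v x) ^ 2 =
        ∫ x in Ω, valH1 u x ^ 2 * valH1 v x ^ 2 := by simp only [mul_pow]
    rw [h2]
    refine h1.trans ?_
    calc _ ≤ (C * ‖valH1 u‖ ^ 2 * ‖u‖ ^ 2) * (C * ‖valH1 v‖ ^ 2 * ‖v‖ ^ 2) :=
          mul_le_mul (hle u) (hle v) (integral_nonneg fun _ => sq_nonneg _) (by positivity)
      _ = _ := by ring

/-! ### Traces -/

theorem IsLipschitzDomain.exists_eq_one {Ω : Set Plane} (hΩ : IsLipschitzDomain Ω) :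
    ∃ X : Test, ∀ y ∈ closure Ω, X y = 1 := by
  obtain ⟨s, r, χ, -, hχ⟩ := hΩ.exists_partition
  exact ⟨∑ x ∈ s, χ x, fun y hy => by rw [Test.sum_apply, hχ y hy]⟩

/-- The trace inequality, applied to a test function equal to one on the closure, bounds the length
of the boundary. -/
theorem IsLipschitzDomain.isFiniteMeasure_bdryMeasure {Ω : Set Plane} (hΩ : IsLipschitzDomain Ω) :
    IsFiniteMeasure (bdryMeasure Ω) := by
  obtain ⟨X, hX⟩ := hΩ.exists_eq_one
  obtain ⟨C, -, hC⟩ := hΩ.exists_trace_le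
  refine ⟨lt_of_le_of_lt ?_ ((hC X).trans_lt ENNReal.ofReal_lt_top)⟩
  have h1 : ∫⁻ y, ENNReal.ofReal (X y ^ 2) ∂(bdryMeasure Ω) = ∫⁻ _, 1 ∂(bdryMeasure Ω) := by
    refine setLIntegral_congr_fun isClosed_frontier.measurableSet fun y hy => ?_
    simp [hX y (frontier_subset_closure hy)]
  rw [h1, lintegral_one]

theorem tendsto_H1 {Ω : Set Plane} {u : ℕ → H1 Ω} {v : H1 Ω}
    (h0 : Tendsto (fun n => valH1 (u n)) atTop (𝓝 (valH1 v)))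
    (h1 : ∀ i, Tendsto (fun n => derivH1 (u n) i) atTop (𝓝 (derivH1 v i))) :
    Tendsto u atTop (𝓝 v) := by
  rw [tendsto_iff_norm_sub_tendsto_zero]
  have h2 : Tendsto (fun n => √(‖valH1 (u n) - valH1 v‖ ^ 2 +
      ∑ i, ‖derivH1 (u n) i - derivH1 v i‖ ^ 2)) atTop (𝓝 (√(0 ^ 2 + ∑ _i : Fin 2, 0 ^ 2))) :=
    (((tendsto_iff_norm_sub_tendsto_zero.1 h0).pow 2).add (tendsto_finsetSum _ fun i _ =>
      (tendsto_iff_norm_sub_tendsto_zero.1 (h1 i)).pow 2)).sqrt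
  simp only [ne_eq, OfNat.ofNat_ne_zero, not_false_eq_true, zero_pow, Finset.sum_const_zero,
    add_zero, Real.sqrt_zero] at h2
  refine h2.congr fun n => ?_
  have h3 := norm_sq_H1 (u n - v)
  rw [← Real.sqrt_sq (norm_nonneg (u n - v)), h3]
  rfl

theorem tendsto_Lp_iff_of_ae_eq {μ : Measure Plane} {F : ℕ → Lp ℝ 2 μ} {g : Lp ℝ 2 μ}
    {φ : ℕ → Plane → ℝ} (hF : ∀ n, F n =ᵐ[μ] φ n) :
    Tendsto F atTop (𝓝 g) ↔
      Tendsto (fun n => eLpNorm (fun x => φ n x - g x) 2 μ) atTop (𝓝 0) := by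
  rw [Lp.tendsto_Lp_iff_tendsto_eLpNorm']
  refine tendsto_congr fun n => eLpNorm_congr_ae ?_
  filter_upwards [hF n] with x hx
  rw [Pi.sub_apply, hx]

theorem Test.d_mul_eq {Ω : Set Plane} (hΩ : IsOpen Ω) {X : Test} (hX : ∀ y ∈ closure Ω, X y = 1)
    (φ : Plane → ℝ) (i : Fin 2) {x : Plane} (hx : x ∈ Ω) :
    pderiv i (fun y => X y * φ y) x = pderiv i φ x := by
  have h : (fun y => X y * φ y) =ᶠ[𝓝 x] φ := by
    filter_upwards [hΩ.mem_nhds hx] with y hy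
    rw [hX y (subset_closure hy), one_mul]
  rw [pderiv, pderiv, h.fderiv_eq]

/-- The trace is a bounded linear operator. -/
theorem IsLipschitzDomain.exists_traceL {Ω : Set Plane} (hΩ : IsLipschitzDomain Ω) :
    ∃ T : H1 Ω →L[ℝ] Lp ℝ 2 (bdryMeasure Ω), ∀ u, trace u = T u := by
  have hfin := hΩ.isFiniteMeasure_bdryMeasure
  obtain ⟨C, hC0, hC⟩ := hΩ.exists_trace_le
  let t : Test →ₗ[ℝ] Lp ℝ 2 (bdryMeasure Ω) :=
    { toFun := fun φ => (φ.memLp 2 _).toLp φ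
      map_add' := fun _ _ => rfl
      map_smul' := fun _ _ => rfl }
  have ht : ∀ φ : Test, t φ =ᵐ[bdryMeasure Ω] φ := fun φ => MemLp.coeFn_toLp (φ.memLp 2 _)
  have hbd : ∀ φ : Test, ‖t φ‖ ≤ √C * ‖Test.toH1 Ω φ‖ := fun φ => by
    refine le_of_sq_le_sq ?_ (by positivity)
    rw [mul_pow, Real.sq_sqrt hC0, Test.norm_toH1_sq]
    have h1 : ‖t φ‖ ^ 2 = ∫ x, φ x ^ 2 ∂(bdryMeasure Ω) := by
      rw [← real_inner_self_eq_norm_sq, L2.inner_def]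
      refine integral_congr_ae ?_
      filter_upwards [ht φ] with x hx
      simp [hx]
    rw [h1, integral_eq_lintegral_of_nonneg_ae (.of_forall fun x => sq_nonneg _)
      (φ.continuous.pow 2).aestronglyMeasurable]
    exact ENNReal.toReal_le_of_le_ofReal (mul_nonneg hC0 (add_nonneg
      (integral_nonneg fun _ => sq_nonneg _) (integral_nonneg φ.gradSq_nonneg))) (hC φ)
  have hd := hΩ.denseRange_toH1
  -- Restriction to the boundary is bounded on the dense class of test functions, by the trace
  -- inequality, and extends by continuity.
  let T : H1 Ω →L[ℝ] Lp ℝ 2 (bdryMeasure Ω) := t.extendOfNorm (Test.toH1 Ω)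
  have hT : ∀ φ, T (Test.toH1 Ω φ) = t φ := LinearMap.extendOfNorm_eq hd ⟨_, hbd⟩
  have hex : ∀ u, IsTrace Ω u (T u) := by
    intro u
    obtain ⟨φ, hφ⟩ := exists_seq_tendsto_toH1 hΩ u
    refine ⟨fun n => φ n, fun n => (φ n).contDiff, ?_, fun i => ?_, ?_⟩
    · exact (tendsto_Lp_iff_of_ae_eq fun n => Test.coeFn_toL2 Ω (φ n)).1
        (((valL Ω).continuous.tendsto u).comp hφ)
    · exact (tendsto_Lp_iff_of_ae_eq fun n => Test.coeFn_toL2 Ω (Test.d i (φ n))).1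
        (((derivL Ω i).continuous.tendsto u).comp hφ)
    · refine (tendsto_Lp_iff_of_ae_eq fun n => ht (φ n)).1 ?_
      simp only [← hT]
      exact (T.continuous.tendsto u).comp hφ
  have huniq : ∀ u g, IsTrace Ω u g → g = T u := by
    rintro u g ⟨φ, hφ, h0, h1, h2⟩
    obtain ⟨X, hX⟩ := hΩ.exists_eq_one
    -- An arbitrary smooth approximating sequence is cut off by a test function equal to one on the
    -- closure. This changes neither its values nor its gradient on Ω, nor its values on the
    -- boundary.
    let ψ : ℕ → Test := fun n => ⟨fun x => X x * φ n x, X.contDiff.mul (hφ n),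
      X.hasCompactSupport.mul_right⟩
    have e0 : ∀ n x, x ∈ closure Ω → ψ n x = φ n x := fun n x hx => by
      simp only [ψ, hX x hx, one_mul]
    have hlim : Tendsto (fun n => Test.toH1 Ω (ψ n)) atTop (𝓝 u) := by
      refine tendsto_H1 ((tendsto_Lp_iff_of_ae_eq fun n => ?_).2 h0)
        fun i => (tendsto_Lp_iff_of_ae_eq fun n => ?_).2 (h1 i)
      · refine (Test.coeFn_toL2 Ω (ψ n)).trans ?_
        refine (ae_restrict_iff' hΩ.measurableSet).2 (.of_forall fun x hx => ?_)
        exact e0 n x (subset_closure hx)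
      · refine (Test.coeFn_toL2 Ω (Test.d i (ψ n))).trans ?_
        refine (ae_restrict_iff' hΩ.measurableSet).2 (.of_forall fun x hx => ?_)
        exact Test.d_mul_eq hΩ.isOpen hX (φ n) i hx
    have hlim2 : Tendsto (fun n => t (ψ n)) atTop (𝓝 g) := by
      refine (tendsto_Lp_iff_of_ae_eq fun n => ?_).2 h2
      refine (ht (ψ n)).trans ?_
      refine (ae_restrict_iff' isClosed_frontier.measurableSet).2 (.of_forall fun x hx => ?_)
      exact e0 n x (frontier_subset_closure hx)
    simp only [← hT] at hlim2
    exact tendsto_nhds_unique hlim2 ((T.continuous.tendsto u).comp hlim)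
  refine ⟨T, fun u => ?_⟩
  have h : ∃ g, IsTrace Ω u g := ⟨_, hex u⟩
  rw [trace, dif_pos h]
  exact huniq u _ h.choose_spec

/-! ### Korn's inequality in `H¹(Ω, ℝ²)` -/

/-- The entries of the strain, as continuous linear maps. -/
def strainL (Ω : Set Plane) (a b : Fin 2) : H1Vec Ω →L[ℝ] L2 Ω :=
  (1 / 2 : ℝ) • ((derivL Ω b).comp (PiLp.proj 2 (fun _ : Fin 2 => H1 Ω) a) +
    (derivL Ω a).comp (PiLp.proj 2 (fun _ : Fin 2 => H1 Ω) b))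

theorem strainL_apply {Ω : Set Plane} (a b : Fin 2) (u : H1Vec Ω) :
    strainL Ω a b u = (1 / 2 : ℝ) • (derivH1 (u a) b + derivH1 (u b) a) := rfl

theorem coeFn_strainL {Ω : Set Plane} (a b : Fin 2) (u : H1Vec Ω) :
    strainL Ω a b u =ᵐ[volume.restrict Ω] fun x => strain u x a b := by
  rw [strainL_apply]
  filter_upwards [Lp.coeFn_smul (1 / 2 : ℝ) (derivH1 (u a) b + derivH1 (u b) a),
    Lp.coeFn_add (derivH1 (u a) b) (derivH1 (u b) a)] with x h1 h2
  rw [h1, Pi.smul_apply, h2, Pi.add_apply, strain, Matrix.of_apply, smul_eq_mul]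
  ring

theorem exists_seq_tendsto_H1Vec {Ω : Set Plane} (hΩ : IsLipschitzDomain Ω) (u : H1Vec Ω) :
    ∃ φ : ℕ → Fin 2 → Test,
      Tendsto (fun n => (WithLp.toLp 2 fun i => Test.toH1 Ω (φ n i) : H1Vec Ω)) atTop (𝓝 u) := by
  choose φ hφ using fun i => exists_seq_tendsto_toH1 hΩ (u i)
  refine ⟨fun n i => φ i n, ?_⟩
  have h1 : Tendsto (fun n => fun i => Test.toH1 Ω (φ i n)) atTop (𝓝 (WithLp.ofLp u)) :=
    tendsto_pi_nhds.2 hφ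
  exact ((PiLp.continuous_toLp 2 (fun _ : Fin 2 => H1 Ω)).tendsto _).comp h1

/-- Korn's second inequality. -/
theorem IsLipschitzDomain.exists_norm_sq_le {Ω : Set Plane} (hΩ : IsLipschitzDomain Ω) :
    ∃ C : ℝ, 0 ≤ C ∧ ∀ u : H1Vec Ω, ‖u‖ ^ 2 ≤
      C * ((∑ a, ∑ b, ‖strainL Ω a b u‖ ^ 2) + ∑ a, ‖valH1 (u a)‖ ^ 2) := by
  obtain ⟨C, hC0, hC⟩ := hΩ.exists_korn
  refine ⟨4 * C + 1, by positivity, fun u => ?_⟩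
  obtain ⟨φ, hφ⟩ := exists_seq_tendsto_H1Vec hΩ u
  have hval : ∀ a, Continuous fun u : H1Vec Ω => valH1 (u a) := fun a =>
    ((valL Ω).comp (PiLp.proj 2 (fun _ : Fin 2 => H1 Ω) a)).continuous
  have hR : Continuous fun u : H1Vec Ω =>
      (4 * C + 1) * ((∑ a, ∑ b, ‖strainL Ω a b u‖ ^ 2) + ∑ a, ‖valH1 (u a)‖ ^ 2) := by
    refine continuous_const.mul (Continuous.add ?_ ?_)
    · exact continuous_finsetSum _ fun a _ => continuous_finsetSum _ fun b _ =>
        (strainL Ω a b).continuous.norm.pow 2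
    · exact continuous_finsetSum _ fun a _ => (hval a).norm.pow 2
  refine le_of_tendsto_of_tendsto' (hφ.norm.pow 2) ((hR.tendsto u).comp hφ) fun n => ?_
  simp only [Function.comp_apply]
  set v := φ n
  have hs : ∀ a b, strainL Ω a b (WithLp.toLp 2 fun i => Test.toH1 Ω (v i)) =
      Test.toL2 Ω (Test.strain v a b) := fun a b => by
    rw [strainL_apply, Test.strain, map_smul, map_add]
    rfl
  rw [PiLp.norm_sq_eq_of_L2]
  simp only [hs, norm_sq_H1, Test.valH1_toH1, Test.derivH1_toH1, Test.norm_toL2_sq]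
  have h := hC v
  set E := ∑ a, ∑ b, ∫ x in Ω, Test.strain v a b x ^ 2 with hE
  have hE0 : 0 ≤ E := Finset.sum_nonneg fun a _ => Finset.sum_nonneg fun b _ =>
    integral_nonneg fun _ => sq_nonneg _
  rw [Finset.sum_add_distrib]
  have h2 : ∑ i, ∑ j, ∫ x in Ω, Test.d j (v i) x ^ 2 ≤
      4 * (C * (E + ∑ a, ∫ x in Ω, v a x ^ 2)) := by
    simp only [Fin.sum_univ_two] at h ⊢
    linarith [h 0 0, h 0 1, h 1 0, h 1 1]
  linarith

/-! ### The elastic quadratic form -/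

section Form

variable {H : Type*} [NormedAddCommGroup H] [InnerProductSpace ℝ H]

/-- The bilinear form `α X : Z + β Tr X Tr Z` on matrices with entries in a Hilbert space. -/
def form (α β : ℝ) (X Z : Fin 2 → Fin 2 → H) : ℝ :=
  α * (∑ a, ∑ b, inner ℝ (X a b) (Z a b)) + β * inner ℝ (X 0 0 + X 1 1) (Z 0 0 + Z 1 1)

theorem form_comm (α β : ℝ) (X Z : Fin 2 → Fin 2 → H) : form α β X Z = form α β Z X := by
  unfold form
  rw [real_inner_comm]
  congr 2
  exact Finset.sum_congr rfl fun a _ => Finset.sum_congr rfl fun b _ => real_inner_comm _ _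

theorem form_add_right (α β : ℝ) (X Z Z' : Fin 2 → Fin 2 → H) :
    form α β X (Z + Z') = form α β X Z + form α β X Z' := by
  simp only [form, Fin.sum_univ_two, Pi.add_apply, inner_add_right]
  ring

theorem form_smul_right (α β c : ℝ) (X Z : Fin 2 → Fin 2 → H) :
    form α β X (c • Z) = c * form α β X Z := by
  simp only [form, Fin.sum_univ_two, Pi.smul_apply, inner_add_right, inner_smul_right]
  ring

theorem form_sub_right (α β : ℝ) (X Z Z' : Fin 2 → Fin 2 → H) :
    form α β X (Z - Z') = form α β X Z - form α β X Z' := by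
  simp only [form, Fin.sum_univ_two, Pi.sub_apply, inner_add_right, inner_sub_right]
  ring

theorem form_add_self (α β : ℝ) (X Z : Fin 2 → Fin 2 → H) :
    form α β (X + Z) (X + Z) = form α β X X + 2 * form α β X Z + form α β Z Z := by
  rw [form_add_right, form_comm α β (X + Z) X, form_comm α β (X + Z) Z, form_add_right,
    form_add_right, form_comm α β Z X]
  ring

theorem form_smul_self (α β c : ℝ) (X : Fin 2 → Fin 2 → H) :
    form α β (c • X) (c • X) = c ^ 2 * form α β X X := by
  rw [form_smul_right, form_comm, form_smul_right]
  ring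

/-- The form is diagonal in the off-diagonal entries and in the difference and the sum of the
diagonal ones; the coefficients relative to the norm are α, α and α + 2β. -/
theorem le_form_self {α β c : ℝ} (h1 : c ≤ α) (h2 : c ≤ α + 2 * β) (X : Fin 2 → Fin 2 → H) :
    c * ∑ a, ∑ b, ‖X a b‖ ^ 2 ≤ form α β X X := by
  simp only [form, Fin.sum_univ_two, real_inner_self_eq_norm_sq, norm_add_sq_real]
  have h3 := norm_sub_sq_real (X 0 0) (X 1 1)
  have h4 := norm_add_sq_real (X 0 0) (X 1 1)
  have h5 := sq_nonneg ‖X 0 0 - X 1 1‖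
  have h6 := sq_nonneg ‖X 0 0 + X 1 1‖
  have h7 := mul_nonneg (sub_nonneg.2 h1) (sq_nonneg ‖X 0 1‖)
  have h8 := mul_nonneg (sub_nonneg.2 h1) (sq_nonneg ‖X 1 0‖)
  have h9 := mul_nonneg (sub_nonneg.2 h1) h5
  have h10 := mul_nonneg (sub_nonneg.2 h2) h6
  rw [h3] at h9
  rw [h4] at h10
  nlinarith

theorem form_self_nonneg {α β : ℝ} (h1 : 0 ≤ α) (h2 : 0 ≤ α + 2 * β) (X : Fin 2 → Fin 2 → H) :
    0 ≤ form α β X X := by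
  have := le_form_self h1 h2 X
  rwa [zero_mul] at this

theorem eq_zero_of_form_self {α β : ℝ} (h1 : 0 < α) (h2 : 0 < α + 2 * β) {X : Fin 2 → Fin 2 → H}
    (h : form α β X X ≤ 0) : X = 0 := by
  have h3 := le_form_self (min_le_left α (α + 2 * β)) (min_le_right _ _) X
  have h4 : 0 < min α (α + 2 * β) := lt_min h1 h2
  have h5 : ∑ a, ∑ b, ‖X a b‖ ^ 2 ≤ 0 := by
    by_contra! h6
    nlinarith
  have h6 : ∀ a ∈ Finset.univ, 0 ≤ ∑ b, ‖X a b‖ ^ 2 :=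
    fun a _ => Finset.sum_nonneg fun b _ => sq_nonneg _
  have h7 := (Finset.sum_eq_zero_iff_of_nonneg h6).1 (le_antisymm h5 (Finset.sum_nonneg h6))
  ext a b
  have h8 := (Finset.sum_eq_zero_iff_of_nonneg fun b _ => sq_nonneg _).1
    (h7 a (Finset.mem_univ a)) b (Finset.mem_univ b)
  simpa using h8

/-- Only the second argument varies, so weak convergence of the entries is enough. -/
theorem tendsto_form {α β : ℝ} {X Z : Fin 2 → Fin 2 → H} {Zn : ℕ → Fin 2 → Fin 2 → H}
    (h : ∀ a b c d, Tendsto (fun n => inner ℝ (X c d) (Zn n a b)) atTop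
      (𝓝 (inner ℝ (X c d) (Z a b)))) :
    Tendsto (fun n => form α β X (Zn n)) atTop (𝓝 (form α β X Z)) := by
  simp only [form, Fin.sum_univ_two, inner_add_left, inner_add_right]
  exact ((((h _ _ _ _).add (h _ _ _ _)).add ((h _ _ _ _).add (h _ _ _ _))).const_mul _).add
    ((((h _ _ _ _).add (h _ _ _ _)).add ((h _ _ _ _).add (h _ _ _ _))).const_mul _)

end Form

theorem integral_frob {Ω : Set Plane} (Y ν : ℝ) {X Z : Fin 2 → Fin 2 → L2 Ω}
    {A B : Plane → Matrix (Fin 2) (Fin 2) ℝ}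
    (hX : ∀ a b, X a b =ᵐ[volume.restrict Ω] fun x => A x a b)
    (hZ : ∀ a b, Z a b =ᵐ[volume.restrict Ω] fun x => B x a b) :
    ∫ x in Ω, frob (J' Y ν (A x)) (B x) =
      form (Y / (1 + ν)) (Y * ν / (1 - ν ^ 2)) X Z := by
  have hi : ∀ a b c d, Integrable (fun x => A x a b * B x c d) (volume.restrict Ω) :=
    fun a b c d => (MemLp.integrable_mul ((Lp.memLp (X a b)).ae_eq (hX a b))
      ((Lp.memLp (Z c d)).ae_eq (hZ c d)))
  have hinner : ∀ a b c d, inner ℝ (X a b) (Z c d) = ∫ x in Ω, A x a b * B x c d := by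
    intro a b c d
    rw [L2.inner_def]
    refine integral_congr_ae ?_
    filter_upwards [hX a b, hZ c d] with x h1 h2
    rw [h1, h2]
    simp [mul_comm]
  simp only [form, Fin.sum_univ_two, inner_add_left, inner_add_right, hinner]
  have hi2 : ∀ a b c d a' b' c' d',
      Integrable (fun x => A x a b * B x c d + A x a' b' * B x c' d') (volume.restrict Ω) :=
    fun a b c d a' b' c' d' => (hi a b c d).add (hi a' b' c' d')
  rw [← integral_add (hi _ _ _ _) (hi _ _ _ _), ← integral_add (hi _ _ _ _) (hi _ _ _ _),
    ← integral_add (hi _ _ _ _) (hi _ _ _ _), ← integral_add (hi _ _ _ _) (hi _ _ _ _),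
    ← integral_add (hi2 _ _ _ _ _ _ _ _) (hi2 _ _ _ _ _ _ _ _),
    ← integral_add (hi2 _ _ _ _ _ _ _ _) (hi2 _ _ _ _ _ _ _ _),
    ← integral_const_mul, ← integral_const_mul, ← integral_add]
  · refine integral_congr_ae (.of_forall fun x => ?_)
    simp [frob, J', Matrix.trace, Fin.sum_univ_two]
    ring
  · exact ((hi2 _ _ _ _ _ _ _ _).add (hi2 _ _ _ _ _ _ _ _)).const_mul _
  · exact ((hi2 _ _ _ _ _ _ _ _).add (hi2 _ _ _ _ _ _ _ _)).const_mul _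

/-- Euler's identity for a homogeneous function of degree two. -/
theorem J_eq_frob (Y ν : ℝ) (A : Matrix (Fin 2) (Fin 2) ℝ) : J Y ν A = frob (J' Y ν A) A / 2 := by
  have e1 : Y / (2 * (1 + ν)) = Y / (1 + ν) / 2 := by rw [div_div, mul_comm 2]
  have e2 : Y * ν / (2 * (1 - ν ^ 2)) = Y * ν / (1 - ν ^ 2) / 2 := by rw [div_div, mul_comm 2]
  simp [frob, J, J', Matrix.trace, Fin.sum_univ_two, e1, e2]
  ring

theorem integral_J {Ω : Set Plane} (Y ν : ℝ) {X : Fin 2 → Fin 2 → L2 Ω}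
    {A : Plane → Matrix (Fin 2) (Fin 2) ℝ}
    (hX : ∀ a b, X a b =ᵐ[volume.restrict Ω] fun x => A x a b) :
    ∫ x in Ω, J Y ν (A x) = form (Y / (1 + ν)) (Y * ν / (1 - ν ^ 2)) X X / 2 := by
  simp only [J_eq_frob]
  rw [integral_div, integral_frob Y ν hX hX]

/-! ### Strains, gradient tensors and Hessians as square integrable fields -/

/-- The strain, as a matrix of functions in `L²(Ω)`. -/
def strainF {Ω : Set Plane} (u : H1Vec Ω) (a b : Fin 2) : L2 Ω := strainL Ω a b u

theorem strainF_sub {Ω : Set Plane} (u v : H1Vec Ω) : strainF (u - v) = strainF u - strainF v := by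
  ext1 a
  ext1 b
  exact (strainL Ω a b).map_sub u v

/-- The Hessian, as a matrix of functions in `L²(Ω)`. -/
def hessF {Ω : Set Plane} (w : H2 Ω) (a b : Fin 2) : L2 Ω := derivH1 (derivH2 w a) b

theorem hessF_smul {Ω : Set Plane} (c : ℝ) (w : H2 Ω) : hessF (c • w) = c • hessF w := rfl

/-- The product of two functions in `H¹(Ω)`, as a function in `L²(Ω)`. -/
def prodL2 {Ω : Set Plane} (hΩ : IsLipschitzDomain Ω) (u v : H1 Ω) : L2 Ω :=
  (hΩ.exists_mul_le.choose_spec.2 u v).1.toLp _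

theorem coeFn_prodL2 {Ω : Set Plane} (hΩ : IsLipschitzDomain Ω) (u v : H1 Ω) :
    prodL2 hΩ u v =ᵐ[volume.restrict Ω] fun x => valH1 u x * valH1 v x :=
  MemLp.coeFn_toLp _

theorem exists_norm_prodL2_le {Ω : Set Plane} (hΩ : IsLipschitzDomain Ω) : ∃ C : ℝ, 0 ≤ C ∧
    ∀ u v : H1 Ω, ‖prodL2 hΩ u v‖ ^ 2 ≤ C * (‖valH1 u‖ * ‖u‖ * ‖valH1 v‖ * ‖v‖) := by
  obtain ⟨hC0, hC⟩ := hΩ.exists_mul_le.choose_spec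
  set C := hΩ.exists_mul_le.choose
  refine ⟨√C, Real.sqrt_nonneg _, fun u v => le_of_sq_le_sq ?_ (by positivity)⟩
  rw [mul_pow, Real.sq_sqrt hC0]
  refine le_trans (le_of_eq ?_) (hC u v).2
  congr 1
  rw [← real_inner_self_eq_norm_sq, L2.inner_def]
  refine integral_congr_ae ?_
  filter_upwards [coeFn_prodL2 hΩ u v] with x hx
  rw [hx, real_inner_self_eq_norm_sq, Real.norm_eq_abs, sq_abs]

theorem prodL2_sub_prodL2 {Ω : Set Plane} (hΩ : IsLipschitzDomain Ω) (u v u' v' : H1 Ω) :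
    prodL2 hΩ u v - prodL2 hΩ u' v' = prodL2 hΩ (u - u') v + prodL2 hΩ u' (v - v') := by
  refine Lp.ext ?_
  filter_upwards [Lp.coeFn_sub (prodL2 hΩ u v) (prodL2 hΩ u' v'), coeFn_prodL2 hΩ u v,
    coeFn_prodL2 hΩ u' v', Lp.coeFn_add (prodL2 hΩ (u - u') v) (prodL2 hΩ u' (v - v')),
    coeFn_prodL2 hΩ (u - u') v, coeFn_prodL2 hΩ u' (v - v'),
    Lp.coeFn_sub (valH1 u) (valH1 u'), Lp.coeFn_sub (valH1 v) (valH1 v')]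
    with x h1 h2 h3 h4 h5 h6 h7 h8
  have e7 : valH1 (u - u') x = valH1 u x - valH1 u' x := h7
  have e8 : valH1 (v - v') x = valH1 v x - valH1 v' x := h8
  rw [h1, h4, Pi.sub_apply, Pi.add_apply, h2, h3, h5, h6, e7, e8]
  ring

/-- The product map is continuous along bounded sequences that converge in `L²(Ω)`. -/
theorem tendsto_prodL2 {Ω : Set Plane} (hΩ : IsLipschitzDomain Ω) {un vn : ℕ → H1 Ω} {u v : H1 Ω}
    {M : ℝ} (hu : ∀ n, ‖un n - u‖ ≤ M) (hv : ∀ n, ‖vn n - v‖ ≤ M)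
    (hu' : Tendsto (fun n => valH1 (un n - u)) atTop (𝓝 0))
    (hv' : Tendsto (fun n => valH1 (vn n - v)) atTop (𝓝 0)) :
    Tendsto (fun n => prodL2 hΩ (un n) (vn n)) atTop (𝓝 (prodL2 hΩ u v)) := by
  obtain ⟨C, hC0, hC⟩ := exists_norm_prodL2_le hΩ
  have hM : 0 ≤ M := (norm_nonneg _).trans (hu 0)
  have hval : ∀ z : H1 Ω, ‖valH1 z‖ ≤ ‖z‖ := fun z => by
    refine le_of_sq_le_sq ?_ (norm_nonneg _)
    rw [norm_sq_H1 z]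
    exact le_add_of_nonneg_right (Finset.sum_nonneg fun _ _ => sq_nonneg _)
  -- Ladyzhenskaya bounds the squared norm of a product by the L² norms times the H¹ norms; the
  -- latter are bounded, so it suffices that the product of the L² norms vanishes in the limit.
  have hzero : ∀ {a b : ℕ → H1 Ω} {K : ℝ}, (∀ n, ‖a n‖ ≤ K) → (∀ n, ‖b n‖ ≤ K) →
      Tendsto (fun n => ‖valH1 (a n)‖ * ‖valH1 (b n)‖) atTop (𝓝 0) →
      Tendsto (fun n => prodL2 hΩ (a n) (b n)) atTop (𝓝 0) := by
    intro a b K ha hb hab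
    have hK : 0 ≤ K := (norm_nonneg _).trans (ha 0)
    rw [tendsto_zero_iff_norm_tendsto_zero]
    have h1 : Tendsto (fun n => √(C * (K * K) * (‖valH1 (a n)‖ * ‖valH1 (b n)‖))) atTop
        (𝓝 (√(C * (K * K) * 0))) := (hab.const_mul _).sqrt
    rw [mul_zero, Real.sqrt_zero] at h1
    refine squeeze_zero (fun _ => norm_nonneg _) (fun n => ?_) h1
    refine Real.le_sqrt_of_sq_le ((hC _ _).trans ?_)
    rw [mul_assoc C]
    refine mul_le_mul_of_nonneg_left ?_ hC0
    calc ‖valH1 (a n)‖ * ‖a n‖ * ‖valH1 (b n)‖ * ‖b n‖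
        = (‖a n‖ * ‖b n‖) * (‖valH1 (a n)‖ * ‖valH1 (b n)‖) := by ring
      _ ≤ _ := by
        gcongr
        · exact ha n
        · exact hb n
  rw [tendsto_iff_norm_sub_tendsto_zero]
  simp only [prodL2_sub_prodL2]
  have hvn : ∀ n, ‖vn n‖ ≤ M + ‖v‖ := fun n => by
    have := norm_le_insert' (vn n) v
    linarith [hv n]
  have h1 : Tendsto (fun n => prodL2 hΩ (un n - u) (vn n)) atTop (𝓝 0) := by
    refine hzero (K := M + ‖v‖) (fun n => (hu n).trans (by linarith [norm_nonneg v])) hvn ?_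
    have h2 : Tendsto (fun n => ‖valH1 (un n - u)‖ * (M + ‖v‖)) atTop (𝓝 (0 * (M + ‖v‖))) := by
      have := hu'.norm
      rw [norm_zero] at this
      exact this.mul_const _
    rw [zero_mul] at h2
    refine squeeze_zero (fun _ => by positivity) (fun n => ?_) h2
    gcongr
    exact (hval _).trans (hvn n)
  have h2 : Tendsto (fun n => prodL2 hΩ u (vn n - v)) atTop (𝓝 0) := by
    refine hzero (K := M + ‖u‖) (fun n => by linarith)
      (fun n => (hv n).trans (by linarith [norm_nonneg u])) ?_
    have h3 := hv'.norm.const_mul ‖valH1 u‖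
    rwa [norm_zero, mul_zero] at h3
  have h3 := (h1.add h2).norm
  rwa [add_zero, norm_zero] at h3

/-- The tensor `Dw ⊗ Dw`, as a matrix of functions in `L²(Ω)`. -/
def gradF {Ω : Set Plane} (hΩ : IsLipschitzDomain Ω) (w : H2 Ω) (a b : Fin 2) : L2 Ω :=
  prodL2 hΩ (derivH2 w a) (derivH2 w b)

theorem coeFn_gradF {Ω : Set Plane} (hΩ : IsLipschitzDomain Ω) (w : H2 Ω) (a b : Fin 2) :
    gradF hΩ w a b =ᵐ[volume.restrict Ω] fun x => gradTensor w x a b :=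
  coeFn_prodL2 hΩ _ _

theorem gradF_smul {Ω : Set Plane} (hΩ : IsLipschitzDomain Ω) (c : ℝ) (w : H2 Ω) :
    gradF hΩ (c • w) = c ^ 2 • gradF hΩ w := by
  ext1 a
  ext1 b
  refine Lp.ext ?_
  filter_upwards [coeFn_gradF hΩ (c • w) a b, coeFn_gradF hΩ w a b,
    Lp.coeFn_smul (c ^ 2) (gradF hΩ w a b), Lp.coeFn_smul c (valH1 (derivH2 w a)),
    Lp.coeFn_smul c (valH1 (derivH2 w b))] with x h1 h2 h3 h4 h5
  have e4 : valH1 (derivH2 (c • w) a) x = c * valH1 (derivH2 w a) x := h4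
  have e5 : valH1 (derivH2 (c • w) b) x = c * valH1 (derivH2 w b) x := h5
  rw [h1, Pi.smul_apply, Pi.smul_apply, h3, Pi.smul_apply, h2]
  simp only [gradTensor, Matrix.of_apply, e4, e5, smul_eq_mul]
  ring

theorem coeFn_stretching {Ω : Set Plane} (hΩ : IsLipschitzDomain Ω) (u : H1Vec Ω) (w : H2 Ω)
    (a b : Fin 2) : (strainF u + (1 / 2 : ℝ) • gradF hΩ w) a b =ᵐ[volume.restrict Ω]
      fun x => stretching u w x a b := by
  filter_upwards [Lp.coeFn_add (strainF u a b) ((1 / 2 : ℝ) • gradF hΩ w a b),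
    Lp.coeFn_smul (1 / 2 : ℝ) (gradF hΩ w a b), coeFn_gradF hΩ w a b, coeFn_strainL a b u]
    with x h1 h2 h3 h4
  have e : (strainF u + (1 / 2 : ℝ) • gradF hΩ w) a b =
    strainF u a b + (1 / 2 : ℝ) • gradF hΩ w a b := rfl
  rw [e, h1, Pi.add_apply, h2, Pi.smul_apply, h3, strainF, h4]
  rfl

/-! ### Equilibria of the flat plate -/

theorem map_eq_zero_of_weakly {V G : Type*} [NormedAddCommGroup V] [NormedSpace ℝ V]
    [NormedAddCommGroup G] [InnerProductSpace ℝ G] {u : ℕ → V} {v : V}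
    (hu : ∀ ℓ : V →L[ℝ] ℝ, Tendsto (fun n => ℓ (u n)) atTop (𝓝 (ℓ v))) (F : V →L[ℝ] G)
    (hF : Tendsto (fun n => F (u n)) atTop (𝓝 0)) : F v = 0 := by
  refine ext_inner_left ℝ fun z => ?_
  have h1 := hu ((innerSL ℝ z).comp F)
  have h2 : Tendsto (fun n => inner ℝ z (F (u n))) atTop (𝓝 (inner ℝ z 0)) :=
    tendsto_const_nhds.inner hF
  exact tendsto_nhds_unique h1 h2

section Equilibrium

variable {V H : Type*} [NormedAddCommGroup V] [InnerProductSpace ℝ V]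
  [NormedAddCommGroup H] [InnerProductSpace ℝ H] (α β : ℝ) (S : Fin 2 → Fin 2 → V →L[ℝ] H)
  (P : V →L[ℝ] V)

/-- The bilinear form of the strains `S u`, `S v`, to which `⟪P u, P v⟫` is added. -/
def strainForm : V →L[ℝ] V →L[ℝ] ℝ :=
  α • (∑ a, ∑ b, (innerSL ℝ).bilinearComp (S a b) (S a b)) +
    β • (innerSL ℝ).bilinearComp (S 0 0 + S 1 1) (S 0 0 + S 1 1) + (innerSL ℝ).bilinearComp P P

theorem strainForm_apply (u v : V) : strainForm α β S P u v =
    form α β (fun a b => S a b u) (fun a b => S a b v) + inner ℝ (P u) (P v) := by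
  simp [strainForm, form, Fin.sum_univ_two, inner_add_left]
  ring

variable [CompleteSpace V] {α β S P}

/-- By contradiction and compactness. Without coercivity there are unit vectors whose form tends to
zero; along a subsequence they converge weakly to some v with S v = 0 and P v = 0, hence v = P v =
0. The hypothesis `hS` upgrades this to strong convergence to zero, against the unit norms. -/
theorem isCoercive_strainForm [TopologicalSpace.SeparableSpace V] (hα : 0 < α)
    (hαβ : 0 < α + 2 * β)
    (hS : ∀ u : ℕ → V, (∀ n, ‖u n‖ ≤ 1) → (∀ ℓ : V →L[ℝ] ℝ, Tendsto (fun n => ℓ (u n)) atTop (𝓝 0)) →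
      (∀ a b, Tendsto (fun n => S a b (u n)) atTop (𝓝 0)) → Tendsto u atTop (𝓝 0))
    (hP : ∀ u, (∀ a b, S a b u = 0) → P u = u) : IsCoercive (strainForm α β S P) := by
  by_contra hcon
  have hc0 : 0 < min α (α + 2 * β) := lt_min hα hαβ
  have hlow : ∀ u, min α (α + 2 * β) * ∑ a, ∑ b, ‖S a b u‖ ^ 2 + ‖P u‖ ^ 2 ≤
      strainForm α β S P u u := fun u => by
    rw [strainForm_apply, real_inner_self_eq_norm_sq]
    have := le_form_self (min_le_left α (α + 2 * β)) (min_le_right _ _) (fun a b => S a b u)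
    linarith
  have hex : ∀ n : ℕ, ∃ u : V, ‖u‖ = 1 ∧ strainForm α β S P u u ≤ 1 / (n + 1) := by
    intro n
    by_contra! h
    refine hcon ⟨1 / (n + 1), by positivity, fun u => ?_⟩
    rcases eq_or_ne u 0 with rfl | hu
    · simp
    · have hu' : 0 < ‖u‖ := norm_pos_iff.2 hu
      have h1 := h (‖u‖⁻¹ • u) (by rw [norm_smul, norm_inv, norm_norm, inv_mul_cancel₀ hu'.ne'])
      simp only [map_smul, FunLike.coe_smul, Pi.smul_apply, smul_eq_mul] at h1
      have h2 : strainForm α β S P u u = ‖u‖⁻¹ * (‖u‖⁻¹ * strainForm α β S P u u) * (‖u‖ * ‖u‖) := by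
        field_simp
      rw [h2, mul_assoc]
      gcongr
  choose u hu1 hu using hex
  obtain ⟨v, s, hs, hlim⟩ := exists_subseq_weakly (fun n => (hu1 n).le)
  have hℓ : ∀ ℓ : V →L[ℝ] ℝ, Tendsto (fun n => ℓ (u (s n))) atTop (𝓝 (ℓ v)) := fun ℓ => by
    have h := hlim ((InnerProductSpace.toDual ℝ V).symm ℓ)
    simp only [real_inner_comm _ (u _), real_inner_comm _ v] at h
    simpa only [InnerProductSpace.toDual_symm_apply] using h
  have hzero : Tendsto (fun n => strainForm α β S P (u (s n)) (u (s n))) atTop (𝓝 0) := by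
    refine squeeze_zero (fun n => le_trans ?_ (hlow _)) (fun n => hu (s n))
      (tendsto_one_div_add_atTop_nhds_zero_nat.comp hs.tendsto_atTop)
    have : 0 ≤ ∑ a, ∑ b, ‖S a b (u (s n))‖ ^ 2 :=
      Finset.sum_nonneg fun _ _ => Finset.sum_nonneg fun _ _ => sq_nonneg _
    positivity
  have hsqrt : ∀ {f : ℕ → ℝ}, (∀ n, 0 ≤ f n) → Tendsto (fun n => f n ^ 2) atTop (𝓝 0) →
      Tendsto f atTop (𝓝 0) := fun {f} hf h => by
    have h1 := h.sqrt
    rw [Real.sqrt_zero] at h1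
    exact h1.congr fun n => Real.sqrt_sq (hf n)
  have hS0 : ∀ a b, Tendsto (fun n => S a b (u (s n))) atTop (𝓝 0) := fun a b => by
    rw [tendsto_zero_iff_norm_tendsto_zero]
    refine hsqrt (fun _ => norm_nonneg _) ?_
    have h1 := hzero.const_mul (min α (α + 2 * β))⁻¹
    rw [mul_zero] at h1
    refine squeeze_zero (fun _ => sq_nonneg _) (fun n => ?_) h1
    rw [inv_mul_eq_div, le_div_iff₀ hc0, mul_comm]
    have h2 : ‖S a b (u (s n))‖ ^ 2 ≤ ∑ a, ∑ b, ‖S a b (u (s n))‖ ^ 2 :=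
      (Finset.single_le_sum (f := fun b => ‖S a b (u (s n))‖ ^ 2) (fun _ _ => sq_nonneg _)
        (Finset.mem_univ b)).trans
        (Finset.single_le_sum (f := fun a => ∑ b, ‖S a b (u (s n))‖ ^ 2)
        (fun _ _ => Finset.sum_nonneg fun _ _ => sq_nonneg _) (Finset.mem_univ a))
    have h3 := mul_le_mul_of_nonneg_left h2 hc0.le
    linarith [hlow (u (s n)), sq_nonneg ‖P (u (s n))‖]
  have hP0 : Tendsto (fun n => P (u (s n))) atTop (𝓝 0) := by
    rw [tendsto_zero_iff_norm_tendsto_zero]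
    refine hsqrt (fun _ => norm_nonneg _) (squeeze_zero (fun _ => sq_nonneg _) (fun n => ?_) hzero)
    have : 0 ≤ ∑ a, ∑ b, ‖S a b (u (s n))‖ ^ 2 :=
      Finset.sum_nonneg fun _ _ => Finset.sum_nonneg fun _ _ => sq_nonneg _
    have := mul_nonneg hc0.le this
    linarith [hlow (u (s n))]
  have hv : v = 0 := by
    rw [← hP v fun a b => map_eq_zero_of_weakly hℓ (S a b) (hS0 a b)]
    exact map_eq_zero_of_weakly hℓ P hP0
  have hfin := hS (fun n => u (s n)) (fun n => (hu1 _).le)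
    (fun ℓ => by simpa [hv] using hℓ ℓ) hS0
  have h1 := hfin.norm
  simp only [hu1, norm_zero] at h1
  exact one_ne_zero (tendsto_nhds_unique tendsto_const_nhds h1)

/-- The form degenerates on the common kernel N of the strains, so the inner product of the
projections onto N is added and Lax-Milgram applies. Testing with the projection of the solution
onto N, where L vanishes, shows that this projection is zero; the added term then drops out of the
equation. -/
theorem exists_equilibrium [TopologicalSpace.SeparableSpace V] (hα : 0 < α) (hαβ : 0 < α + 2 * β)
    (hS : ∀ u : ℕ → V, (∀ n, ‖u n‖ ≤ 1) → (∀ ℓ : V →L[ℝ] ℝ, Tendsto (fun n => ℓ (u n)) atTop (𝓝 0)) →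
      (∀ a b, Tendsto (fun n => S a b (u n)) atTop (𝓝 0)) → Tendsto u atTop (𝓝 0))
    (L : V →L[ℝ] ℝ) (hL : ∀ v, (∀ a b, S a b v = 0) → L v = 0) :
    ∃ u, ∀ v, form α β (fun a b => S a b u) (fun a b => S a b v) = L v := by
  let N : Submodule ℝ V := ⨅ a, ⨅ b, LinearMap.ker (S a b : V →ₗ[ℝ] H)
  have hN : ∀ v, v ∈ N ↔ ∀ a b, S a b v = 0 := fun v => by
    simp [N, Submodule.mem_iInf]
  have hNc : IsClosed (N : Set V) := by
    have : (N : Set V) = ⋂ a, ⋂ b, {v | S a b v = 0} := by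
      ext v
      simp only [SetLike.mem_coe, hN, mem_iInter]
      rfl
    rw [this]
    exact isClosed_iInter fun a => isClosed_iInter fun b =>
      isClosed_eq (S a b).continuous continuous_const
  have : CompleteSpace N := hNc.completeSpace_coe
  have hc := isCoercive_strainForm (P := N.starProjection) hα hαβ hS fun u hu =>
    Submodule.starProjection_eq_self_iff.2 ((hN u).2 hu)
  set u := hc.continuousLinearEquivOfBilin.symm ((InnerProductSpace.toDual ℝ V).symm L) with hu
  have hEL : ∀ v, form α β (fun a b => S a b u) (fun a b => S a b v) +
      inner ℝ (N.starProjection u) (N.starProjection v) = L v := fun v => by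
    rw [← strainForm_apply, ← hc.continuousLinearEquivOfBilin_apply, hu,
      ContinuousLinearEquiv.apply_symm_apply, InnerProductSpace.toDual_symm_apply]
  have hz : N.starProjection u = 0 := by
    have hmem : N.starProjection u ∈ N := by
      rw [Submodule.starProjection_apply]
      exact Submodule.coe_mem _
    have h1 := hEL (N.starProjection u)
    have hzero := (hN _).1 hmem
    rw [hL _ hzero, Submodule.starProjection_eq_self_iff.2 hmem] at h1
    have h2 : form α β (fun a b => S a b u) (fun a b => S a b (N.starProjection u)) = 0 := by
      simp [form, hzero]
    rw [h2, zero_add] at h1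
    exact inner_self_eq_zero.1 h1
  exact ⟨u, fun v => by have := hEL v; rwa [hz, inner_zero_left, add_zero] at this⟩

end Equilibrium

instance innerProductSpace_H1Vec (Ω : Set Plane) : InnerProductSpace ℝ (H1Vec Ω) :=
  PiLp.innerProductSpace _

instance completeSpace_H1Vec (Ω : Set Plane) : CompleteSpace (H1Vec Ω) :=
  inferInstance

/-- Korn's inequality leaves only the L² norms to control, and by Rellich's theorem they tend to
zero. -/
theorem IsLipschitzDomain.tendsto_of_strainL {Ω : Set Plane} (hΩ : IsLipschitzDomain Ω)
    (u : ℕ → H1Vec Ω) (hu : ∀ n, ‖u n‖ ≤ 1)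
    (hw : ∀ ℓ : H1Vec Ω →L[ℝ] ℝ, Tendsto (fun n => ℓ (u n)) atTop (𝓝 0))
    (hS : ∀ a b, Tendsto (fun n => strainL Ω a b (u n)) atTop (𝓝 0)) :
    Tendsto u atTop (𝓝 0) := by
  obtain ⟨C, hC0, hC⟩ := hΩ.exists_norm_sq_le
  have hval : ∀ a, Tendsto (fun n => valH1 (u n a)) atTop (𝓝 0) := fun a => by
    refine hΩ.tendsto_valH1 (M := 1) (fun n => (PiLp.norm_apply_le (u n) a).trans (hu n)) fun g => ?_
    exact hw ((innerSL ℝ g).comp ((valL Ω).comp (PiLp.proj 2 (fun _ : Fin 2 => H1 Ω) a)))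
  have h1 : Tendsto (fun n => C * ((∑ a, ∑ b, ‖strainL Ω a b (u n)‖ ^ 2) +
      ∑ a, ‖valH1 (u n a)‖ ^ 2)) atTop (𝓝 (C * ((∑ _a : Fin 2, ∑ _b : Fin 2, ‖(0 : L2 Ω)‖ ^ 2) +
      ∑ _a : Fin 2, ‖(0 : L2 Ω)‖ ^ 2))) :=
    ((tendsto_finsetSum _ fun a _ => tendsto_finsetSum _ fun b _ => (hS a b).norm.pow 2).add
      (tendsto_finsetSum _ fun a _ => (hval a).norm.pow 2)).const_mul _
  simp only [norm_zero, ne_eq, OfNat.ofNat_ne_zero, not_false_eq_true, zero_pow,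
    Finset.sum_const_zero, add_zero, mul_zero] at h1
  have h2 := (squeeze_zero (fun _ => sq_nonneg _) (fun n => hC (u n)) h1).sqrt
  rw [Real.sqrt_zero] at h2
  rw [tendsto_zero_iff_norm_tendsto_zero]
  exact h2.congr fun n => Real.sqrt_sq (norm_nonneg _)

/-- The work of a square integrable load is a bounded linear functional. -/
theorem IsLipschitzDomain.exists_loadWorkL {Ω : Set Plane} (hΩ : IsLipschitzDomain Ω)
    {f : Plane → Plane} (hf : MemLp f 2 (bdryMeasure Ω)) :
    ∃ L : H1Vec Ω →L[ℝ] ℝ, ∀ u, loadWork f u = L u := by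
  obtain ⟨T, hT⟩ := hΩ.exists_traceL
  have hfi : ∀ i, MemLp (fun x => f x i) 2 (bdryMeasure Ω) := fun i =>
    (EuclideanSpace.proj i : Plane →L[ℝ] ℝ).comp_memLp' hf
  refine ⟨∑ i, (innerSL ℝ ((hfi i).toLp _)).comp
    (T.comp (PiLp.proj 2 (fun _ : Fin 2 => H1 Ω) i)), fun u => ?_⟩
  have h1 : loadWork f u = ∑ i, ∫ x, f x i * T (u i) x ∂(bdryMeasure Ω) := by
    simp only [loadWork, hT]
    exact integral_finsetSum _ fun i _ => MemLp.integrable_mul (hfi i) (Lp.memLp (T (u i)))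
  have h2 : ∀ i, ∫ x, f x i * T (u i) x ∂(bdryMeasure Ω) =
      inner ℝ ((hfi i).toLp _) (T (u i)) := fun i => by
    rw [L2.inner_def]
    refine integral_congr_ae ?_
    filter_upwards [(hfi i).coeFn_toLp] with x hx
    rw [hx]
    simp [mul_comm]
  rw [h1]
  simp only [h2, _root_.sum_apply]
  rfl

theorem strainF_eq_zero_iff {Ω : Set Plane} (u : H1Vec Ω) :
    strainF u = 0 ↔ ∀ᵐ x ∂(volume.restrict Ω), strain u x = 0 := by
  constructor
  · intro h
    have h1 : ∀ᵐ x ∂(volume.restrict Ω), ∀ a b, strain u x a b = 0 := by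
      refine ae_all_iff.2 fun a => ae_all_iff.2 fun b => ?_
      have h2 : strainL Ω a b u = 0 := congrFun (congrFun h a) b
      have h3 := coeFn_strainL a b u
      rw [h2] at h3
      filter_upwards [h3, Lp.coeFn_zero ℝ 2 (volume.restrict Ω)] with x h4 h5
      rw [← h4, h5]
      rfl
    filter_upwards [h1] with x hx
    ext a b
    exact hx a b
  · intro h
    ext1 a
    ext1 b
    refine Lp.ext ?_
    filter_upwards [h, coeFn_strainL a b u, Lp.coeFn_zero ℝ 2 (volume.restrict Ω)] with x h1 h2 h3
    have e : (0 : Fin 2 → Fin 2 → L2 Ω) a b = 0 := rfl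
    rw [strainF, h2, h1, e, h3]
    rfl

/-- The Euler-Lagrange equation of the flat plate has a solution. -/
theorem IsLipschitzDomain.exists_euler_lagrange {Ω : Set Plane} (hΩ : IsLipschitzDomain Ω)
    {f : Plane → Plane} (hf : MemLp f 2 (bdryMeasure Ω)) (hequil : Equilibrated Ω f) {α β : ℝ}
    (hα : 0 < α) (hαβ : 0 < α + 2 * β) :
    ∃ u : H1Vec Ω, ∀ v : H1Vec Ω, form α β (strainF u) (strainF v) = loadWork f v := by
  obtain ⟨L, hL⟩ := hΩ.exists_loadWorkL hf
  obtain ⟨u, hu⟩ := exists_equilibrium (S := strainL Ω) hα hαβ hΩ.tendsto_of_strainL L fun v hv => by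
    rw [← hL]
    refine hequil v ((strainF_eq_zero_iff v).1 ?_)
    ext1 a
    ext1 b
    exact hv a b
  exact ⟨u, fun v => (hu v).trans (hL v).symm⟩

theorem IsLipschitzDomain.loadWork_sub {Ω : Set Plane} (hΩ : IsLipschitzDomain Ω)
    {f : Plane → Plane} (hf : MemLp f 2 (bdryMeasure Ω)) (u v : H1Vec Ω) :
    loadWork f (u - v) = loadWork f u - loadWork f v := by
  obtain ⟨L, hL⟩ := hΩ.exists_loadWorkL hf
  rw [hL, hL, hL]
  exact L.map_sub u v

/-! ### The admissible classes -/

/-- The trace is continuous into L²(∂Ω), so a subsequence of traces converges almost everywhere: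
pointwise conditions on Γ pass to the limit. -/
theorem exists_subseq_trace_tendsto {Ω Γ : Set Plane} (hΩ : IsLipschitzDomain Ω)
    (hΓ : Γ ⊆ frontier Ω) {u : ℕ → H1 Ω} {v : H1 Ω} (h : Tendsto u atTop (𝓝 v)) :
    ∃ s : ℕ → ℕ, StrictMono s ∧ ∀ᵐ x ∂((Measure.hausdorffMeasure 1 : Measure Plane).restrict Γ),
      Tendsto (fun n => trace (u (s n)) x) atTop (𝓝 (trace v x)) := by
  obtain ⟨T, hT⟩ := hΩ.exists_traceL
  have h1 : Tendsto (fun n => T (u n)) atTop (𝓝 (T v)) := (T.continuous.tendsto v).comp h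
  obtain ⟨s, hs, hae⟩ := (tendstoInMeasure_of_tendsto_Lp h1).exists_seq_tendsto_ae
  simp only [hT]
  exact ⟨s, hs, ae_mono (Measure.restrict_mono_set _ hΓ) hae⟩

theorem trace_add_ae {Ω Γ : Set Plane} (hΩ : IsLipschitzDomain Ω) (hΓ : Γ ⊆ frontier Ω)
    (u v : H1 Ω) (a b : ℝ) : ∀ᵐ x ∂((Measure.hausdorffMeasure 1 : Measure Plane).restrict Γ),
      trace (a • u + b • v) x = a * trace u x + b * trace v x := by
  obtain ⟨T, hT⟩ := hΩ.exists_traceL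
  refine ae_mono (Measure.restrict_mono_set _ hΓ) ?_
  have e : T (a • u + b • v) = a • T u + b • T v := by rw [map_add, map_smul, map_smul]
  simp only [hT, e]
  filter_upwards [Lp.coeFn_add (a • T u) (b • T v), Lp.coeFn_smul a (T u), Lp.coeFn_smul b (T v)]
    with x h1 h2 h3
  rw [h1, Pi.add_apply, h2, h3]
  rfl

theorem vanishesOn_isSeqClosed {Ω Γ : Set Plane} (hΩ : IsLipschitzDomain Ω)
    (hΓ : Γ ⊆ frontier Ω) : IsSeqClosed {w : H2 Ω | VanishesOn Γ w} := by
  intro wn w hwn hw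
  obtain ⟨s, -, hae⟩ := exists_subseq_trace_tendsto hΩ hΓ (((toH1L Ω).continuous.tendsto w).comp hw)
  have h1 : ∀ᵐ x ∂((Measure.hausdorffMeasure 1 : Measure Plane).restrict Γ),
      ∀ n, trace (toH1 (wn n)) x = 0 := ae_all_iff.2 fun n => hwn n
  filter_upwards [hae, h1] with x hx h1x
  refine tendsto_nhds_unique hx ?_
  simp [h1x]

theorem normalDerivVanishesOn_isSeqClosed {Ω Γ : Set Plane} (hΩ : IsLipschitzDomain Ω)
    (hΓ : Γ ⊆ frontier Ω) : IsSeqClosed {w : H2 Ω | NormalDerivVanishesOn Γ w} := by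
  intro wn w hwn hw
  have hd : ∀ i, Tendsto (fun n => derivH2 (wn n) i) atTop (𝓝 (derivH2 w i)) := fun i =>
    ((derivH2L Ω i).continuous.tendsto w).comp hw
  obtain ⟨s, hs, hae⟩ := exists_subseq_trace_tendsto hΩ hΓ (hd 0)
  -- The second subsequence is extracted from the first, so that both partial derivatives have
  -- convergent traces along it.
  obtain ⟨s', hs', hae'⟩ := exists_subseq_trace_tendsto hΩ hΓ ((hd 1).comp hs.tendsto_atTop)
  have h1 : ∀ᵐ x ∂((Measure.hausdorffMeasure 1 : Measure Plane).restrict Γ), ∀ k, ∀ n : Plane,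
      IsOuterNormal Ω x n → ∑ i, trace (derivH2 (wn k) i) x * n i = 0 := ae_all_iff.2 fun n => hwn n
  filter_upwards [hae, hae', h1] with x hx hx' h1x n hn
  have h2 : Tendsto (fun k => ∑ i, trace (derivH2 (wn (s (s' k))) i) x * n i) atTop
      (𝓝 (∑ i, trace (derivH2 w i) x * n i)) := by
    simp only [Fin.sum_univ_two]
    exact ((hx.comp hs'.tendsto_atTop).mul_const _).add (hx'.mul_const _)
  simp only [h1x _ n hn] at h2
  exact tendsto_nhds_unique h2 tendsto_const_nhds

theorem isClosed_admissible {Ω Γ : Set Plane} (hΩ : IsLipschitzDomain Ω) (hΓ : Γ ⊆ frontier Ω)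
    (i : Fin 3) : IsClosed (admissible Ω Γ i) := by
  have h1 := (vanishesOn_isSeqClosed hΩ hΓ).isClosed
  fin_cases i
  · exact h1.inter (normalDerivVanishesOn_isSeqClosed hΩ hΓ).isClosed
  · exact h1
  · exact isClosed_univ

theorem admissible_combination {Ω Γ : Set Plane} (hΩ : IsLipschitzDomain Ω) (hΓ : Γ ⊆ frontier Ω)
    {i : Fin 3} {v w : H2 Ω} (hv : v ∈ admissible Ω Γ i) (hw : w ∈ admissible Ω Γ i) (a b : ℝ) :
    a • v + b • w ∈ admissible Ω Γ i := by
  have h1 : VanishesOn Γ v → VanishesOn Γ w → VanishesOn Γ (a • v + b • w) := by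
    intro hv hw
    filter_upwards [hv, hw, trace_add_ae hΩ hΓ (toH1 v) (toH1 w) a b] with x h1 h2 h3
    have e : toH1 (a • v + b • w) = a • toH1 v + b • toH1 w := rfl
    rw [e, h3, h1, h2]
    simp
  have h2 : NormalDerivVanishesOn Γ v → NormalDerivVanishesOn Γ w →
      NormalDerivVanishesOn Γ (a • v + b • w) := by
    intro hv hw
    filter_upwards [hv, hw, trace_add_ae hΩ hΓ (derivH2 v 0) (derivH2 w 0) a b,
      trace_add_ae hΩ hΓ (derivH2 v 1) (derivH2 w 1) a b] with x h1 h2 h3 h4 n hn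
    have e : ∀ i, derivH2 (a • v + b • w) i = a • derivH2 v i + b • derivH2 w i := fun i => rfl
    have h5 := h1 n hn
    have h6 := h2 n hn
    simp only [Fin.sum_univ_two] at h5 h6 ⊢
    rw [e, e, h3, h4]
    linear_combination a * h5 + b * h6
  fin_cases i
  · exact ⟨h1 hv.1 hw.1, h2 hv.2 hw.2⟩
  · exact h1 hv hw
  · exact mem_univ _

theorem smul_mem_admissible {Ω Γ : Set Plane} (hΩ : IsLipschitzDomain Ω) (hΓ : Γ ⊆ frontier Ω)
    {i : Fin 3} {ε : ℝ} (hε : ε ≠ 0) {w : H2 Ω} :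
    ε • w ∈ admissible Ω Γ i ↔ w ∈ admissible Ω Γ i := by
  have h : ∀ (c : ℝ) (v : H2 Ω), v ∈ admissible Ω Γ i → c • v ∈ admissible Ω Γ i := fun c v hv => by
    have := admissible_combination hΩ hΓ hv hv c 0
    rwa [zero_smul, add_zero] at this
  refine ⟨fun h1 => ?_, h ε w⟩
  have := h ε⁻¹ _ h1
  rwa [smul_smul, inv_mul_cancel₀ hε, one_smul] at this

theorem convex_admissible {Ω Γ : Set Plane} (hΩ : IsLipschitzDomain Ω) (hΓ : Γ ⊆ frontier Ω)
    (i : Fin 3) : Convex ℝ (admissible Ω Γ i) :=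
  fun _ hv _ hw a b _ _ _ => admissible_combination hΩ hΓ hv hw a b

/-! ### Energies in terms of the elastic form -/

variable {Ω : Set Plane} {Y ν h : ℝ} {f : Plane → Plane}

theorem form_smul_right_L2 (α β c : ℝ) (X Z : Fin 2 → Fin 2 → L2 Ω) :
    form α β X (c • Z) = c * form α β X Z := form_smul_right α β c X Z

theorem form_smul_self_L2 (α β c : ℝ) (X : Fin 2 → Fin 2 → L2 Ω) :
    form α β (c • X) (c • X) = c ^ 2 * form α β X X := form_smul_self α β c X

theorem bendingEnergy_eq (w : H2 Ω) : bendingEnergy Y ν h w =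
    h ^ 3 / 24 * form (Y / (1 + ν)) (Y * ν / (1 - ν ^ 2)) (hessF w) (hessF w) := by
  rw [bendingEnergy, integral_J Y ν (X := hessF w) (A := hess w) fun a b => ae_eq_refl _]
  ring

theorem energy_eq (hΩ : IsLipschitzDomain Ω) (u : H1Vec Ω) (w : H2 Ω) : energy Y ν h f u w =
    h / 2 * form (Y / (1 + ν)) (Y * ν / (1 - ν ^ 2)) (strainF u + (1 / 2 : ℝ) • gradF hΩ w)
      (strainF u + (1 / 2 : ℝ) • gradF hΩ w) + bendingEnergy Y ν h w - h * loadWork f u := by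
  rw [energy, membraneEnergy, integral_J Y ν (coeFn_stretching hΩ u w)]
  ring

/-- Expansion of the square around the strain of u₀. In the cross term, the Euler-Lagrange equation
turns the part linear in E(u - u₀) into the work of the load on u - u₀; of the load term only the
work on u₀ remains. -/
theorem energy_eq_add (hΩ : IsLipschitzDomain Ω) (hf : MemLp f 2 (bdryMeasure Ω)) {u₀ : H1Vec Ω}
    (hu₀ : ∀ v, form (Y / (1 + ν)) (Y * ν / (1 - ν ^ 2)) (strainF u₀) (strainF v) = loadWork f v)
    (u : H1Vec Ω) (w : H2 Ω) : energy Y ν h f u w =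
    h / 2 * form (Y / (1 + ν)) (Y * ν / (1 - ν ^ 2)) (strainF u₀) (strainF u₀) - h * loadWork f u₀ +
    h / 2 * form (Y / (1 + ν)) (Y * ν / (1 - ν ^ 2)) (strainF (u - u₀) + (1 / 2 : ℝ) • gradF hΩ w)
      (strainF (u - u₀) + (1 / 2 : ℝ) • gradF hΩ w) +
    h / 2 * form (Y / (1 + ν)) (Y * ν / (1 - ν ^ 2)) (strainF u₀) (gradF hΩ w) +
    bendingEnergy Y ν h w := by
  have e : strainF u + (1 / 2 : ℝ) • gradF hΩ w =
      strainF u₀ + (strainF (u - u₀) + (1 / 2 : ℝ) • gradF hΩ w) := by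
    rw [strainF_sub]
    abel
  rw [energy_eq hΩ, e, form_add_self, form_add_right _ _ (strainF u₀), form_smul_right_L2,
    hu₀ (u - u₀), hΩ.loadWork_sub hf]
  ring

theorem flatEnergy_eq (hΩ : IsLipschitzDomain Ω) (hf : MemLp f 2 (bdryMeasure Ω)) {u₀ : H1Vec Ω}
    (hu₀ : ∀ v, form (Y / (1 + ν)) (Y * ν / (1 - ν ^ 2)) (strainF u₀) (strainF v) = loadWork f v)
    (u : H1Vec Ω) : flatEnergy Y ν h f u =
    h / 2 * form (Y / (1 + ν)) (Y * ν / (1 - ν ^ 2)) (strainF u₀) (strainF u₀) - h * loadWork f u₀ +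
    h / 2 * form (Y / (1 + ν)) (Y * ν / (1 - ν ^ 2)) (strainF (u - u₀)) (strainF (u - u₀)) := by
  have h1 : gradF hΩ (0 : H2 Ω) = 0 := by
    have := gradF_smul hΩ 0 (0 : H2 Ω)
    rw [zero_smul] at this
    rw [this]
    simp
  have h2 : hessF (0 : H2 Ω) = (0 : ℝ) • hessF (0 : H2 Ω) := by rw [← hessF_smul, zero_smul]
  rw [flatEnergy, energy_eq_add hΩ hf hu₀, h1, bendingEnergy_eq, h2, form_smul_self_L2, smul_zero,
    add_zero]
  have h3 := form_smul_right_L2 (Y / (1 + ν)) (Y * ν / (1 - ν ^ 2)) 0 (strainF u₀) (0 : Fin 2 → Fin 2 → L2 Ω)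
  rw [smul_zero] at h3
  rw [h3]
  ring

/-- The two eigenvalues of the elastic form are Y/(1 + ν) and, after simplification, Y/(1 - ν). -/
theorem elastic_pos (hY : 0 < Y) (hν : -1 < ν) (hν' : ν < 1 / 2) : 0 < Y / (1 + ν) ∧
    0 < Y / (1 + ν) + 2 * (Y * ν / (1 - ν ^ 2)) := by
  have h1 : 0 < 1 + ν := by linarith
  have h2 : 0 < 1 - ν := by linarith
  refine ⟨by positivity, ?_⟩
  have h3 : Y / (1 + ν) + 2 * (Y * ν / (1 - ν ^ 2)) = Y / (1 - ν) := by
    have : 1 - ν ^ 2 = (1 + ν) * (1 - ν) := by ring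
    rw [this]
    field_simp
    ring
  rw [h3]
  positivity

/-- The flat energy exceeds its value at u₀ by h/2 times a positive definite form in E(u - u₀). -/
theorem mem_flatArgmin_iff (hΩ : IsLipschitzDomain Ω) (hf : MemLp f 2 (bdryMeasure Ω)) (hY : 0 < Y)
    (hν : -1 < ν) (hν' : ν < 1 / 2) (hh : 0 < h) {u₀ : H1Vec Ω}
    (hu₀ : ∀ v, form (Y / (1 + ν)) (Y * ν / (1 - ν ^ 2)) (strainF u₀) (strainF v) = loadWork f v)
    (u : H1Vec Ω) : u ∈ flatArgmin Ω Y ν h f ↔ strainF (u - u₀) = 0 := by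
  obtain ⟨hα, hαβ⟩ := elastic_pos hY hν hν'
  have hz : form (Y / (1 + ν)) (Y * ν / (1 - ν ^ 2)) (0 : Fin 2 → Fin 2 → L2 Ω) 0 = 0 := by
    simp [form]
  constructor
  · intro hu
    have h1 := hu u₀
    have h2 : strainF (u₀ - u₀) = 0 := by rw [strainF_sub, sub_self]
    rw [flatEnergy_eq hΩ hf hu₀, flatEnergy_eq hΩ hf hu₀ u₀, h2, hz] at h1
    refine eq_zero_of_form_self hα hαβ ?_
    by_contra! h3
    have := mul_pos (half_pos hh) h3
    linarith
  · intro hu v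
    rw [flatEnergy_eq hΩ hf hu₀, flatEnergy_eq hΩ hf hu₀ v, hu, hz]
    have := mul_nonneg (half_pos hh).le (form_self_nonneg hα.le hαβ.le (strainF (v - u₀)))
    linarith

theorem flatMin_eq (hΩ : IsLipschitzDomain Ω) (hf : MemLp f 2 (bdryMeasure Ω)) (hY : 0 < Y)
    (hν : -1 < ν) (hν' : ν < 1 / 2) (hh : 0 < h) {u₀ : H1Vec Ω}
    (hu₀ : ∀ v, form (Y / (1 + ν)) (Y * ν / (1 - ν ^ 2)) (strainF u₀) (strainF v) = loadWork f v) :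
    flatMin Ω Y ν h f = h / 2 * form (Y / (1 + ν)) (Y * ν / (1 - ν ^ 2)) (strainF u₀) (strainF u₀) -
      h * loadWork f u₀ := by
  have h2 : strainF (u₀ - u₀) = 0 := by rw [strainF_sub, sub_self]
  have h3 : u₀ ∈ flatArgmin Ω Y ν h f := (mem_flatArgmin_iff hΩ hf hY hν hν' hh hu₀ u₀).2 h2
  have h4 : flatMin Ω Y ν h f = flatEnergy Y ν h f u₀ :=
    le_antisymm (ciInf_le ⟨_, by rintro _ ⟨v, rfl⟩; exact h3 v⟩ u₀) (le_ciInf h3)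
  rw [h4, flatEnergy_eq hΩ hf hu₀ u₀, h2]
  simp [form]

set_option maxHeartbeats 1000000 in
-- Replacing w by εw multiplies Dw ⊗ Dw by ε² and the Hessian by ε. After division by ε² only the
-- completed square still depends on ε.
theorem rescaledEnergy_of_mem (hΩ : IsLipschitzDomain Ω) {Γ : Set Plane} (hΓ : Γ ⊆ frontier Ω)
    (hf : MemLp f 2 (bdryMeasure Ω)) (hY : 0 < Y)
    (hν : -1 < ν) (hν' : ν < 1 / 2) (hh : 0 < h) {u₀ : H1Vec Ω}
    (hu₀ : ∀ v, form (Y / (1 + ν)) (Y * ν / (1 - ν ^ 2)) (strainF u₀) (strainF v) = loadWork f v)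
    {i : Fin 3} {ε : ℝ} (hε : ε ≠ 0) {p : H1Vec Ω × H2 Ω} (hp : p.2 ∈ admissible Ω Γ i) :
    rescaledEnergy Γ i Y ν h f ε p =
      (((ε ^ 2)⁻¹ * (h / 2 * form (Y / (1 + ν)) (Y * ν / (1 - ν ^ 2))
        (strainF (p.1 - u₀) + (ε ^ 2 / 2) • gradF hΩ p.2)
        (strainF (p.1 - u₀) + (ε ^ 2 / 2) • gradF hΩ p.2)) +
      (h / 2 * form (Y / (1 + ν)) (Y * ν / (1 - ν ^ 2)) (strainF u₀) (gradF hΩ p.2) +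
      h ^ 3 / 24 * form (Y / (1 + ν)) (Y * ν / (1 - ν ^ 2)) (hessF p.2) (hessF p.2)) : ℝ) :
        EReal) := by
  obtain ⟨w, hw⟩ : ∃ w, w = ε • p.2 := ⟨_, rfl⟩
  have hG : gradF hΩ w = ε ^ 2 • gradF hΩ p.2 := hw ▸ gradF_smul hΩ ε p.2
  have hH : hessF w = ε • hessF p.2 := hw ▸ hessF_smul ε p.2
  have hG' : (1 / 2 : ℝ) • gradF hΩ w = (ε ^ 2 / 2) • gradF hΩ p.2 := by
    rw [hG, smul_smul]
    ring_nf
  have hadm : w ∈ admissible Ω Γ i := hw ▸ (smul_mem_admissible hΩ hΓ hε).2 hp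
  have h1 := energy_eq_add (h := h) hΩ hf hu₀ p.1 w
  rw [bendingEnergy_eq, hH, form_smul_self_L2 _ _ ε (hessF p.2), hG', hG,
    form_smul_right_L2 _ _ (ε ^ 2) (strainF u₀) (gradF hΩ p.2)] at h1
  have hE : energyBC Γ i Y ν h f p.1 w = (energy Y ν h f p.1 w : EReal) := if_pos hadm
  have hR : rescaledEnergy Γ i Y ν h f ε p = (((ε ^ 2)⁻¹ : ℝ) : EReal) *
      (energyBC Γ i Y ν h f p.1 w - (flatMin Ω Y ν h f : EReal)) := by
    rw [hw]
    rfl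
  rw [hR, hE, ← EReal.coe_sub, ← EReal.coe_mul, h1, flatMin_eq hΩ hf hY hν hν' hh hu₀]
  congr 1
  have h2 : ε ^ 2 ≠ 0 := pow_ne_zero 2 hε
  field_simp
  ring

theorem rescaledEnergy_of_notMem (hΩ : IsLipschitzDomain Ω) {Γ : Set Plane} (hΓ : Γ ⊆ frontier Ω)
    {i : Fin 3} {ε : ℝ} (hε : ε ≠ 0) {p : H1Vec Ω × H2 Ω} (hp : p.2 ∉ admissible Ω Γ i) :
    rescaledEnergy Γ i Y ν h f ε p = ⊤ := by
  rw [rescaledEnergy, energyBC, if_neg (mt (smul_mem_admissible hΩ hΓ hε).1 hp), EReal.top_sub_coe,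
    EReal.coe_mul_top_of_pos (by positivity)]

/-- All minimizers share the strain of u₀, so the coupling term may be evaluated at u₀. -/
theorem limitEnergy_of_mem (hΩ : IsLipschitzDomain Ω) {Γ : Set Plane}
    (hf : MemLp f 2 (bdryMeasure Ω)) (hY : 0 < Y)
    (hν : -1 < ν) (hν' : ν < 1 / 2) (hh : 0 < h) {u₀ : H1Vec Ω}
    (hu₀ : ∀ v, form (Y / (1 + ν)) (Y * ν / (1 - ν ^ 2)) (strainF u₀) (strainF v) = loadWork f v)
    {i : Fin 3} {p : H1Vec Ω × H2 Ω} (hp1 : strainF (p.1 - u₀) = 0) (hp : p.2 ∈ admissible Ω Γ i) :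
    limitEnergy Γ i Y ν h f p =
      ((h / 2 * form (Y / (1 + ν)) (Y * ν / (1 - ν ^ 2)) (strainF u₀) (gradF hΩ p.2) +
      h ^ 3 / 24 * form (Y / (1 + ν)) (Y * ν / (1 - ν ^ 2)) (hessF p.2) (hessF p.2) : ℝ) :
        EReal) := by
  have h1 := integral_frob Y ν (X := strainF p.1) (Z := gradF hΩ p.2) (A := strain p.1)
    (B := gradTensor p.2) (fun a b => coeFn_strainL a b p.1) (coeFn_gradF hΩ p.2)
  rw [limitEnergy, if_pos ⟨(mem_flatArgmin_iff hΩ hf hY hν hν' hh hu₀ _).2 hp1, hp⟩, h1,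
    bendingEnergy_eq]
  have e : strainF p.1 = strainF u₀ := by
    rw [strainF_sub] at hp1
    exact sub_eq_zero.1 hp1
  rw [e, add_comm]

/-! ### Weak convergence -/

theorem tendsto_apply_of_weakly {ι X : Type*} [AddCommGroup X] [Module ℝ X] [TopologicalSpace X]
    [IsTopologicalAddGroup X] [ContinuousConstSMul ℝ X] {l : Filter ι} {p : ι → X} {q : X}
    (h : Tendsto (fun i => toWeakSpace ℝ X (p i)) l (𝓝 (toWeakSpace ℝ X q))) (ℓ : X →L[ℝ] ℝ) :
    Tendsto (fun i => ℓ (p i)) l (𝓝 (ℓ q)) :=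
  ((WeakBilin.eval_continuous (topDualPairing ℝ X).flip ℓ).tendsto (toWeakSpace ℝ X q)).comp h

theorem WeaklyTendsto.tendsto_apply {Ω : Set Plane} {p : ℝ → H1Vec Ω × H2 Ω} {q : H1Vec Ω × H2 Ω}
    (h : WeaklyTendsto p q) (ℓ : (H1Vec Ω × H2 Ω) →L[ℝ] ℝ) :
    Tendsto (fun ε => ℓ (p ε)) (𝓝[>] (0 : ℝ)) (𝓝 (ℓ q)) :=
  tendsto_apply_of_weakly h ℓ

instance normedSpace_H1Vec (Ω : Set Plane) : NormedSpace ℝ (H1Vec Ω) :=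
  PiLp.normedSpace 2 ℝ (fun _ : Fin 2 => H1 Ω)

set_option synthInstance.maxHeartbeats 400000 in
instance normedSpace_H2 (Ω : Set Plane) : NormedSpace ℝ (H2 Ω) := Submodule.normedSpace (H2 Ω)

/-- The uniform boundedness principle in the bidual, in which X embeds isometrically. -/
theorem exists_norm_le_of_weakly {X : Type*} [NormedAddCommGroup X] [NormedSpace ℝ X] {x : ℕ → X}
    {y : X} (h : ∀ ℓ : X →L[ℝ] ℝ, Tendsto (fun n => ℓ (x n)) atTop (𝓝 (ℓ y))) :
    ∃ M, ∀ n, ‖x n‖ ≤ M := by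
  obtain ⟨M, hM⟩ := banach_steinhaus (g := fun n => NormedSpace.inclusionInDoubleDual ℝ X (x n))
    fun ℓ => by
      obtain ⟨C, hC⟩ := (Metric.isBounded_range_of_tendsto _ (h ℓ)).exists_norm_le
      exact ⟨C, fun n => hC _ (mem_range_self n)⟩
  refine ⟨M, fun n => le_trans (le_of_eq ?_) (hM n)⟩
  exact ((NormedSpace.inclusionInDoubleDualLi ℝ (E := X)).norm_map (x n)).symm

/-- A point outside a closed convex set is strictly separated from it by a continuous functional,
which weak convergence contradicts. -/
theorem mem_of_weakly {X : Type*} [NormedAddCommGroup X] [NormedSpace ℝ X] {K : Set X}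
    (hK : Convex ℝ K) (hKc : IsClosed K) {x : ℕ → X} {y : X} (hx : ∀ n, x n ∈ K)
    (h : ∀ ℓ : X →L[ℝ] ℝ, Tendsto (fun n => ℓ (x n)) atTop (𝓝 (ℓ y))) : y ∈ K := by
  by_contra hy
  obtain ⟨ℓ, c, h1, h2⟩ := geometric_hahn_banach_closed_point hK hKc hy
  exact absurd (le_of_tendsto' (h ℓ) fun n => (h1 _ (hx n)).le) (not_le.2 h2)

theorem norm_derivH2_le {Ω : Set Plane} (w : H2 Ω) (a : Fin 2) : ‖derivH2 w a‖ ≤ ‖w‖ := by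
  refine le_of_sq_le_sq ?_ (norm_nonneg _)
  rw [norm_sq_H2 w]
  have h1 := Finset.single_le_sum (f := fun a => ‖derivH2 w a‖ ^ 2) (fun _ _ => sq_nonneg _)
    (Finset.mem_univ a)
  exact h1.trans (le_add_of_nonneg_left (sq_nonneg _))

set_option synthInstance.maxHeartbeats 400000 in
set_option maxHeartbeats 4000000 in
/-- The map `w ↦ Dw ⊗ Dw` from `H²(Ω)` to `L²(Ω)` is weak-to-strong sequentially continuous. -/
theorem tendsto_gradF {Ω : Set Plane} (hΩ : IsLipschitzDomain Ω) {wn : ℕ → H2 Ω} {w : H2 Ω}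
    (h : ∀ ℓ : H2 Ω →L[ℝ] ℝ, Tendsto (fun n => ℓ (wn n)) atTop (𝓝 (ℓ w))) (a b : Fin 2) :
    Tendsto (fun n => gradF hΩ (wn n) a b) atTop (𝓝 (gradF hΩ w a b)) := by
  obtain ⟨M, hM⟩ := @exists_norm_le_of_weakly (H2 Ω) _ (normedSpace_H2 Ω) _ _ h
  have hb : ∀ a n, ‖derivH2 (wn n) a - derivH2 w a‖ ≤ M + ‖w‖ := fun a n =>
    (norm_sub_le _ _).trans
      (add_le_add ((norm_derivH2_le _ a).trans (hM n)) (norm_derivH2_le w a))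
  have hz : ∀ a, Tendsto (fun n => valH1 (derivH2 (wn n) a - derivH2 w a)) atTop (𝓝 0) := by
    intro a
    refine hΩ.tendsto_valH1 (hb a) fun g => ?_
    have h1 := (h ((innerSL ℝ g).comp ((valL Ω).comp (derivH2L Ω a)))).sub_const
      (inner ℝ g (valH1 (derivH2 w a)))
    have h2 : ((innerSL ℝ g).comp ((valL Ω).comp (derivH2L Ω a))) w =
      inner ℝ g (valH1 (derivH2 w a)) := rfl
    rw [h2, sub_self] at h1
    refine h1.congr fun n => ?_
    have h3 : valH1 (derivH2 (wn n) a - derivH2 w a) =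
      valH1 (derivH2 (wn n) a) - valH1 (derivH2 w a) := rfl
    rw [h3, inner_sub_right]
    rfl
  exact tendsto_prodL2 hΩ (hb a) (hb b) (hz a) (hz b)

/-! ### The lower bound and the recovery families. -/

/-- A nonnegative quadratic form lies above its tangent at X. The bound is affine in Z, so lower
semicontinuity under weak convergence reduces to limits of linear functionals. -/
theorem two_mul_form_sub_le {H : Type*} [NormedAddCommGroup H] [InnerProductSpace ℝ H] {α β : ℝ}
    (h1 : 0 ≤ α) (h2 : 0 ≤ α + 2 * β) (X Z : Fin 2 → Fin 2 → H) :
    2 * form α β X Z - form α β X X ≤ form α β Z Z := by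
  have h3 := form_self_nonneg h1 h2 (Z - X)
  rw [form_sub_right, form_comm α β (Z - X) Z, form_comm α β (Z - X) X, form_sub_right,
    form_sub_right, form_comm α β Z X] at h3
  linarith

set_option synthInstance.maxHeartbeats 400000 in
set_option maxHeartbeats 4000000 in
/-- The lower bound, along sequences. -/
theorem limitEnergy_le_of_seq {Ω Γ : Set Plane} {Y ν h : ℝ} {f : Plane → Plane}
    (hΩ : IsLipschitzDomain Ω) (hΓ : Γ ⊆ frontier Ω)
    (hf : MemLp f 2 (bdryMeasure Ω)) (hY : 0 < Y)
    (hν : -1 < ν) (hν' : ν < 1 / 2) (hh : 0 < h) {u₀ : H1Vec Ω}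
    (hu₀ : ∀ v, form (Y / (1 + ν)) (Y * ν / (1 - ν ^ 2)) (strainF u₀) (strainF v) = loadWork f v)
    {i : Fin 3} {ε : ℕ → ℝ} (hε : ∀ n, 0 < ε n) (hε0 : Tendsto ε atTop (𝓝 0))
    {p : ℕ → H1Vec Ω × H2 Ω} {q : H1Vec Ω × H2 Ω}
    (hw : ∀ ℓ : (H1Vec Ω × H2 Ω) →L[ℝ] ℝ, Tendsto (fun n => ℓ (p n)) atTop (𝓝 (ℓ q)))
    {c : ℝ} (hc : ∀ n, rescaledEnergy Γ i Y ν h f (ε n) (p n) ≤ (c : EReal)) :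
    limitEnergy Γ i Y ν h f q ≤ (c : EReal) := by
  obtain ⟨hα, hαβ⟩ := elastic_pos hY hν hν'
  have hadm : ∀ n, (p n).2 ∈ admissible Ω Γ i := fun n => by
    by_contra hn
    have := hc n
    rw [rescaledEnergy_of_notMem hΩ hΓ (hε n).ne' hn] at this
    exact (EReal.coe_lt_top c).not_ge this
  have hw1 : ∀ ℓ : H1Vec Ω →L[ℝ] ℝ, Tendsto (fun n => ℓ (p n).1) atTop (𝓝 (ℓ q.1)) :=
    fun ℓ => hw (ℓ.comp (ContinuousLinearMap.fst ℝ _ _))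
  have hw2 : ∀ ℓ : H2 Ω →L[ℝ] ℝ, Tendsto (fun n => ℓ (p n).2) atTop (𝓝 (ℓ q.2)) :=
    fun ℓ => hw (ℓ.comp (ContinuousLinearMap.snd ℝ _ _))
  have hq : q.2 ∈ admissible Ω Γ i :=
    @mem_of_weakly (H2 Ω) _ (normedSpace_H2 Ω) _ (convex_admissible hΩ hΓ i) (isClosed_admissible hΩ hΓ i) _ _ hadm hw2
  have hc' : ∀ n, _ := fun n => EReal.coe_le_coe_iff.1
    ((rescaledEnergy_of_mem hΩ hΓ hf hY hν hν' hh hu₀ (hε n).ne' (hadm n)).symm.trans_le (hc n))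
  -- The only nonlinear quantity whose limit is taken; it relies on the strong convergence of Dw ⊗
  -- Dw, whereas the strains and Hessians below converge only weakly.
  have hG : ∀ X : Fin 2 → Fin 2 → L2 Ω, Tendsto (fun n =>
      form (Y / (1 + ν)) (Y * ν / (1 - ν ^ 2)) X (gradF hΩ (p n).2)) atTop
      (𝓝 (form (Y / (1 + ν)) (Y * ν / (1 - ν ^ 2)) X (gradF hΩ q.2))) := fun X =>
    tendsto_form fun a b c d => tendsto_const_nhds.inner (tendsto_gradF hΩ hw2 a b)
  have hD : ∀ X : Fin 2 → Fin 2 → L2 Ω, Tendsto (fun n =>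
      form (Y / (1 + ν)) (Y * ν / (1 - ν ^ 2)) X (strainF ((p n).1 - u₀))) atTop
      (𝓝 (form (Y / (1 + ν)) (Y * ν / (1 - ν ^ 2)) X (strainF (q.1 - u₀)))) := fun X => by
    simp only [strainF_sub, form_sub_right]
    refine Tendsto.sub_const (tendsto_form fun a b c d => ?_) _
    exact hw1 ((innerSL ℝ (X c d)).comp (strainL Ω a b))
  have hH : ∀ X : Fin 2 → Fin 2 → L2 Ω, Tendsto (fun n =>
      form (Y / (1 + ν)) (Y * ν / (1 - ν ^ 2)) X (hessF (p n).2)) atTop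
      (𝓝 (form (Y / (1 + ν)) (Y * ν / (1 - ν ^ 2)) X (hessF q.2))) := fun X =>
    tendsto_form fun a b c d =>
      hw2 ((innerSL ℝ (X c d)).comp ((derivL Ω b).comp (derivH2L Ω a)))
  have hHn := fun n => two_mul_form_sub_le hα.le hαβ.le (hessF q.2) (hessF (p n).2)
  -- The energy bound is multiplied by ε² and the squares are replaced by their tangents at D and at
  -- the limit Hessian. In the limit only (h/2) times the form of D survives on the left, and it is
  -- at most zero.
  have hD0 : strainF (q.1 - u₀) = 0 := by
    refine eq_zero_of_form_self hα hαβ ?_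
    set D := strainF (q.1 - u₀)
    have hle : ∀ n, h / 2 * (2 * (form (Y / (1 + ν)) (Y * ν / (1 - ν ^ 2)) D
          (strainF ((p n).1 - u₀)) + ε n ^ 2 / 2 * form (Y / (1 + ν)) (Y * ν / (1 - ν ^ 2)) D
          (gradF hΩ (p n).2)) - form (Y / (1 + ν)) (Y * ν / (1 - ν ^ 2)) D D) +
        ε n ^ 2 * (h / 2 * form (Y / (1 + ν)) (Y * ν / (1 - ν ^ 2)) (strainF u₀)
          (gradF hΩ (p n).2) + h ^ 3 / 24 * (2 * form (Y / (1 + ν)) (Y * ν / (1 - ν ^ 2))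
          (hessF q.2) (hessF (p n).2) - form (Y / (1 + ν)) (Y * ν / (1 - ν ^ 2))
          (hessF q.2) (hessF q.2))) ≤ ε n ^ 2 * c := fun n => by
      have hε2 : 0 < ε n ^ 2 := pow_pos (hε n) 2
      have h1 := two_mul_form_sub_le hα.le hαβ.le D
        (strainF ((p n).1 - u₀) + (ε n ^ 2 / 2) • gradF hΩ (p n).2)
      rw [form_add_right, form_smul_right_L2] at h1
      have h2 := mul_le_mul_of_nonneg_left (hc' n) hε2.le
      rw [mul_add, mul_inv_cancel_left₀ hε2.ne'] at h2
      have h3 := mul_le_mul_of_nonneg_left h1 (half_pos hh).le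
      have h4 := mul_le_mul_of_nonneg_left (hHn n) (by positivity : 0 ≤ ε n ^ 2 * (h ^ 3 / 24))
      linarith
    have hε2 : Tendsto (fun n => ε n ^ 2) atTop (𝓝 0) := by
      have := hε0.pow 2
      rwa [zero_pow two_ne_zero] at this
    have hε2' : Tendsto (fun n => ε n ^ 2 / 2) atTop (𝓝 0) := by
      have := hε2.div_const 2
      rwa [zero_div] at this
    have hlim := le_of_tendsto_of_tendsto'
      (((((hD D).add (hε2'.mul (hG D))).const_mul 2).sub_const _ |>.const_mul (h / 2)).add
        (hε2.mul (((hG (strainF u₀)).const_mul (h / 2)).add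
          ((((hH (hessF q.2)).const_mul 2).sub_const _).const_mul (h ^ 3 / 24)))))
      (hε2.mul_const c) hle
    simp only [zero_mul, add_zero] at hlim
    by_contra! hpos
    have := mul_pos (half_pos hh) hpos
    linarith
  rw [limitEnergy_of_mem hΩ hf hY hν hν' hh hu₀ hD0 hq, EReal.coe_le_coe_iff]
  -- Here the completed square is discarded as nonnegative, and the bending term is bounded below by
  -- its tangent at the limit Hessian.
  have hlim := le_of_tendsto' (((hG (strainF u₀)).const_mul (h / 2)).add
    ((((hH (hessF q.2)).const_mul 2).sub_const
      (form (Y / (1 + ν)) (Y * ν / (1 - ν ^ 2)) (hessF q.2) (hessF q.2))).const_mul (h ^ 3 / 24)))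
    (b := c) fun n => by
      have hε2 : 0 < ε n ^ 2 := pow_pos (hε n) 2
      have h1 := form_self_nonneg hα.le hαβ.le
        (strainF ((p n).1 - u₀) + (ε n ^ 2 / 2) • gradF hΩ (p n).2)
      have h2 := mul_nonneg (inv_pos.2 hε2).le (mul_nonneg (half_pos hh).le h1)
      have h3 := mul_le_mul_of_nonneg_left (hHn n) (by positivity : 0 ≤ h ^ 3 / 24)
      have h4 := hc' n
      linarith
  linarith

set_option synthInstance.maxHeartbeats 400000 in
set_option maxHeartbeats 4000000 in
/-- The lower bound. -/
theorem limitEnergy_le_liminf {Ω Γ : Set Plane} {Y ν h : ℝ} {f : Plane → Plane}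
    (hΩ : IsLipschitzDomain Ω) (hΓ : Γ ⊆ frontier Ω)
    (hf : MemLp f 2 (bdryMeasure Ω)) (hY : 0 < Y)
    (hν : -1 < ν) (hν' : ν < 1 / 2) (hh : 0 < h) {u₀ : H1Vec Ω}
    (hu₀ : ∀ v, form (Y / (1 + ν)) (Y * ν / (1 - ν ^ 2)) (strainF u₀) (strainF v) = loadWork f v)
    {i : Fin 3} {p : ℝ → H1Vec Ω × H2 Ω} {q : H1Vec Ω × H2 Ω} (hw : WeaklyTendsto p q) :
    limitEnergy Γ i Y ν h f q ≤
      liminf (fun ε => rescaledEnergy Γ i Y ν h f ε (p ε)) (𝓝[>] (0 : ℝ)) := by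
  by_contra! hlt
  -- A real number strictly between the liminf and the limit energy bounds the energies along some
  -- sequence of scales; this reduces the filter statement to sequences, to which weak compactness
  -- arguments apply.
  obtain ⟨c, hc1, hc2⟩ := EReal.lt_iff_exists_real_btwn.1 hlt
  have hfreq : ∃ᶠ ε in 𝓝[>] (0 : ℝ), rescaledEnergy Γ i Y ν h f ε (p ε) < (c : EReal) :=
    frequently_lt_of_liminf_lt (by isBoundedDefault) hc1
  have hpos : ∀ᶠ ε : ℝ in 𝓝[>] (0 : ℝ), 0 < ε := self_mem_nhdsWithin
  obtain ⟨ε, hε, hlt'⟩ := exists_seq_forall_of_frequently (hfreq.and_eventually hpos)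
  refine absurd (limitEnergy_le_of_seq hΩ hΓ hf hY hν hν' hh hu₀ (fun n => (hlt' n).2)
    (tendsto_nhds_of_tendsto_nhdsWithin hε) (p := fun n => p (ε n)) (q := q)
    (fun ℓ => (hw.tendsto_apply ℓ).comp hε) (fun n => (hlt' n).1.le)) (not_le.2 hc2)

/-- Constant families are recovery sequences. -/
theorem tendsto_rescaledEnergy {Ω Γ : Set Plane} {Y ν h : ℝ} {f : Plane → Plane}
    (hΩ : IsLipschitzDomain Ω) (hΓ : Γ ⊆ frontier Ω)
    (hf : MemLp f 2 (bdryMeasure Ω)) (hY : 0 < Y)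
    (hν : -1 < ν) (hν' : ν < 1 / 2) (hh : 0 < h) {u₀ : H1Vec Ω}
    (hu₀ : ∀ v, form (Y / (1 + ν)) (Y * ν / (1 - ν ^ 2)) (strainF u₀) (strainF v) = loadWork f v)
    {i : Fin 3} (q : H1Vec Ω × H2 Ω) :
    Tendsto (fun ε => rescaledEnergy Γ i Y ν h f ε q) (𝓝[>] (0 : ℝ))
      (𝓝 (limitEnergy Γ i Y ν h f q)) := by
  -- The constant family converges weakly, so the lower bound applies to it; it is all that is
  -- needed where the limit energy is infinite.
  have hliminf := limitEnergy_le_liminf hΩ hΓ hf hY hν hν' hh hu₀ (i := i) (p := fun _ => q) (q := q)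
    tendsto_const_nhds
  refine tendsto_of_le_liminf_of_limsup_le hliminf ?_
  by_cases hq : q.1 ∈ flatArgmin Ω Y ν h f ∧ q.2 ∈ admissible Ω Γ i
  · have hD := (mem_flatArgmin_iff hΩ hf hY hν hν' hh hu₀ q.1).1 hq.1
    rw [limitEnergy_of_mem hΩ hf hY hν hν' hh hu₀ hD hq.2]
    set g := form (Y / (1 + ν)) (Y * ν / (1 - ν ^ 2)) (gradF hΩ q.2) (gradF hΩ q.2) with hg
    set e := h / 2 * form (Y / (1 + ν)) (Y * ν / (1 - ν ^ 2)) (strainF u₀) (gradF hΩ q.2) +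
      h ^ 3 / 24 * form (Y / (1 + ν)) (Y * ν / (1 - ν ^ 2)) (hessF q.2) (hessF q.2) with he
    -- At a minimizer the completed square reduces to (h/2)(ε²/2)² g, which after division by ε² is
    -- ε² (h/8) g.
    have hlim : Tendsto (fun ε : ℝ => ((ε ^ 2 * (h / 8 * g) + e : ℝ) : EReal)) (𝓝[>] (0 : ℝ))
        (𝓝 (e : EReal)) := by
      refine (continuous_coe_real_ereal.tendsto e).comp ?_
      have h1 : Continuous fun ε : ℝ => ε ^ 2 * (h / 8 * g) + e := by fun_prop
      have h2 := h1.tendsto 0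
      simp only [ne_eq, OfNat.ofNat_ne_zero, not_false_eq_true, zero_pow, zero_mul, zero_add] at h2
      exact h2.mono_left nhdsWithin_le_nhds
    refine (Tendsto.congr' ?_ hlim).limsup_eq.le
    filter_upwards [self_mem_nhdsWithin] with ε hε
    have hε' : ε ≠ 0 := (mem_Ioi.1 hε).ne'
    rw [rescaledEnergy_of_mem hΩ hΓ hf hY hν hν' hh hu₀ hε' hq.2, hD, zero_add,
      form_smul_self_L2, ← hg, ← he]
    congr 2
    field_simp
    ring
  · have h1 : limitEnergy Γ i Y ν h f q = ⊤ := if_neg hq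
    rw [h1]
    exact le_top

end FvK

end

/-! ### Existence of minimizers of the flat plate and Γ-convergence. -/

theorem proposition2p1 (Ω : Set FvK.Plane) (hΩ : FvK.IsLipschitzDomain Ω)
    (Γ : Set FvK.Plane) (hΓ : Γ ⊆ frontier Ω) (hΓmeas : MeasurableSet Γ)
    (hΓpos : 0 < (Measure.hausdorffMeasure 1 : Measure FvK.Plane) Γ)
    (Y ν h : ℝ) (hY : 0 < Y) (hν : -1 < ν) (hν' : ν < 1 / 2) (hh : 0 < h)
    (f : FvK.Plane → FvK.Plane) (hf : MemLp f 2 (FvK.bdryMeasure Ω))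
    (hequil : FvK.Equilibrated Ω f) (i : Fin 3) :
    (FvK.flatArgmin Ω Y ν h f).Nonempty ∧
    (∀ (p : ℝ → FvK.H1Vec Ω × FvK.H2 Ω) (q : FvK.H1Vec Ω × FvK.H2 Ω),
      FvK.WeaklyTendsto p q →
        FvK.limitEnergy Γ i Y ν h f q ≤
          liminf (fun ε => FvK.rescaledEnergy Γ i Y ν h f ε (p ε)) (𝓝[>] (0 : ℝ))) ∧
    (∀ q : FvK.H1Vec Ω × FvK.H2 Ω, ∃ p : ℝ → FvK.H1Vec Ω × FvK.H2 Ω,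
      FvK.WeaklyTendsto p q ∧
        Tendsto (fun ε => FvK.rescaledEnergy Γ i Y ν h f ε (p ε)) (𝓝[>] (0 : ℝ))
          (𝓝 (FvK.limitEnergy Γ i Y ν h f q))) := by
  obtain ⟨hα, hαβ⟩ := FvK.elastic_pos hY hν hν'
  obtain ⟨u₀, hu₀⟩ := hΩ.exists_euler_lagrange hf hequil hα hαβ
  refine ⟨⟨u₀, ?_⟩, fun p q hw => ?_, fun q => ⟨fun _ => q, tendsto_const_nhds, ?_⟩⟩
  · rw [FvK.mem_flatArgmin_iff hΩ hf hY hν hν' hh hu₀, FvK.strainF_sub, sub_self]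
  · exact FvK.limitEnergy_le_liminf hΩ hΓ hf hY hν hν' hh hu₀ hw
  · exact FvK.tendsto_rescaledEnergy hΩ hΓ hf hY hν hν' hh hu₀ q
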